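/- **Setting.** For a set $X$ let $\mathcal F(l^2(X))=\bigoplus_{k\ge 0}\wedge^k l^2(X)$ be the antisymmetric Fock space over $l^2(X)$, let $c^*(x)$, $x\in l^2(X)$, be the creation operators $x_1\wedge\dots\wedge x_k\mapsto x\wedge x_1\wedge\dots\wedge x_k$ on it and $c(x)=(c^*(x))^*$ the annihilation operators. $\mathrm{CAR}(l^2(X))$ is the $C^*$-algebra generated by the $c(x)$, $x\in l^2(X)$; for finite $X$ it is the algebra of all operators on $\mathcal F(l^2(X))$. A state $\omega_Q$ on $\mathrm{CAR}(l^2(X))$ is quasi-free with symbol $Q\in\mathcal B(l^2(X))$ if for all $n,m$ and all $x_i,y_j\in l^2(X)$ $$\omega_Q\big(c(x_1)^*\cdots c(x_n)^*c(y_m)\cdots c(y_1)\big)=\delta_{m,n}\det\{\langle y_i,Qx_j\rangle\}_{i,j=1}^n ,$$ where inner products are linear in the second variable. Let $F:l^2(\mathbb Z^\nu)\to L^2\big([0,2\pi)^\nu,(2\pi)^{-\nu}d\mathbf x\big)$ be the Fourier transformation $\mathbf 1_{\{\mathbf k\}}\mapsto e^{i\langle \mathbf k,\cdot\rangle}$,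 and $M_{\hat a}$ the operator of multiplication by $\hat a$. **Proposition 4.1.** Let $\hat q,\hat r$ be measurable real functions on $[0,2\pi)^\nu$, and suppose that $\eta\le\hat q\le 1-\eta$ and $\eta\le \hat r\le 1-\eta$ for some $\eta\in(0,1/2)$. Let $\omega_Q$ and $\omega_R$ be the (shift-invariant) quasi-free states on $\mathrm{CAR}(l^2(\mathbb Z^\nu))$ with symbols $Q=F^{-1}M_{\hat q}F$ and $R=F^{-1}M_{\hat r}F$. For $n\in\mathbb N$ let $\mathcal H_n=\mathrm{span}\{\mathbf 1_{\{\mathbf k\}}:\mathbf k\in\{0,\dots,n-1\}^\nu\}$, and let $\hat\rho_n$ and $\hat\sigma_n$ be the densities of the restrictions of $\omega_Q$ and $\omega_R$ to $\mathrm{CAR}(\mathcal H_n)\cong\mathcal B(\mathcal F(\mathcal H_n))$, that is, $\omega_Q(A)=\mathrm{Tr}\,\hat\rho_nA$ and $\omega_R(A)=\mathrm{Tr}\,\hat\sigma_nA$ for $A\in \mathrm{CAR}(\mathcal H_n)$. Then the limits $$S_M(\omega_Q\|\omega_R)=\lim_{n\to\infty}\frac1{n^\nu}\mathrm{Tr}\,\hat\rho_n(\log\hat\rho_n-\log\hat\sigma_n),\qquad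 \psi(t)=\lim_{n\to\infty}\frac1{n^\nu}\log\mathrm{Tr}\,\hat\rho_n^{\,t}\hat\sigma_n^{\,1-t}\quad(t\in\mathbb R)$$ exist as real numbers, $$S_M(\omega_Q\|\omega_R)=\frac1{(2\pi)^\nu}\int_{[0,2\pi)^\nu}\Big[\hat q(\mathbf x)\log\frac{\hat q(\mathbf x)}{\hat r(\mathbf x)}+(1-\hat q(\mathbf x))\log\frac{1-\hat q(\mathbf x)}{1-\hat r(\mathbf x)}\Big]d\mathbf x ,$$ $$\psi(t)=\frac1{(2\pi)^\nu}\int_{[0,2\pi)^\nu}\log\Big[\hat q(\mathbf x)^t\hat r(\mathbf x)^{1-t}+(1-\hat q(\mathbf x))^t(1-\hat r(\mathbf x))^{1-t}\Big]d\mathbf x\qquad(t\in\mathbb R).$$ Moreover, $\psi$ is differentiable on $\mathbb R$, and $\psi'(1)=S_M(\omega_Q\|\omega_R)$. -/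

import Mathlib

open MeasureTheory Filter Topology
open scoped ComplexOrder InnerProductSpace

namespace QuasiFree

/-! ### The antisymmetric Fock space over `l²(X)` -/

/-- The Hilbert space `l²(X)`. -/
abbrev EllTwo (X : Type*) : Type _ := lp (fun _ : X => ℂ) 2

/-- The standard basis vector of `l²(X)` at the point `k`. -/
noncomputable def delta {X : Type*} [DecidableEq X] (k : X) : EllTwo X :=
  lp.single 2 k (1 : ℂ)

/-- The antisymmetric Fock space over `l²(X)`, in its occupation number representation.
For a linearly ordered set `X` the vectors `1_{s₁} ∧ ... ∧ 1_{s_k}` with `s₁ < ... < s_k` in `X` and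
`k = 0, 1, 2, ...` form an orthonormal basis of the antisymmetric Fock space; such a vector is the
standard basis vector of `l²(Finset X)` at `S = {s₁, ..., s_k}`; the vacuum is the one at `S = ∅`. -/
abbrev Fock (X : Type*) : Type _ := EllTwo (Finset X)

section CreationAnnihilation

variable {X : Type*} [LinearOrder X]

/-- `(-1)` to the number of elements of `S` that lie strictly below `j`: the sign of the permutation
which sorts `1_j ∧ 1_{s₁} ∧ ... ∧ 1_{s_k}`. -/
def sgn (j : X) (S : Finset X) : ℂ := (-1) ^ (S.filter (fun s => s < j)).card

theorem norm_sgn (j : X) (S : Finset X) : ‖sgn j S‖ = 1 := by simp [sgn]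

theorem sgn_mul_self (j : X) (S : Finset X) : sgn j S * sgn j S = 1 := by
  unfold sgn; rw [← mul_pow]; simp

theorem conj_sgn (j : X) (S : Finset X) : (starRingEnd ℂ) (sgn j S) = sgn j S := by simp [sgn]

theorem sgn_insert (j i : X) (S : Finset X) (h : i ∉ S) :
    sgn j (insert i S) = if i < j then - sgn j S else sgn j S := by
  unfold sgn
  rw [Finset.filter_insert]
  split_ifs with hij
  · rw [Finset.card_insert_of_notMem (by simp [h]), pow_succ]; ring
  · rfl

theorem sgn_erase (j i : X) (S : Finset X) (h : i ∈ S) :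
    sgn j (S.erase i) = if i < j then - sgn j S else sgn j S := by
  have := sgn_insert j i (S.erase i) (by simp)
  rw [Finset.insert_erase h] at this
  rw [this]; split_ifs <;> simp

/-- The function `1_j ∧ ψ`. -/
def creationFun (j : X) (ψ : Finset X → ℂ) (T : Finset X) : ℂ :=
  if j ∈ T then sgn j T * ψ (T.erase j) else 0

theorem creationFun_sum_le (j : X) (ψ : Fock X) (s : Finset (Finset X)) :
    ∑ T ∈ s, ‖creationFun j ψ T‖ ^ (2 : ENNReal).toReal ≤ ‖ψ‖ ^ (2 : ENNReal).toReal := by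
  have h1 : ∑ T ∈ s, ‖creationFun j ψ T‖ ^ (2 : ENNReal).toReal
      = ∑ T ∈ s.filter (fun T => j ∈ T), ‖ψ (T.erase j)‖ ^ (2 : ENNReal).toReal := by
    rw [Finset.sum_filter]
    refine Finset.sum_congr rfl fun T _ => ?_
    unfold creationFun
    split_ifs
    · rw [norm_mul, norm_sgn, one_mul]
    · simp
  rw [h1, ← Finset.sum_image (f := fun S => ‖ψ S‖ ^ (2 : ENNReal).toReal)
    (g := fun T : Finset X => T.erase j)]
  · exact lp.sum_rpow_le_norm_rpow (by norm_num) ψ _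
  · intro T hT T' hT' h
    simp only [Finset.coe_filter, Set.mem_ofPred_eq] at hT hT'
    have h' : T.erase j = T'.erase j := h
    rw [← Finset.insert_erase hT.2, ← Finset.insert_erase hT'.2, h']

/-- The creation operator of the basis vector at `j`: it maps the basis vector of the Fock space at
`S` to `sgn j S` times the one at `S ∪ {j}` if `j ∉ S`, and to `0` if `j ∈ S`. -/
noncomputable def siteCreation (j : X) : Fock X →L[ℂ] Fock X :=
  LinearMap.mkContinuous
    { toFun := fun ψ => ⟨creationFun j ψ, memℓp_gen' (creationFun_sum_le j ψ)⟩
      map_add' := fun φ ψ => by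
        ext T
        simp only [creationFun, lp.coeFn_add, Pi.add_apply]
        split_ifs <;> ring
      map_smul' := fun a ψ => by
        ext T
        simp only [creationFun, lp.coeFn_smul, Pi.smul_apply, smul_eq_mul, RingHom.id_apply]
        split_ifs <;> ring } 1
    (fun ψ => by
      rw [one_mul]
      exact lp.norm_le_of_forall_sum_le (by norm_num) (norm_nonneg _) (creationFun_sum_le j ψ))

theorem siteCreation_apply (j : X) (ψ : Fock X) (T : Finset X) :
    siteCreation j ψ T = if j ∈ T then sgn j T * ψ (T.erase j) else 0 := rfl

theorem siteCreation_delta (j : X) (S : Finset X) :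
    siteCreation j (delta S) = if j ∈ S then 0 else sgn j S • delta (insert j S) := by
  ext T
  rw [siteCreation_apply]
  by_cases hS : j ∈ S
  · by_cases hT : j ∈ T
    · have : T.erase j ≠ S := fun h => by rw [← h] at hS; simp at hS
      simp [hS, hT, delta, lp.single_apply, this]
    · simp [hS, hT]
  · by_cases hT : j ∈ T
    · by_cases h : T = insert j S
      · subst h
        simp [hS, delta, lp.single_apply, sgn_insert j j S hS]
      · have : T.erase j ≠ S := fun h' => h (by rw [← h', Finset.insert_erase hT])
        simp [hS, hT, delta, lp.single_apply, this, h]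
    · have : T ≠ insert j S := fun h => hT (by simp [h])
      simp [hS, hT, delta, lp.single_apply, this]

theorem adjoint_siteCreation_apply (j : X) (ψ : Fock X) (S : Finset X) :
    (siteCreation j).adjoint ψ S = if j ∈ S then 0 else sgn j S * ψ (insert j S) := by
  have h : ⟪(delta S : Fock X), (siteCreation j).adjoint ψ⟫_ℂ = (siteCreation j).adjoint ψ S := by
    simp [delta, lp.inner_single_left]
  rw [← h, ContinuousLinearMap.adjoint_inner_right, siteCreation_delta]
  split_ifs
  · simp
  · simp [delta, inner_smul_left, lp.inner_single_left, conj_sgn]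

theorem site_car (i j : X) :
    (siteCreation i).adjoint * siteCreation j + siteCreation j * (siteCreation i).adjoint
      = (if i = j then (1 : ℂ) else 0) • (1 : Fock X →L[ℂ] Fock X) := by
  ext ψ S
  change (siteCreation i).adjoint (siteCreation j ψ) S
    + siteCreation j ((siteCreation i).adjoint ψ) S = (if i = j then (1 : ℂ) else 0) * ψ S
  simp only [adjoint_siteCreation_apply, siteCreation_apply]
  by_cases hij : i = j
  · subst hij
    by_cases hi : i ∈ S
    · simp [hi, sgn_erase, ← mul_assoc, sgn_mul_self]
    · simp [hi, sgn_insert, ← mul_assoc, sgn_mul_self]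
  · by_cases hi : i ∈ S
    · simp [hij, hi]
    · by_cases hj : j ∈ S
      · have hji : ¬ j = i := fun h => hij h.symm
        rw [Finset.erase_insert_of_ne hij]
        simp only [hi, hj, hij, sgn_insert _ _ _ hi, sgn_erase _ _ _ hj, Finset.mem_insert,
          Finset.mem_erase, or_true, and_false, if_true, if_false]
        rcases lt_or_gt_of_ne hij with h | h
        · simp only [h, not_lt_of_gt h, if_true, if_false]; ring
        · simp only [h, not_lt_of_gt h, if_true, if_false]; ring
      · have hji : ¬ j = i := fun h => hij h.symm
        simp [hij, hi, hj, hji]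

theorem norm_sum_siteCreation_le (x : X → ℂ) (s : Finset X) :
    ‖∑ j ∈ s, x j • siteCreation j‖ ≤ Real.sqrt (∑ j ∈ s, ‖x j‖ ^ 2) := by
  set A := ∑ j ∈ s, x j • siteCreation j with hA
  have hcar : A.adjoint * A + A * A.adjoint
      = ((∑ j ∈ s, ‖x j‖ ^ 2 : ℝ) : ℂ) • (1 : Fock X →L[ℂ] Fock X) := by
    have hadj : A.adjoint = ∑ i ∈ s, (starRingEnd ℂ) (x i) • (siteCreation i).adjoint := by
      rw [hA, map_sum]
      exact Finset.sum_congr rfl fun i _ => by rw [map_smulₛₗ]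
    rw [hadj, hA, Finset.sum_mul_sum, Finset.sum_mul_sum,
      Finset.sum_comm (s := s) (t := s) (f := fun i j => x i • siteCreation i *
        (starRingEnd ℂ) (x j) • (siteCreation j).adjoint), ← Finset.sum_add_distrib]
    have : ∀ i ∈ s, (∑ j ∈ s, (starRingEnd ℂ) (x i) • (siteCreation i).adjoint *
          x j • siteCreation j) + (∑ j ∈ s, x j • siteCreation j *
          (starRingEnd ℂ) (x i) • (siteCreation i).adjoint)
        = ((‖x i‖ ^ 2 : ℝ) : ℂ) • (1 : Fock X →L[ℂ] Fock X) := by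
      intro i hi
      rw [← Finset.sum_add_distrib, Finset.sum_eq_single i]
      · rw [smul_mul_smul_comm, smul_mul_smul_comm, mul_comm (x i), ← smul_add, site_car]
        simp [Complex.conj_mul']
      · intro j _ hj
        rw [smul_mul_smul_comm, smul_mul_smul_comm, mul_comm (x j), ← smul_add, site_car]
        simp [hj.symm]
      · exact fun h => absurd hi h
    rw [Finset.sum_congr rfl this, ← Finset.sum_smul, Complex.ofReal_sum]
  refine ContinuousLinearMap.opNorm_le_bound _ (Real.sqrt_nonneg _) fun ψ => ?_
  have h1 : ⟪ψ, (A.adjoint * A + A * A.adjoint) ψ⟫_ℂ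
      = ((‖A ψ‖ ^ 2 + ‖A.adjoint ψ‖ ^ 2 : ℝ) : ℂ) := by
    change ⟪ψ, A.adjoint (A ψ) + A (A.adjoint ψ)⟫_ℂ = _
    rw [inner_add_right, ContinuousLinearMap.adjoint_inner_right,
      ← ContinuousLinearMap.adjoint_inner_left A (A.adjoint ψ) ψ, inner_self_eq_norm_sq_to_K,
      inner_self_eq_norm_sq_to_K]
    push_cast; rfl
  rw [hcar, smul_apply, one_apply_eq_self, inner_smul_right, inner_self_eq_norm_sq_to_K] at h1
  have h2 : (∑ j ∈ s, ‖x j‖ ^ 2) * ‖ψ‖ ^ 2 = ‖A ψ‖ ^ 2 + ‖A.adjoint ψ‖ ^ 2 := by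
    refine Complex.ofReal_injective (Eq.trans ?_ h1)
    push_cast
    rfl
  rw [← Real.sqrt_sq (norm_nonneg ψ), ← Real.sqrt_mul (Finset.sum_nonneg fun _ _ => by positivity)]
  exact Real.le_sqrt_of_sq_le (by nlinarith [sq_nonneg ‖A.adjoint ψ‖])

theorem summable_creation (x : EllTwo X) : Summable fun j => x j • siteCreation j := by
  have hx : Summable fun j => ‖x j‖ ^ 2 := by
    simpa using (lp.memℓp x).summable (by norm_num)
  rw [summable_iff_vanishing_norm]
  intro ε hε
  obtain ⟨s, hs⟩ := summable_iff_vanishing_norm.1 hx (ε ^ 2) (by positivity)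
  refine ⟨s, fun t ht => lt_of_le_of_lt (norm_sum_siteCreation_le x t) ?_⟩
  have := lt_of_le_of_lt (le_abs_self _) (hs t ht)
  exact (Real.sqrt_lt' hε).2 this

/-- The creation operator `c*(x) : ψ ↦ x ∧ ψ` for `x ∈ l²(X)`, as the operator-norm convergent sum
`∑ x_j c*(1_j)`. -/
noncomputable def creation (x : EllTwo X) : Fock X →L[ℂ] Fock X :=
  ∑' j, x j • siteCreation j

/-- The annihilation operator `c(x)`, the adjoint of `c*(x)`. -/
noncomputable def annihilation (x : EllTwo X) : Fock X →L[ℂ] Fock X :=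
  (creation x).adjoint

/-- The canonical anticommutation relation `c(x) c*(y) + c*(y) c(x) = ⟨x, y⟩ 1`. -/
theorem car (x y : EllTwo X) :
    annihilation x * creation y + creation y * annihilation x
      = ⟪x, y⟫_ℂ • (1 : Fock X →L[ℂ] Fock X) := by
  have hy : HasSum (fun j => y j • siteCreation j) (creation y) := (summable_creation y).hasSum
  have hx : HasSum (fun i => (starRingEnd ℂ) (x i) • (siteCreation i).adjoint)
      (annihilation x) := by
    have := (summable_creation x).hasSum.mapL
      (ContinuousLinearMap.adjoint (𝕜 := ℂ) (E := Fock X)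
        (F := Fock X)).toContinuousLinearEquiv.toContinuousLinearMap
    simpa [map_smulₛₗ, annihilation, creation] using this
  have h1 : ∀ j, annihilation x * siteCreation j + siteCreation j * annihilation x
      = (starRingEnd ℂ) (x j) • (1 : Fock X →L[ℂ] Fock X) := by
    intro j
    refine ((hx.mul_right (siteCreation j)).add (hx.mul_left (siteCreation j))).unique ?_
    have : (fun i => (starRingEnd ℂ) (x i) • (siteCreation i).adjoint * siteCreation j
        + siteCreation j * (starRingEnd ℂ) (x i) • (siteCreation i).adjoint)
        = fun i => if i = j then (starRingEnd ℂ) (x j) • (1 : Fock X →L[ℂ] Fock X) else 0 := by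
      funext i
      rw [smul_mul_assoc, mul_smul_comm, ← smul_add, site_car]
      split_ifs with h <;> simp [h]
    rw [this]
    exact hasSum_ite_eq j _
  refine ((hy.mul_left (annihilation x)).add (hy.mul_right (annihilation x))).unique ?_
  have h2 : (fun j => annihilation x * y j • siteCreation j
      + y j • siteCreation j * annihilation x)
      = fun j => ⟪x j, y j⟫_ℂ • (1 : Fock X →L[ℂ] Fock X) := by
    funext j
    rw [smul_mul_assoc, mul_smul_comm, ← smul_add, h1, smul_smul]
    simp
  rw [h2]
  exact (lp.hasSum_inner x y).smul_const _

end CreationAnnihilation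

/-! ### The CAR algebra, its states, and local restrictions -/

section CARAlgebra

variable {X : Type*} [LinearOrder X]

/-- `CAR(l²(X))`, the `C*`-algebra on the Fock space generated by all `c(x)`, `x ∈ l²(X)`. -/
noncomputable def CAR (X : Type*) [LinearOrder X] : StarSubalgebra ℂ (Fock X →L[ℂ] Fock X) :=
  (StarAlgebra.adjoin ℂ (Set.range (annihilation (X := X)))).topologicalClosure

/-- The annihilation operator `c(x)` as an element of the CAR algebra. -/
noncomputable def c (x : EllTwo X) : CAR X :=
  ⟨annihilation x, StarSubalgebra.le_topologicalClosure _
    (StarAlgebra.subset_adjoin ℂ _ (Set.mem_range_self x))⟩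

/-- A state: a linear functional that is positive and normalized. -/
structure IsState (ω : CAR X →ₗ[ℂ] ℂ) : Prop where
  map_one : ω 1 = 1
  nonneg : ∀ a : CAR X, 0 ≤ ω (star a * a)

/-- `ω` is the quasi-free state with symbol `Q`: it is a state and
`ω(c(x₁)* ... c(xₙ)* c(yₘ) ... c(y₁)) = δ_{m,n} det (⟨y_i, Q x_j⟩)_{i,j}`. -/
structure IsQuasiFree (ω : CAR X →ₗ[ℂ] ℂ) (Q : EllTwo X →L[ℂ] EllTwo X) : Prop where
  isState : IsState ω
  apply_eq : ∀ (n : ℕ) (x y : Fin n → EllTwo X),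
    ω ((List.ofFn fun i => star (c (x i))).prod * (List.ofFn fun i => c (y i)).reverse.prod)
      = (Matrix.of fun i j => ⟪y i, Q (x j)⟫_ℂ).det
  apply_ne : ∀ (n m : ℕ) (x : Fin n → EllTwo X) (y : Fin m → EllTwo X), n ≠ m →
    ω ((List.ofFn fun i => star (c (x i))).prod * (List.ofFn fun i => c (y i)).reverse.prod) = 0

/-- For a finite `Λ ⊆ X`, the subalgebra `CAR(l²(Λ))` of `CAR(l²(X))`, generated by the `c(x)` with
`x ∈ l²(Λ) = span {1_k : k ∈ Λ}`. It is finite-dimensional, hence already closed. -/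
noncomputable def localCAR (Λ : Finset X) : StarSubalgebra ℂ (CAR X) :=
  StarAlgebra.adjoin ℂ (c '' (Submodule.span ℂ (delta '' (Λ : Set X)) : Set (EllTwo X)))

/-- The index set of the orthonormal basis of the Fock space over `l²(Λ)`. -/
abbrev FockIndex (Λ : Finset X) : Type _ := {S : Finset X // S ∈ Λ.powerset}

/-- Operators on the finite-dimensional Fock space over `l²(Λ)`, written as matrices with respect to
its orthonormal basis of the vectors `1_{s₁} ∧ ... ∧ 1_{s_k}`, `s₁ < ... < s_k` in `Λ`. -/
abbrev LocalOp (Λ : Finset X) : Type _ := Matrix (FockIndex Λ) (FockIndex Λ) ℂ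

/-- The Fock space over `l²(Λ)` is a subspace of the Fock space over `l²(X)` which is invariant under
`CAR(l²(Λ))`. For `A` in this algebra `localize Λ A` is the restriction of `A` to that subspace; this
is the identification of `CAR(l²(Λ))` with the algebra of all operators on the Fock space over
`l²(Λ)`. -/
noncomputable def localize (Λ : Finset X) (A : CAR X) : LocalOp Λ :=
  Matrix.of fun S T => ⟪(delta S.1 : Fock X), (A : Fock X →L[ℂ] Fock X) (delta T.1)⟫_ℂ

/-- `D` is the density of the restriction of `ω` to `CAR(l²(Λ))`: `ω(A) = Tr D A` for all `A` in
this algebra. -/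
def IsLocalDensity (ω : CAR X →ₗ[ℂ] ℂ) (Λ : Finset X) (D : LocalOp Λ) : Prop :=
  ∀ A ∈ localCAR Λ, ω A = (D * localize Λ A).trace

open Classical in
/-- The density of the restriction of `ω` to `CAR(l²(Λ))` (a unique one exists for every `ω`). -/
noncomputable def localDensity (ω : CAR X →ₗ[ℂ] ℂ) (Λ : Finset X) : LocalOp Λ :=
  if h : ∃ D, IsLocalDensity ω Λ D then h.choose else 0

end CARAlgebra

/-! ### Relative entropy and the function `log Tr ρ^t σ^(1-t)` in finite dimension -/

section Entropy

variable {d : Type*} [Fintype d] [DecidableEq d]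

/-- The power `D ^ t` of a positive semidefinite matrix, with the convention `0 ^ t = 0` for all real
`t`, defined through the spectral decomposition of `D`. -/
noncomputable def matPow (D : Matrix d d ℂ) (t : ℝ) : Matrix d d ℂ :=
  cfc (fun x : ℝ => if x = 0 then 0 else x ^ t) D

/-- The logarithm of a positive definite matrix, defined through its spectral decomposition. -/
noncomputable def matLog (D : Matrix d d ℂ) : Matrix d d ℂ := cfc Real.log D

/-- The relative entropy `Tr D (log D - log E)` of the states with densities `D` and `E`, for
`supp D ≤ supp E`. -/
noncomputable def relEntropy (D E : Matrix d d ℂ) : ℝ :=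
  (D * (matLog D - matLog E)).trace.re

/-- `log Tr D^t E^(1-t)`. -/
noncomputable def logTrPow (D E : Matrix d d ℂ) (t : ℝ) : ℝ :=
  Real.log (matPow D t * matPow E (1 - t)).trace.re

end Entropy

/-! ### The lattice `ℤ^ν` and the Fourier transformation -/

section Lattice

/-- The lattice `ℤ^ν`. The lexicographic order only serves to order the factors of wedge products of
basis vectors. -/
abbrev Lattice (ν : ℕ) : Type := Lex (Fin ν → ℤ)

/-- The cube `{0, ..., n-1}^ν` in `ℤ^ν`. -/
noncomputable def box (ν n : ℕ) : Finset (Lattice ν) :=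
  (Fintype.piFinset fun _ : Fin ν => Finset.Ico (0 : ℤ) n).map toLex.toEmbedding

/-- The cube `[0, 2π)^ν`. -/
def cube (ν : ℕ) : Set (Fin ν → ℝ) := Set.univ.pi fun _ => Set.Ico 0 (2 * Real.pi)

/-- The measure `(2π)^(-ν) dx` on `[0, 2π)^ν`. -/
noncomputable def cubeMeasure (ν : ℕ) : Measure (Fin ν → ℝ) :=
  ENNReal.ofReal (((2 * Real.pi) ^ ν)⁻¹) • volume.restrict (cube ν)

theorem volume_cube (ν : ℕ) : volume (cube ν) = ENNReal.ofReal ((2 * Real.pi) ^ ν) := by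
  rw [cube, Real.volume_pi_Ico]
  simp [ENNReal.ofReal_pow Real.two_pi_pos.le]

instance (ν : ℕ) : IsProbabilityMeasure (cubeMeasure ν) := by
  constructor
  rw [cubeMeasure, Measure.smul_apply, Measure.restrict_apply_univ, volume_cube, smul_eq_mul,
    ← ENNReal.ofReal_mul (by positivity), inv_mul_cancel₀ (by positivity), ENNReal.ofReal_one]

/-- The function `φ_k(x) = exp(i ⟨k, x⟩)`. -/
noncomputable def character {ν : ℕ} (k : Lattice ν) (x : Fin ν → ℝ) : ℂ :=
  Complex.exp (Complex.I * ∑ i, (ofLex k i : ℂ) * (x i : ℂ))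

theorem memLp_character {ν : ℕ} (k : Lattice ν) : MemLp (character k) 2 (cubeMeasure ν) := by
  refine MemLp.of_bound (C := 1) ?_ ?_
  · exact Continuous.aestronglyMeasurable (by unfold character; fun_prop)
  · refine ae_of_all _ fun x => ?_
    have : Complex.I * ∑ i, (ofLex k i : ℂ) * (x i : ℂ)
        = ((∑ i, (ofLex k i : ℝ) * x i : ℝ) : ℂ) * Complex.I := by push_cast; ring
    rw [character, this, Complex.norm_exp_ofReal_mul_I]

theorem integral_exp_int (m : ℤ) :
    ∫ x in Set.Ico 0 (2 * Real.pi), Complex.exp (Complex.I * ((m : ℂ) * (x : ℂ)))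
      = if m = 0 then (2 * Real.pi : ℂ) else 0 := by
  rw [integral_Ico_eq_integral_Ioc, ← intervalIntegral.integral_of_le Real.two_pi_pos.le]
  split_ifs with h
  · subst h; simp
  · have hm : (Complex.I * m) ≠ 0 := by simp [h]
    have := integral_exp_mul_complex (a := 0) (b := 2 * Real.pi) hm
    simp_rw [mul_assoc] at this
    rw [this]
    have h2 : Complex.exp (Complex.I * (m * ((2 * Real.pi : ℝ) : ℂ))) = 1 := by
      rw [Complex.exp_eq_one_iff]; exact ⟨m, by push_cast; ring⟩
    rw [h2]; simp

theorem orthonormal_character (ν : ℕ) :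
    Orthonormal ℂ fun k : Lattice ν => (memLp_character k).toLp (character k) := by
  rw [orthonormal_iff_ite]
  intro k l
  rw [L2.inner_def]
  have h1 : ∫ x, ⟪(memLp_character k).toLp (character k) x,
      (memLp_character l).toLp (character l) x⟫_ℂ ∂cubeMeasure ν
      = ∫ x, ∏ i, Complex.exp (Complex.I * (((ofLex l i - ofLex k i : ℤ) : ℂ) * (x i : ℂ)))
        ∂cubeMeasure ν := by
    refine integral_congr_ae ?_
    filter_upwards [(memLp_character k).coeFn_toLp, (memLp_character l).coeFn_toLp] with x hk hl
    rw [hk, hl, ← Complex.exp_sum, RCLike.inner_apply, character, character, ← Complex.exp_conj,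
      ← Complex.exp_add]
    congr 1
    simp only [map_mul, Complex.conj_I, map_sum, map_intCast, Complex.conj_ofReal,
      Finset.mul_sum, ← Finset.sum_add_distrib]
    exact Finset.sum_congr rfl fun i _ => by push_cast; ring
  rw [h1, cubeMeasure, integral_smul_measure, cube, volume_pi, Measure.restrict_pi_pi,
    integral_fintype_prod_eq_prod (f := fun (i : Fin ν) (t : ℝ) =>
      Complex.exp (Complex.I * (((ofLex l i - ofLex k i : ℤ) : ℂ) * (t : ℂ))))]
  simp_rw [integral_exp_int]
  split_ifs with h
  · subst h
    simp only [sub_self, if_true, Finset.prod_const, Finset.card_univ, Fintype.card_fin]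
    rw [ENNReal.toReal_ofReal (by positivity), Complex.real_smul]
    push_cast
    exact inv_mul_cancel₀ (pow_ne_zero _ (by simp [Real.pi_ne_zero]))
  · obtain ⟨i, hi⟩ : ∃ i, ofLex k i ≠ ofLex l i := by
      by_contra! h'
      exact h (ofLex.injective (funext h'))
    rw [Finset.prod_eq_zero (Finset.mem_univ i), smul_zero]
    rw [if_neg (sub_ne_zero.2 hi.symm)]

/-- The Fourier transformation `F : l²(ℤ^ν) → L²([0,2π)^ν)`, `1_k ↦ φ_k`. -/
noncomputable def fourier (ν : ℕ) : EllTwo (Lattice ν) →ₗᵢ[ℂ] Lp ℂ 2 (cubeMeasure ν) :=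
  (orthonormal_character ν).orthogonalFamily.linearIsometry

theorem fourier_delta {ν : ℕ} (k : Lattice ν) :
    fourier ν (delta k) = (memLp_character k).toLp (character k) := by
  rw [fourier, delta, OrthogonalFamily.linearIsometry_apply_single]
  simp

/-- `Q = F⁻¹ M_q F`, where `M_q` is multiplication by `q`; stated as `F Q = M_q F`. -/
def IsFourierMultiplier {ν : ℕ} (Q : EllTwo (Lattice ν) →L[ℂ] EllTwo (Lattice ν))
    (q : (Fin ν → ℝ) → ℝ) : Prop :=
  ∀ f, fourier ν (Q f) =ᵐ[cubeMeasure ν] fun x => (q x : ℂ) * fourier ν f x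

end Lattice

end QuasiFree

/-! On a finite set of sites the restricted quasi-free state has an explicit density. If $q$ is the
compressed symbol and $K=q/(1-q)$, then $\rho=\det(1-q)\,\Gamma(K)$, where $\Gamma$ is second
quantization. The relation $\rho\,c^*(x)=c^*(Kx)\,\rho$ and cyclicity of the trace reproduce the
determinant of a quasi-free state as a column expansion (`trace_mul_creProd_mul_annProd`,
`IsQuasiFree.isLocalDensity`). Since $\Gamma$ is multiplicative and
$\mathrm{Tr}\,\Gamma(A)=\det(1+A)$, the number $\mathrm{Tr}\,\rho^t\sigma^{1-t}$ becomes
$\det(1-q)^t\det(1-r)^{1-t}\det(1+XYX)$ with $X=(q/(1-q))^{t/2}$ and $Y=(r/(1-r))^{1-t}$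
(`logTrPow_density`). The problem thus moves from the Fock space to matrices of size $n^\nu$.

What remains is a Szegő type limit for functions of two truncated Toeplitz matrices. The vector
$v_x=(e^{i\langle k,x\rangle})_k$ is, on average over $x$, an approximate left eigenvector of the
compressed $Q$ with eigenvalue $\hat q(x)$: the mean square of its defect is
$\sum_k\|(1-P_n)Q1_k\|^2=o(n^\nu)$, because a fixed translation moves only a vanishing proportion of
the box out of it (`tendsto_integral_defect_sq`). Sums, products and Lipschitz functions of matrices
preserve approximate eigenvectors, with constants independent of $n$
(`exists_bound_log_one_add_spectralMatrix`). The average of $\langle v_x,Hv_x\rangle$ is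
$\mathrm{Tr}\,H$, so normalized traces converge to integrals of symbols
(`abs_trace_sub_integral_le`, `tendsto_sum_div`). This yields $\psi$.

The relative entropy needs no separate asymptotic analysis. By Jensen's inequality it is a
subgradient at $t=1$ of $t\mapsto\log\mathrm{Tr}\,\rho^t\sigma^{1-t}$
(`mul_relEntropy_le_logTrPow`). These functions converge pointwise to a function differentiable at
$1$, so the normalized subgradients converge to its derivative (`tendsto_of_subgradient`), which is
computed by differentiating under the integral. -/

namespace QuasiFree

/-! ### The local CAR algebra as matrices on a finite Fock space -/

section LocalAlgebra

variable {X : Type*} [LinearOrder X]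

theorem siteCreation_anticomm (i j : X) :
    siteCreation i * siteCreation j + siteCreation j * siteCreation i
      = (0 : Fock X →L[ℂ] Fock X) := by
  ext ψ T
  change siteCreation i (siteCreation j ψ) T + siteCreation j (siteCreation i ψ) T = 0
  simp only [siteCreation_apply]
  by_cases hij : i = j
  · subst hij; simp
  have hji : ¬ j = i := fun h => hij h.symm
  by_cases hi : i ∈ T
  · by_cases hj : j ∈ T
    · simp only [hi, hj, hij, hji, sgn_erase _ _ _ hi, sgn_erase _ _ _ hj, Finset.mem_erase,
        if_true, ne_eq, not_false_eq_true, and_self, Finset.erase_right_comm (a := i)]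
      rcases lt_or_gt_of_ne hij with h | h
      · simp only [h, not_lt_of_gt h, if_true, if_false]; ring
      · simp only [h, not_lt_of_gt h, if_true, if_false]; ring
    · simp [hi, hj]
  · simp [hi]

theorem creation_add (x y : EllTwo X) : creation (x + y) = creation x + creation y := by
  unfold creation
  rw [← (summable_creation x).tsum_add (summable_creation y)]
  simp [add_smul]

theorem creation_smul (a : ℂ) (x : EllTwo X) : creation (a • x) = a • creation x := by
  unfold creation
  rw [← tsum_const_smul'' a]
  simp [mul_smul]

theorem creation_delta (j : X) : creation (delta j) = siteCreation j := by
  unfold creation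
  rw [tsum_eq_single j]
  · simp [delta]
  · intro i hi
    simp [delta, lp.single_apply, hi]

/-- `x ↦ c*(x)` as a linear map into the CAR algebra. -/
noncomputable def creationLin (X : Type*) [LinearOrder X] : EllTwo X →ₗ[ℂ] CAR X where
  toFun x := star (c x)
  map_add' x y := by
    ext1
    change star (annihilation (x + y)) = star (annihilation x) + star (annihilation y)
    simp only [annihilation, ContinuousLinearMap.star_eq_adjoint,
      ContinuousLinearMap.adjoint_adjoint, creation_add]
  map_smul' a x := by
    ext1
    change star (annihilation (a • x)) = a • star (annihilation x)
    simp only [annihilation, ContinuousLinearMap.star_eq_adjoint,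
      ContinuousLinearMap.adjoint_adjoint, creation_smul]

theorem star_c_eq (x : EllTwo X) : star (c x) = creationLin X x := rfl

theorem coe_star_c (x : EllTwo X) : ((star (c x) : CAR X) : Fock X →L[ℂ] Fock X) = creation x := by
  change star (annihilation x) = creation x
  simp only [annihilation, ContinuousLinearMap.star_eq_adjoint,
      ContinuousLinearMap.adjoint_adjoint]

theorem c_mul_star_c (x y : EllTwo X) :
    c x * star (c y) + star (c y) * c x = ⟪x, y⟫_ℂ • (1 : CAR X) := by
  ext1
  have := car x y
  rw [← coe_star_c y] at this
  exact this

theorem star_c_delta_anticomm (i j : X) :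
    star (c (delta i)) * star (c (delta j)) + star (c (delta j)) * star (c (delta i))
      = (0 : CAR X) := by
  ext1
  have := siteCreation_anticomm i j
  rw [← creation_delta, ← creation_delta, ← coe_star_c, ← coe_star_c] at this
  exact this

/-- The vector of `l²(X)` supported in `Λ` with the given coordinates. -/
noncomputable def emb {Λ : Finset X} (x : Λ → ℂ) : EllTwo X := ∑ j, x j • delta (j : X)

theorem emb_mem_span {Λ : Finset X} (x : Λ → ℂ) :
    emb x ∈ Submodule.span ℂ (delta '' (Λ : Set X) : Set (EllTwo X)) :=
  Submodule.sum_mem _ fun j _ => Submodule.smul_mem _ _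
    (Submodule.subset_span ⟨j, j.2, rfl⟩)

theorem exists_emb_eq {Λ : Finset X} {x : EllTwo X}
    (hx : x ∈ Submodule.span ℂ (delta '' (Λ : Set X) : Set (EllTwo X))) :
    ∃ y : Λ → ℂ, x = emb y := by
  induction hx using Submodule.span_induction with
  | mem x h =>
    obtain ⟨j, hj, rfl⟩ := h
    refine ⟨Pi.single ⟨j, hj⟩ 1, ?_⟩
    rw [emb, Finset.sum_eq_single ⟨j, hj⟩]
    · simp
    · intro i _ hi; simp [hi]
    · simp
  | zero => exact ⟨0, by simp [emb]⟩
  | add x y _ _ hx hy =>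
    obtain ⟨a, rfl⟩ := hx
    obtain ⟨b, rfl⟩ := hy
    exact ⟨a + b, by simp [emb, add_smul, Finset.sum_add_distrib]⟩
  | smul t x _ hx =>
    obtain ⟨a, rfl⟩ := hx
    exact ⟨t • a, by simp [emb, mul_smul, Finset.smul_sum]⟩

theorem inner_emb {Λ : Finset X} (x : Λ → ℂ) (ψ : EllTwo X) :
    ⟪emb x, ψ⟫_ℂ = ∑ j, star (x j) * ψ j := by
  simp [emb, delta, lp.inner_single_left, mul_comm]

theorem emb_apply {Λ : Finset X} (x : Λ → ℂ) (j : Λ) : emb x (j : X) = x j := by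
  have h : ∀ i : Λ, (Pi.single (M := fun _ => ℂ) (i : X) (1 : ℂ) (j : X)) = if i = j then 1 else 0 := by
    intro i
    by_cases hij : i = j
    · subst hij; simp
    · have : (j : X) ≠ i := fun h => hij (Subtype.ext h.symm)
      simp [hij, this]
  simp only [emb, lp.coeFn_sum, Finset.sum_apply, lp.coeFn_smul, Pi.smul_apply, delta,
    lp.single_apply, smul_eq_mul, h]
  simp

/-- The creation operator of `x` supported in `Λ` is a finite sum of site creation operators. -/
theorem star_c_emb {Λ : Finset X} (x : Λ → ℂ) :
    star (c (emb x)) = ∑ j, x j • star (c (delta (j : X))) := by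
  simp only [star_c_eq, emb, map_sum, map_smul]

/-- The subspace of Fock space vectors supported in `Λ`. -/
def localFock (Λ : Finset X) : Submodule ℂ (Fock X) where
  carrier := {ψ | ∀ S, ¬ S ⊆ Λ → ψ S = 0}
  add_mem' := fun {a b} ha hb S hS => by simp [ha S hS, hb S hS]
  zero_mem' := fun S _ => rfl
  smul_mem' := fun t a ha S hS => by simp [ha S hS]

/-- The operators of the CAR algebra which, together with their adjoints, leave the Fock space over
`l²(Λ)` invariant. -/
noncomputable def invariantAlgebra (Λ : Finset X) : StarSubalgebra ℂ (CAR X) where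
  carrier := {A | ∀ ψ ∈ localFock Λ, (A : Fock X →L[ℂ] Fock X) ψ ∈ localFock Λ ∧
    ((star A : CAR X) : Fock X →L[ℂ] Fock X) ψ ∈ localFock Λ}
  mul_mem' := fun {a b} ha hb ψ hψ => by
    refine ⟨(ha _ (hb ψ hψ).1).1, ?_⟩
    rw [star_mul]
    exact (hb _ (ha ψ hψ).2).2
  one_mem' := fun ψ hψ => by
    rw [star_one]
    exact ⟨hψ, hψ⟩
  add_mem' := fun {a b} ha hb ψ hψ => by
    rw [star_add]
    exact ⟨add_mem (ha ψ hψ).1 (hb ψ hψ).1, add_mem (ha ψ hψ).2 (hb ψ hψ).2⟩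
  algebraMap_mem' := fun r ψ hψ => by
    rw [Algebra.algebraMap_eq_smul_one, star_smul, star_one]
    exact ⟨Submodule.smul_mem _ r hψ, Submodule.smul_mem _ _ hψ⟩
  star_mem' := fun {a} ha ψ hψ => by
    rw [star_star]
    exact ⟨(ha ψ hψ).2, (ha ψ hψ).1⟩

theorem star_c_delta_mem_invariantAlgebra {Λ : Finset X} {j : X} (hj : j ∈ Λ) :
    star (c (delta j)) ∈ invariantAlgebra Λ := by
  intro ψ hψ
  rw [star_star, coe_star_c, creation_delta]
  refine ⟨fun S hS => ?_, fun S hS => ?_⟩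
  · rw [siteCreation_apply]
    split_ifs with h
    · rw [hψ, mul_zero]
      intro h'
      exact hS fun i hi => by
        by_cases hij : i = j
        · exact hij ▸ hj
        · exact h' (Finset.mem_erase.2 ⟨hij, hi⟩)
    · rfl
  · change (creation (delta j)).adjoint ψ S = 0
    rw [creation_delta, adjoint_siteCreation_apply]
    split_ifs with h
    · rfl
    · rw [hψ, mul_zero]
      exact fun h' => hS fun i hi => h' (Finset.mem_insert_of_mem hi)

/-- Compression to a subspace is multiplicative only on operators preserving it; this inclusion
makes `localize` multiplicative on the local algebra. -/
theorem localCAR_le_invariantAlgebra (Λ : Finset X) : localCAR Λ ≤ invariantAlgebra Λ := by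
  refine StarAlgebra.adjoin_le ?_
  rintro _ ⟨x, hx, rfl⟩
  obtain ⟨y, rfl⟩ := exists_emb_eq hx
  have h : star (c (emb y)) ∈ invariantAlgebra Λ := by
    rw [star_c_emb]
    exact sum_mem fun j _ => SMulMemClass.smul_mem _ (star_c_delta_mem_invariantAlgebra j.2)
  simpa using star_mem h

/-- `localize` as a linear map. -/
noncomputable def localizeLin (Λ : Finset X) : CAR X →ₗ[ℂ] LocalOp Λ where
  toFun := localize Λ
  map_add' A B := by
    ext S T
    change ⟪_, (A : Fock X →L[ℂ] Fock X) _ + (B : Fock X →L[ℂ] Fock X) _⟫_ℂ = _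
    rw [inner_add_right]; rfl
  map_smul' a A := by
    ext S T
    change ⟪_, a • (A : Fock X →L[ℂ] Fock X) _⟫_ℂ = _
    rw [inner_smul_right]; rfl

theorem localizeLin_apply (Λ : Finset X) (A : CAR X) : localizeLin Λ A = localize Λ A := rfl

theorem inner_delta {Y : Type*} [DecidableEq Y] (S : Y) (ψ : EllTwo Y) :
    ⟪delta S, ψ⟫_ℂ = ψ S := by
  simp [delta, lp.inner_single_left]

theorem localize_apply (Λ : Finset X) (A : CAR X) (S T : FockIndex Λ) :
    localize Λ A S T = (A : Fock X →L[ℂ] Fock X) (delta T.1) S.1 :=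
  inner_delta _ _

theorem localize_one (Λ : Finset X) : localize Λ (1 : CAR X) = 1 := by
  ext S T
  rw [localize_apply]
  change (delta T.1 : Fock X) S.1 = _
  by_cases h : S = T
  · subst h; simp [delta]
  · have : S.1 ≠ T.1 := fun h' => h (Subtype.ext h')
    simp [delta, lp.single_apply, h, this]

theorem localize_star (Λ : Finset X) (A : CAR X) :
    localize Λ (star A) = (localize Λ A).conjTranspose := by
  ext S T
  simp only [localize, Matrix.of_apply, Matrix.conjTranspose_apply]
  change ⟪_, (A : Fock X →L[ℂ] Fock X).adjoint _⟫_ℂ = _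
  rw [ContinuousLinearMap.adjoint_inner_right]
  exact (inner_conj_symm _ _).symm

theorem delta_mem_localFock {Λ : Finset X} (T : FockIndex Λ) :
    (delta T.1 : Fock X) ∈ localFock Λ := by
  intro S hS
  have : S ≠ T.1 := fun h => hS (h ▸ Finset.mem_powerset.1 T.2)
  simp [delta, lp.single_apply, this]

theorem localFock_eq_sum {Λ : Finset X} {ψ : Fock X} (hψ : ψ ∈ localFock Λ) :
    ψ = ∑ U : FockIndex Λ, ψ U.1 • (delta U.1 : Fock X) := by
  ext S
  have h : ∀ U : FockIndex Λ, (ψ U.1 • (delta U.1 : Fock X)) S = if U.1 = S then ψ S else 0 := by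
    intro U
    by_cases h : U.1 = S
    · subst h; simp [delta]
    · have : S ≠ U.1 := fun h' => h h'.symm
      simp [delta, lp.single_apply, this, h]
  rw [lp.coeFn_sum, Finset.sum_apply, Finset.sum_congr rfl fun U _ => h U]
  by_cases hS : S ⊆ Λ
  · rw [Finset.sum_eq_single ⟨S, Finset.mem_powerset.2 hS⟩]
    · simp
    · intro U _ hU
      rw [if_neg fun h' => hU (Subtype.ext h')]
    · simp
  · rw [hψ S hS]; simp

/-- With $P$ the projection onto the local Fock space, $BP=PBP$ gives $PABP=(PAP)(PBP)$, so
invariance is needed for the right factor alone. -/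
theorem localize_mul {Λ : Finset X} (A : CAR X) {B : CAR X} (hB : B ∈ invariantAlgebra Λ) :
    localize Λ (A * B) = localize Λ A * localize Λ B := by
  ext S T
  rw [Matrix.mul_apply, localize_apply]
  change (A : Fock X →L[ℂ] Fock X) ((B : Fock X →L[ℂ] Fock X) (delta T.1)) S.1 = _
  rw [localFock_eq_sum (hB _ (delta_mem_localFock T)).1, map_sum, lp.coeFn_sum, Finset.sum_apply]
  refine Finset.sum_congr rfl fun U _ => ?_
  rw [map_smul, localize_apply, localize_apply, lp.coeFn_smul, Pi.smul_apply, smul_eq_mul,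
    mul_comm]

theorem star_c_emb_mem_localCAR {Λ : Finset X} (x : Λ → ℂ) : star (c (emb x)) ∈ localCAR Λ :=
  star_mem (StarAlgebra.subset_adjoin ℂ _ ⟨emb x, emb_mem_span x, rfl⟩)

theorem delta_eq_emb {Λ : Finset X} (j : Λ) : delta (j : X) = emb (Pi.single j (1 : ℂ)) := by
  rw [emb, Finset.sum_eq_single j]
  · simp
  · intro i _ hi; simp [hi]
  · simp

/-- The matrix of the creation operator at a site. -/
noncomputable def siteMatrix {Λ : Finset X} (j : Λ) : LocalOp Λ :=
  localize Λ (star (c (delta (j : X))))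

/-- The matrix of the creation operator `c*(x)`. -/
noncomputable def cre {Λ : Finset X} : (Λ → ℂ) →ₗ[ℂ] LocalOp Λ :=
  Fintype.linearCombination ℂ siteMatrix

theorem cre_apply {Λ : Finset X} (x : Λ → ℂ) : cre x = ∑ j, x j • siteMatrix j := rfl

theorem cre_single {Λ : Finset X} (j : Λ) : cre (Pi.single j 1) = siteMatrix j := by
  simp [cre]

theorem localize_star_c_emb {Λ : Finset X} (x : Λ → ℂ) : localize Λ (star (c (emb x))) = cre x := by
  rw [star_c_emb, ← localizeLin_apply, map_sum]
  simp only [map_smul]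
  rfl

theorem localize_c_emb {Λ : Finset X} (x : Λ → ℂ) :
    localize Λ (c (emb x)) = (cre x).conjTranspose := by
  rw [← localize_star_c_emb, ← localize_star, star_star]

/-- The index of the vacuum vector. -/
def vacIndex (Λ : Finset X) : FockIndex Λ := ⟨∅, by simp⟩

/-- Adding a site to an occupation set. -/
def insertSite {Λ : Finset X} (j : Λ) (T : FockIndex Λ) : FockIndex Λ :=
  ⟨insert (j : X) T.1, Finset.mem_powerset.2
    (Finset.insert_subset j.2 (Finset.mem_powerset.1 T.2))⟩

theorem siteMatrix_mulVec_single {Λ : Finset X} (j : Λ) (T : FockIndex Λ) :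
    (siteMatrix j).mulVec (Pi.single T 1) = if (j : X) ∈ T.1 then 0 else
      sgn (j : X) T.1 • Pi.single (insertSite j T) 1 := by
  ext S
  rw [Matrix.mulVec_single_one, Matrix.col_apply, siteMatrix, localize_apply, coe_star_c,
    creation_delta, siteCreation_delta]
  split_ifs with h
  · rfl
  · rw [lp.coeFn_smul, Pi.smul_apply, Pi.smul_apply]
    congr 1
    by_cases hS : S = insertSite j T
    · subst hS
      simp [insertSite, delta]
    · have : S.1 ≠ insert (j : X) T.1 := fun h' => hS (Subtype.ext h')
      simp [delta, lp.single_apply, hS, this]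

theorem localize_mul_localCAR {Λ : Finset X} (A : CAR X) {B : CAR X} (hB : B ∈ localCAR Λ) :
    localize Λ (A * B) = localize Λ A * localize Λ B :=
  localize_mul A (localCAR_le_invariantAlgebra Λ hB)

theorem siteMatrix_anticomm {Λ : Finset X} (i j : Λ) :
    siteMatrix i * siteMatrix j = - (siteMatrix j * siteMatrix i) := by
  have h := star_c_delta_anticomm (i : X) (j : X)
  have h' := congrArg (localizeLin Λ) h
  rw [map_add, map_zero, localizeLin_apply, localizeLin_apply, localize_mul_localCAR,
    localize_mul_localCAR] at h'
  · exact eq_neg_of_add_eq_zero_left h'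
  · rw [delta_eq_emb]; exact star_c_emb_mem_localCAR _
  · rw [delta_eq_emb]; exact star_c_emb_mem_localCAR _

theorem cre_anticomm {Λ : Finset X} (x y : Λ → ℂ) : cre x * cre y = - (cre y * cre x) := by
  simp only [cre_apply, Finset.sum_mul_sum]
  rw [Finset.sum_comm, ← Finset.sum_neg_distrib]
  refine Finset.sum_congr rfl fun j _ => ?_
  rw [← Finset.sum_neg_distrib]
  refine Finset.sum_congr rfl fun i _ => ?_
  rw [smul_mul_smul_comm, smul_mul_smul_comm, siteMatrix_anticomm, mul_comm, smul_neg]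

theorem cre_mul_self {Λ : Finset X} (x : Λ → ℂ) : cre x * cre x = 0 := by
  ext S T
  exact self_eq_neg.1 (congrFun (congrFun (cre_anticomm x x) S) T)

theorem ann_mul_cre {Λ : Finset X} (x y : Λ → ℂ) :
    (cre x).conjTranspose * cre y + cre y * (cre x).conjTranspose
      = (star x ⬝ᵥ y) • (1 : LocalOp Λ) := by
  have h := c_mul_star_c (emb x) (emb y)
  have h' := congrArg (localizeLin Λ) h
  rw [map_add, map_smul, localizeLin_apply, localizeLin_apply, localize_mul_localCAR,
    localize_mul_localCAR, localize_star_c_emb, localize_c_emb, localizeLin_apply, localize_one,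
    inner_emb] at h'
  · rw [h']
    congr 1
    exact Finset.sum_congr rfl fun j _ => by rw [emb_apply]; rfl
  · simpa using star_mem (star_c_emb_mem_localCAR x)
  · exact star_c_emb_mem_localCAR _

theorem ann_mulVec_vac {Λ : Finset X} (x : Λ → ℂ) :
    (cre x).conjTranspose.mulVec (Pi.single (vacIndex Λ) 1) = 0 := by
  have h : ∀ j : Λ, (siteMatrix j).conjTranspose.mulVec (Pi.single (vacIndex Λ) 1) = 0 := by
    intro j
    ext S
    have := congrFun (siteMatrix_mulVec_single j S) (vacIndex Λ)
    rw [Matrix.mulVec_single_one, Matrix.col_apply] at this ⊢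
    rw [Matrix.conjTranspose_apply, this]
    split_ifs
    · simp
    · have : vacIndex Λ ≠ insertSite j S := fun h => by
        have := congrArg Subtype.val h
        simp [vacIndex, insertSite] at this
        exact (Finset.insert_ne_empty _ _ this.symm).elim
      simp [this]
  rw [cre_apply, Matrix.conjTranspose_sum, Matrix.sum_mulVec]
  refine Finset.sum_eq_zero fun j _ => ?_
  rw [Matrix.conjTranspose_smul, Matrix.smul_mulVec, h, smul_zero]

/-- The basis vectors of the Fock space are generated from the vacuum by creation operators. -/
theorem fock_induction {Λ : Finset X} {p : (FockIndex Λ → ℂ) → Prop}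
    (vac : p (Pi.single (vacIndex Λ) 1))
    (cre_smul : ∀ (a : ℂ) (j : Λ) ψ, p ψ → p (a • (siteMatrix j).mulVec ψ)) (T : FockIndex Λ) :
    p (Pi.single T 1) := by
  obtain ⟨T, hT⟩ := T
  induction T using Finset.induction_on with
  | empty => exact vac
  | insert j T hj ih =>
    have hT' := Finset.mem_powerset.1 hT
    have hjΛ : j ∈ Λ := hT' (Finset.mem_insert_self _ _)
    have hTΛ : T ∈ Λ.powerset :=
      Finset.mem_powerset.2 fun i hi => hT' (Finset.mem_insert_of_mem hi)
    have h := cre_smul (sgn j T) ⟨j, hjΛ⟩ _ (ih hTΛ)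
    rw [siteMatrix_mulVec_single, if_neg hj, smul_smul, sgn_mul_self, one_smul] at h
    exact h

/-- Two matrices agree if they agree on the vacuum and satisfy the same relation with the creation
operators. -/
theorem matrix_ext_of_intertwine {Λ : Finset X} {M N : LocalOp Λ} (A : Λ → LocalOp Λ)
    (hvac : M.mulVec (Pi.single (vacIndex Λ) 1) = N.mulVec (Pi.single (vacIndex Λ) 1))
    (hM : ∀ j, M * siteMatrix j = A j * M) (hN : ∀ j, N * siteMatrix j = A j * N) : M = N := by
  refine Matrix.ext_col fun T => ?_
  rw [← Matrix.mulVec_single_one, ← Matrix.mulVec_single_one]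
  refine fock_induction (p := fun ψ => M.mulVec ψ = N.mulVec ψ) hvac (fun a j ψ h => ?_) T
  rw [Matrix.mulVec_smul, Matrix.mulVec_smul, Matrix.mulVec_mulVec, Matrix.mulVec_mulVec, hM, hN,
    ← Matrix.mulVec_mulVec, ← Matrix.mulVec_mulVec, h]

end LocalAlgebra

/-! ### Matrix units in the local algebra and uniqueness of the density -/

section LocalDensity

variable {X : Type*} [LinearOrder X] {Λ : Finset X}

theorem siteMatrix_apply (j : Λ) (S T : FockIndex Λ) :
    siteMatrix j S T = if (j : X) ∈ T.1 then 0 else if S = insertSite j T then sgn (j : X) T.1 else 0 := by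
  have := congrFun (siteMatrix_mulVec_single j T) S
  rw [Matrix.mulVec_single_one, Matrix.col_apply] at this
  rw [this]
  by_cases h : (j : X) ∈ T.1 <;> by_cases h' : S = insertSite j T <;> simp [h, h']

theorem siteMatrix_conjTranspose_mul_self (j : Λ) :
    (siteMatrix j).conjTranspose * siteMatrix j
      = Matrix.diagonal fun S => if (j : X) ∈ S.1 then 0 else 1 := by
  ext S T
  rw [Matrix.mul_apply]
  simp only [Matrix.conjTranspose_apply, siteMatrix_apply]
  by_cases hT : (j : X) ∈ T.1
  · by_cases hST : S = T
    · subst hST; simp [hT]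
    · simp [hT, hST]
  · rw [Finset.sum_eq_single (insertSite j T)]
    · by_cases hST : S = T
      · subst hST
        simp only [hT, if_false, if_true, Matrix.diagonal_apply_eq]
        rw [← starRingEnd_apply, conj_sgn, sgn_mul_self]
      · rw [Matrix.diagonal_apply_ne _ hST]
        by_cases hS : (j : X) ∈ S.1
        · simp [hS]
        · have : insertSite j T ≠ insertSite j S := fun h => by
            have h' := congrArg (fun U : FockIndex Λ => U.1.erase (j : X)) h
            simp only [insertSite, Finset.erase_insert hT, Finset.erase_insert hS] at h'
            exact hST (Subtype.ext h'.symm)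
          simp [hS, this]
    · intro U _ hU
      simp [hT, hU]
    · simp

theorem star_c_delta_mem_localCAR (j : Λ) : star (c (delta (j : X))) ∈ localCAR Λ := by
  rw [delta_eq_emb]; exact star_c_emb_mem_localCAR _

theorem c_delta_mem_localCAR (j : Λ) : c (delta (j : X)) ∈ localCAR Λ := by
  simpa using star_mem (star_c_delta_mem_localCAR j)

/-- The operator $c_jc_j^*$ projects onto the configurations in which $j$ is empty; multiplying over
$j\in F$ empties $F$. For $F=\Lambda$ this is the vacuum projection. -/
theorem exists_localize_eq_diagonal (F : Finset X) (hF : F ⊆ Λ) :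
    ∃ A ∈ localCAR Λ, localize Λ A
      = Matrix.diagonal fun S => if Disjoint S.1 F then (1 : ℂ) else 0 := by
  induction F using Finset.induction_on with
  | empty =>
    refine ⟨1, one_mem _, ?_⟩
    rw [localize_one]
    simp
  | insert j F hj ih =>
    obtain ⟨A, hA, h⟩ := ih fun i hi => hF (Finset.mem_insert_of_mem hi)
    have hjΛ := hF (Finset.mem_insert_self j F)
    let j' : Λ := ⟨j, hjΛ⟩
    refine ⟨c (delta j) * star (c (delta j)) * A,
      mul_mem (mul_mem (c_delta_mem_localCAR j') (star_c_delta_mem_localCAR j')) hA, ?_⟩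
    rw [localize_mul_localCAR _ hA, localize_mul_localCAR _ (star_c_delta_mem_localCAR j'), h]
    have h1 : localize Λ (c (delta j)) = (siteMatrix j').conjTranspose := by
      rw [siteMatrix, ← localize_star, star_star]
    have h2 : localize Λ (star (c (delta j))) = siteMatrix j' := rfl
    rw [h1, h2, siteMatrix_conjTranspose_mul_self, Matrix.diagonal_mul_diagonal]
    congr 1
    ext S
    simp only [Finset.disjoint_insert_right, j']
    by_cases h3 : j ∈ S.1 <;> simp [h3]

/-- Applying creation monomials to the vacuum projection gives $|S\rangle\langle\mathrm{vac}|$, and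
$|S\rangle\langle\mathrm{vac}|\,(|T\rangle\langle\mathrm{vac}|)^*=|S\rangle\langle T|$. Hence the
local algebra contains all matrices, and a density is determined by its expectations. -/
theorem exists_localize_eq_single (S T : FockIndex Λ) :
    ∃ A ∈ localCAR Λ, localize Λ A = Matrix.single S T 1 := by
  have hvac : ∃ A ∈ localCAR Λ, localize Λ A = Matrix.vecMulVec (Pi.single (vacIndex Λ) 1)
      (Pi.single (vacIndex Λ) 1) := by
    obtain ⟨A, hA, h⟩ := exists_localize_eq_diagonal Λ subset_rfl
    refine ⟨A, hA, h.trans ?_⟩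
    ext U V
    rw [Matrix.vecMulVec_apply, Matrix.diagonal_apply]
    have hU : Disjoint U.1 Λ ↔ U = vacIndex Λ := by
      rw [Finset.disjoint_iff_inter_eq_empty,
        Finset.inter_eq_left.2 (Finset.mem_powerset.1 U.2)]
      exact ⟨fun h => Subtype.ext h, fun h => congrArg Subtype.val h⟩
    simp only [hU, Pi.single_apply]
    by_cases h1 : U = vacIndex Λ
    · by_cases h2 : V = vacIndex Λ
      · simp [h1, h2]
      · have : ¬ vacIndex Λ = V := fun h => h2 h.symm
        simp [h1, h2, this]
    · simp [h1]
  have hcol : ∀ U : FockIndex Λ, ∃ A ∈ localCAR Λ, localize Λ A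
      = Matrix.vecMulVec (Pi.single U 1) (Pi.single (vacIndex Λ) 1) := by
    refine fun U => fock_induction (p := fun ψ => ∃ A ∈ localCAR Λ, localize Λ A
      = Matrix.vecMulVec ψ (Pi.single (vacIndex Λ) 1)) hvac (fun a j ψ ⟨A, hA, h⟩ => ?_) U
    refine ⟨a • (star (c (delta (j : X))) * A),
      SMulMemClass.smul_mem _ (mul_mem (star_c_delta_mem_localCAR j) hA), ?_⟩
    rw [← localizeLin_apply, map_smul, localizeLin_apply, localize_mul_localCAR _ hA, h,
      Matrix.mul_vecMulVec, Matrix.smul_vecMulVec]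
    rfl
  obtain ⟨A, hA, hA'⟩ := hcol S
  obtain ⟨B, hB, hB'⟩ := hcol T
  refine ⟨A * star B, mul_mem hA (star_mem hB), ?_⟩
  rw [localize_mul_localCAR _ (star_mem hB), localize_star, hA', hB']
  ext U V
  simp [Matrix.mul_apply, Matrix.vecMulVec_apply, Matrix.single_apply, Pi.single_apply,
    eq_comm, ite_and]
  split_ifs <;> rfl

theorem IsLocalDensity.unique {ω : CAR X →ₗ[ℂ] ℂ} {D E : LocalOp Λ}
    (hD : IsLocalDensity ω Λ D) (hE : IsLocalDensity ω Λ E) : D = E := by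
  ext T S
  obtain ⟨A, hA, h⟩ := exists_localize_eq_single S T
  have := (hD A hA).symm.trans (hE A hA)
  rw [h] at this
  simpa [Matrix.trace_mul_single] using this

theorem IsLocalDensity.localDensity_eq {ω : CAR X →ₗ[ℂ] ℂ} {D : LocalOp Λ}
    (hD : IsLocalDensity ω Λ D) : localDensity ω Λ = D := by
  have h : ∃ D, IsLocalDensity ω Λ D := ⟨D, hD⟩
  rw [localDensity, dif_pos h]
  exact h.choose_spec.unique hD

end LocalDensity

/-! ### Second quantization on the finite Fock space -/

section SecondQuantization

variable {X : Type*} [LinearOrder X]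

/-- The product of the `f i`, `i ∈ T`, in increasing order. -/
def orderedProd {R : Type*} [Ring R] (f : X → R) (T : Finset X) : R := (T.sort.map f).prod

theorem orderedProd_insert {R : Type*} [Ring R] (f : X → R) {a : X} {T : Finset X}
    (h : ∀ x ∈ T, a < x) : orderedProd f (insert a T) = f a * orderedProd f T := by
  unfold orderedProd
  rw [Finset.sort_insert _ (fun b hb => (h b hb).le) fun ha => lt_irrefl a (h a ha)]
  simp

/-- Sorting a new factor into an increasing product costs exactly the sign `sgn`. Only
anticommutation and vanishing squares enter, so this applies to the transformed operators
$c^*(Ae_j)$ as well as to the original ones. -/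
theorem mul_orderedProd {R : Type*} [Ring R] [Algebra ℂ R] {f : X → R}
    (hf : ∀ i j, f i * f j = - (f j * f i)) (hf2 : ∀ i, f i * f i = 0) (j : X) (T : Finset X) :
    f j * orderedProd f T = if j ∈ T then 0 else sgn j T • orderedProd f (insert j T) := by
  induction T using Finset.induction_on_min with
  | empty => simp [orderedProd, sgn]
  | insert a T ha ih =>
    have haT : a ∉ T := fun h => lt_irrefl a (ha a h)
    rcases lt_trichotomy j a with h | h | h
    · have hj : ∀ x ∈ insert a T, j < x := by
        intro x hx
        rcases Finset.mem_insert.1 hx with rfl | hx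
        · exact h
        · exact h.trans (ha x hx)
      have hs : sgn j (insert a T) = 1 := by
        unfold sgn
        rw [Finset.filter_false_of_mem fun x hx => not_lt_of_gt (hj x hx)]
        simp
      rw [if_neg fun h' => lt_irrefl j (hj j h'), hs, one_smul, orderedProd_insert f hj]
    · subst h
      rw [orderedProd_insert f ha, ← mul_assoc, hf2]
      simp
    · rw [orderedProd_insert f ha, ← mul_assoc, hf j a, neg_mul, mul_assoc, ih]
      by_cases hjT : j ∈ T
      · simp [hjT]
      · have hja : j ≠ a := h.ne'
        rw [if_neg hjT, if_neg (by simp [hjT, hja]), sgn_insert _ _ _ haT, if_pos h,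
          mul_smul_comm, neg_smul, Finset.insert_comm, orderedProd_insert f (T := insert j T)]
        intro x hx
        rcases Finset.mem_insert.1 hx with rfl | hx
        · exact h
        · exact ha x hx

variable {Λ : Finset X}

open Classical in
/-- The second quantization `Γ(A)` of an operator `A` on `l²(Λ)`:
`x₁ ∧ ... ∧ x_k ↦ A x₁ ∧ ... ∧ A x_k`. -/
noncomputable def secondQuant (A : Matrix Λ Λ ℂ) : LocalOp Λ :=
  Matrix.of fun S T => (orderedProd (fun j => if h : j ∈ Λ then cre (A.col ⟨j, h⟩) else 0)
    T.1).mulVec (Pi.single (vacIndex Λ) 1) S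

theorem secondQuant_mulVec_single (A : Matrix Λ Λ ℂ) (T : FockIndex Λ) :
    (secondQuant A).mulVec (Pi.single T 1)
      = (orderedProd (fun j => if h : j ∈ Λ then cre (A.col ⟨j, h⟩) else 0)
        T.1).mulVec (Pi.single (vacIndex Λ) 1) := by
  ext S
  rw [Matrix.mulVec_single_one, Matrix.col_apply, secondQuant, Matrix.of_apply]

theorem secondQuant_mulVec_vac (A : Matrix Λ Λ ℂ) :
    (secondQuant A).mulVec (Pi.single (vacIndex Λ) 1) = Pi.single (vacIndex Λ) 1 := by
  rw [secondQuant_mulVec_single]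
  change Matrix.mulVec (orderedProd _ ∅) _ = _
  rw [orderedProd, Finset.sort_empty, List.map_nil, List.prod_nil, Matrix.one_mulVec]

/-- Together with $\Gamma(A)\,\mathrm{vac}=\mathrm{vac}$ this relation characterizes $\Gamma(A)$ by
`matrix_ext_of_intertwine`; the algebraic identities for $\Gamma$ below are deduced from it. -/
theorem secondQuant_mul_siteMatrix (A : Matrix Λ Λ ℂ) (j : Λ) :
    secondQuant A * siteMatrix j = cre (A.col j) * secondQuant A := by
  refine Matrix.ext_col fun T => ?_
  rw [← Matrix.mulVec_single_one, ← Matrix.mulVec_single_one, ← Matrix.mulVec_mulVec,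
    ← Matrix.mulVec_mulVec, siteMatrix_mulVec_single, secondQuant_mulVec_single,
    Matrix.mulVec_mulVec]
  have key := mul_orderedProd (f := fun j : X => if h : j ∈ Λ then cre (A.col ⟨j, h⟩) else 0)
    (fun i k => ?_) (fun i => ?_) (j : X) T.1
  · simp only [j.2, dif_pos] at key
    rw [key]
    split_ifs with h
    · rw [Matrix.mulVec_zero, Matrix.zero_mulVec]
    · rw [Matrix.mulVec_smul, secondQuant_mulVec_single, Matrix.smul_mulVec]
      rfl
  · by_cases hi : i ∈ Λ
    · by_cases hk : k ∈ Λ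
      · simp only [hi, hk, dif_pos]; exact cre_anticomm _ _
      · simp [hk]
    · simp [hi]
  · by_cases hi : i ∈ Λ
    · simp only [hi, dif_pos]; exact cre_mul_self _
    · simp [hi]

theorem secondQuant_mul_cre (A : Matrix Λ Λ ℂ) (x : Λ → ℂ) :
    secondQuant A * cre x = cre (A.mulVec x) * secondQuant A := by
  have : A.mulVec x = ∑ j, x j • A.col j := by
    ext i
    simp [Matrix.mulVec, dotProduct, mul_comm]
  rw [this, cre_apply, map_sum, Finset.mul_sum, Finset.sum_mul]
  refine Finset.sum_congr rfl fun j _ => ?_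
  rw [map_smul, mul_smul_comm, smul_mul_assoc, secondQuant_mul_siteMatrix]

theorem secondQuant_mul (A B : Matrix Λ Λ ℂ) :
    secondQuant (A * B) = secondQuant A * secondQuant B := by
  refine matrix_ext_of_intertwine (fun j => cre ((A * B).col j)) ?_
    (secondQuant_mul_siteMatrix _) fun j => ?_
  · rw [← Matrix.mulVec_mulVec]
    simp only [secondQuant_mulVec_vac]
  · rw [mul_assoc, secondQuant_mul_siteMatrix, ← mul_assoc, secondQuant_mul_cre, mul_assoc]
    congr 2

theorem secondQuant_one : secondQuant (1 : Matrix Λ Λ ℂ) = 1 := by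
  refine matrix_ext_of_intertwine (fun j => cre ((1 : Matrix Λ Λ ℂ).col j)) ?_
    (secondQuant_mul_siteMatrix _) fun j => ?_
  · rw [secondQuant_mulVec_vac, Matrix.one_mulVec]
  · rw [one_mul, mul_one, ← cre_single]
    congr 1
    ext i
    simp [Matrix.one_apply, Pi.single_apply]

theorem cre_mulVec_vacIndex (x : Λ → ℂ) (ψ : FockIndex Λ → ℂ) :
    (cre x).mulVec ψ (vacIndex Λ) = 0 := by
  have h : ∀ S, cre x (vacIndex Λ) S = 0 := by
    intro S
    have := congrFun (ann_mulVec_vac x) S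
    rw [Matrix.mulVec_single_one, Matrix.col_apply, Matrix.conjTranspose_apply] at this
    simpa using this
  simp [Matrix.mulVec, dotProduct, h]

/-- The difference $D$ of the two sides kills the vacuum. The scalar terms from the anticommutation
relations agree, since $\langle A^*x,e_j\rangle=\langle x,Ae_j\rangle$, and leave
$Dc_j^*=-c^*(Ae_j)D$; the zero matrix satisfies the same relations. -/
theorem secondQuant_mul_ann (A : Matrix Λ Λ ℂ) (x : Λ → ℂ) :
    secondQuant A * (cre (A.conjTranspose.mulVec x)).conjTranspose
      = (cre x).conjTranspose * secondQuant A := by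
  rw [← sub_eq_zero]
  refine matrix_ext_of_intertwine (fun j => - cre (A.col j)) ?_ (fun j => ?_) (by simp)
  · rw [Matrix.sub_mulVec, ← Matrix.mulVec_mulVec, ← Matrix.mulVec_mulVec, ann_mulVec_vac,
      secondQuant_mulVec_vac, ann_mulVec_vac, Matrix.mulVec_zero, Matrix.zero_mulVec, sub_zero]
  · have h1 := ann_mul_cre (A.conjTranspose.mulVec x) (Pi.single j 1)
    have h2 := ann_mul_cre x (A.col j)
    have h3 : star (A.conjTranspose.mulVec x) ⬝ᵥ (Pi.single j 1) = star x ⬝ᵥ A.col j := by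
      rw [Matrix.star_mulVec, Matrix.conjTranspose_conjTranspose, ← Matrix.dotProduct_mulVec,
        Matrix.mulVec_single_one]
    rw [cre_single] at h1
    rw [sub_mul, mul_assoc, eq_sub_of_add_eq h1, mul_assoc, secondQuant_mul_siteMatrix, ← mul_assoc,
      eq_sub_of_add_eq h2, h3, mul_sub, sub_mul, mul_smul_comm, mul_one, smul_mul_assoc, one_mul,
      ← mul_assoc (secondQuant A), secondQuant_mul_siteMatrix]
    noncomm_ring

theorem secondQuant_conjTranspose (A : Matrix Λ Λ ℂ) :
    (secondQuant A).conjTranspose = secondQuant A.conjTranspose := by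
  refine matrix_ext_of_intertwine (fun j => cre (A.conjTranspose.col j)) ?_ (fun j => ?_)
    (secondQuant_mul_siteMatrix _)
  · rw [secondQuant_mulVec_vac]
    ext T
    rw [Matrix.mulVec_single_one, Matrix.col_apply, Matrix.conjTranspose_apply]
    -- The adjoint fixes the vacuum because $\Gamma(A)$ preserves vacuum components: any vector in
    -- the range of a creation operator has vacuum component zero, before and after applying
    -- $\Gamma(A)$.
    have := fock_induction (p := fun ψ => (secondQuant A).mulVec ψ (vacIndex Λ) = ψ (vacIndex Λ))
      (by rw [secondQuant_mulVec_vac]) (fun a j ψ _ => ?_) T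
    · rw [Matrix.mulVec_single_one, Matrix.col_apply] at this
      rw [this]
      by_cases h : T = vacIndex Λ
      · simp [h]
      · have h' : ¬ vacIndex Λ = T := fun h' => h h'.symm
        simp [h, h']
    · rw [Matrix.mulVec_smul, Matrix.mulVec_mulVec, secondQuant_mul_siteMatrix,
        ← Matrix.mulVec_mulVec, Pi.smul_apply, Pi.smul_apply, cre_mulVec_vacIndex, ← cre_single,
        cre_mulVec_vacIndex]
  · have := congrArg Matrix.conjTranspose (secondQuant_mul_ann A (Pi.single j 1))
    rw [Matrix.conjTranspose_mul, Matrix.conjTranspose_mul, Matrix.conjTranspose_conjTranspose,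
      Matrix.conjTranspose_conjTranspose, cre_single, Matrix.mulVec_single_one] at this
    exact this.symm

theorem secondQuant_diagonal (κ : Λ → ℂ) :
    secondQuant (Matrix.diagonal κ)
      = Matrix.diagonal fun T => ∏ j : Λ, if (j : X) ∈ T.1 then κ j else 1 := by
  refine matrix_ext_of_intertwine (fun j => cre ((Matrix.diagonal κ).col j)) ?_
    (secondQuant_mul_siteMatrix _) fun j => ?_
  · rw [secondQuant_mulVec_vac, Matrix.diagonal_mulVec_single]
    simp [vacIndex]
  · have h : (Matrix.diagonal κ).col j = κ j • Pi.single j 1 := by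
      ext i
      by_cases hij : i = j
      · subst hij; simp
      · simp [hij]
    rw [h, map_smul, cre_single]
    refine Matrix.ext_col fun T => ?_
    rw [← Matrix.mulVec_single_one, ← Matrix.mulVec_single_one, ← Matrix.mulVec_mulVec,
      ← Matrix.mulVec_mulVec, siteMatrix_mulVec_single, Matrix.diagonal_mulVec_single,
      show ∀ a : ℂ, Pi.single T (a * 1) = a • (Pi.single T 1 : FockIndex Λ → ℂ) from
        fun a => by rw [← Pi.single_smul, smul_eq_mul], Matrix.mulVec_smul, Matrix.smul_mulVec,
      siteMatrix_mulVec_single]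
    split_ifs with hj
    · simp only [Matrix.mulVec_zero, smul_zero]
    · rw [Matrix.mulVec_smul, Matrix.diagonal_mulVec_single,
        show ∀ a : ℂ, Pi.single (insertSite j T) (a * 1)
          = a • (Pi.single (insertSite j T) 1 : FockIndex Λ → ℂ) from
        fun a => by rw [← Pi.single_smul, smul_eq_mul], smul_smul, smul_smul, smul_smul]
      congr 1
      have h1 : ∏ i ∈ Finset.univ.erase j, (if (i : X) ∈ (insertSite j T).1 then κ i else 1)
          = ∏ i ∈ Finset.univ.erase j, if (i : X) ∈ T.1 then κ i else 1 := by
        refine Finset.prod_congr rfl fun i hi => ?_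
        have : (i : X) ≠ j := fun h => (Finset.mem_erase.1 hi).1 (Subtype.ext h)
        simp [insertSite, this]
      rw [← Finset.mul_prod_erase Finset.univ _ (Finset.mem_univ j), h1,
        ← Finset.mul_prod_erase Finset.univ (fun i : Λ => if (i : X) ∈ T.1 then κ i else 1)
          (Finset.mem_univ j), if_neg hj,
        if_pos (show (j : X) ∈ (insertSite j T).1 from Finset.mem_insert_self _ _)]
      ring

/-- The eigenvalue at an occupation set is the product of $\kappa$ over that set, so the trace is
the subset expansion of $\prod_j(1+\kappa_j)$. This is $\mathrm{Tr}\,\Gamma(A)=\det(1+A)$ in the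
diagonal case. -/
theorem trace_secondQuant_diagonal (κ : Λ → ℂ) :
    (secondQuant (Matrix.diagonal κ)).trace = ∏ j, (1 + κ j) := by
  classical
  rw [secondQuant_diagonal, Matrix.trace_diagonal]
  let f : X → ℂ := fun i => if h : i ∈ Λ then κ ⟨i, h⟩ else 0
  have hf : ∀ j : Λ, κ j = f j := fun j => by simp [f]
  simp only [hf]
  rw [Finset.prod_coe_sort Λ (fun i => 1 + f i), Finset.prod_one_add,
    ← Finset.sum_coe_sort Λ.powerset]
  refine Finset.sum_congr rfl fun T _ => ?_
  rw [Finset.prod_coe_sort Λ (fun i => if i ∈ T.1 then f i else 1), Finset.prod_ite_mem,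
    Finset.inter_eq_right.2 (Finset.mem_powerset.1 T.2)]

end SecondQuantization

/-! ### Wick's determinant formula from an intertwining relation -/

section Wick

/-- Carrying a creation operator leftwards through the annihilators changes sign at each crossing
and leaves one contraction per annihilator. The factor `f 0` stands rightmost and is met first, so
the `i`-th contraction carries $(-1)^i$. -/
theorem reverse_prod_mul {R : Type*} [Ring R] [Algebra ℂ R] (g : R) (m : ℕ) (f : Fin (m + 1) → R)
    (κ : Fin (m + 1) → ℂ) (h : ∀ i, f i * g + g * f i = κ i • (1 : R)) :
    (List.ofFn f).reverse.prod * g = (-1 : ℂ) ^ (m + 1) • (g * (List.ofFn f).reverse.prod)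
      + ∑ i : Fin (m + 1), ((-1 : ℂ) ^ (i : ℕ) * κ i) •
        (List.ofFn fun k => f (i.succAbove k)).reverse.prod := by
  induction m with
  | zero =>
    have e : ∀ F : Fin (0 + 1) → R, (List.ofFn F).reverse.prod = F 0 := fun F => by simp
    have e' : ∀ F : Fin 0 → R, (List.ofFn F).reverse.prod = 1 := fun F => by simp
    rw [e, Fin.sum_univ_succ, Fin.sum_univ_zero, e', eq_sub_of_add_eq (h 0)]
    simp [sub_eq_neg_add]
  | succ m ih =>
    have ih' := ih (fun i => f i.succ) (fun i => κ i.succ) (fun i => h i.succ)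
    have hr : ∀ {k : ℕ} (F : Fin (k + 1) → R), (List.ofFn F).reverse.prod
        = (List.ofFn fun i => F i.succ).reverse.prod * F 0 := by
      intro k F
      rw [List.ofFn_succ, List.reverse_cons, List.prod_append, List.prod_singleton]
    rw [hr f, mul_assoc, eq_sub_of_add_eq (h 0), mul_sub, ← mul_assoc, ih', Fin.sum_univ_succ (n := m + 1),
      add_mul, Finset.sum_mul]
    have h2 : ∀ i : Fin (m + 1), ((-1 : ℂ) ^ ((i.succ : Fin (m + 2)) : ℕ) * κ i.succ) •
        (List.ofFn fun k => f (i.succ.succAbove k)).reverse.prod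
        = - (((-1 : ℂ) ^ (i : ℕ) * κ i.succ) •
          (List.ofFn fun k => f (i.succAbove k).succ).reverse.prod * f 0) := by
      intro i
      rw [hr, Fin.succ_succAbove_zero]
      simp only [Fin.succ_succAbove_succ, Fin.val_succ, pow_succ]
      rw [smul_mul_assoc, ← neg_smul]
      congr 1
      ring
    simp only [h2, Finset.sum_neg_distrib, Fin.val_zero, pow_zero, one_mul, Fin.zero_succAbove,
      mul_smul_comm, mul_one]
    rw [pow_succ _ (m + 1), mul_neg_one, neg_smul, smul_mul_assoc, mul_assoc]
    abel

theorem mul_prod_of_anticomm {R : Type*} [Ring R] [Algebra ℂ R] (g : R) (n : ℕ) (f : Fin n → R)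
    (h : ∀ i, f i * g = - (g * f i)) :
    (List.ofFn f).prod * g = (-1 : ℂ) ^ n • (g * (List.ofFn f).prod) := by
  induction n with
  | zero => simp
  | succ n ih =>
    rw [List.ofFn_succ, List.prod_cons, mul_assoc, ih _ fun i => h i.succ, mul_smul_comm,
      ← mul_assoc, h, pow_succ, mul_neg_one, neg_smul, neg_mul, smul_neg, mul_assoc]

variable {X : Type*} [LinearOrder X] {Λ : Finset X}

/-- `c*(x₁) ... c*(xₙ)` -/
noncomputable def creProd {n : ℕ} (x : Fin n → Λ → ℂ) : LocalOp Λ :=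
  (List.ofFn fun i => cre (x i)).prod

/-- `c(yₙ) ... c(y₁)` -/
noncomputable def annProd {n : ℕ} (y : Fin n → Λ → ℂ) : LocalOp Λ :=
  (List.ofFn fun i => (cre (y i)).conjTranspose).reverse.prod

theorem trace_mul_add_of_intertwine {d : Type*} [Fintype d] {ρ z g C A : Matrix d d ℂ}
    (h : ρ * z = g * ρ) :
    (ρ * ((z + g) * C * A)).trace = (ρ * (C * A * g + g * (C * A))).trace := by
  rw [Matrix.add_mul, Matrix.add_mul, Matrix.mul_add, Matrix.mul_add, Matrix.trace_add,
    Matrix.trace_add, Matrix.mul_assoc g, Matrix.mul_assoc z, ← Matrix.mul_assoc ρ z, h,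
    Matrix.mul_assoc g ρ, Matrix.trace_mul_comm g, Matrix.mul_assoc ρ]

/-- With $z=(1-q)x_0$ one has $x_0=z+Kz$. The intertwining relation and cyclicity carry $c^*(z)$
around the trace as $g=c^*(Kz)=c^*(qx_0)$ at the right end, while the other summand of $c^*(x_0)$ is
$g$ at the left end. Their sum reduces to contractions, which form the expansion of the determinant
along its first column. -/
theorem trace_mul_creProd_mul_annProd {ρ : LocalOp Λ} {q K : Matrix Λ Λ ℂ}
    (hρ : ∀ x, ρ * cre x = cre (K.mulVec x) * ρ) (htr : ρ.trace = 1) (hK : K * (1 - q) = q)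
    (n : ℕ) (x y : Fin n → Λ → ℂ) :
    (ρ * (creProd x * annProd y)).trace
      = (Matrix.of fun i j => star (y i) ⬝ᵥ q.mulVec (x j)).det := by
  induction n with
  | zero => simp [creProd, annProd, htr]
  | succ n ih =>
    set z := (1 - q).mulVec (x 0) with hz
    have hKz : K.mulVec z = q.mulVec (x 0) := by
      rw [hz, Matrix.mulVec_mulVec, hK]
    have hx : x 0 = z + q.mulVec (x 0) := by
      rw [hz, ← Matrix.add_mulVec, sub_add_cancel, Matrix.one_mulVec]
    set C := creProd fun i : Fin n => x i.succ with hC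
    set g := cre (q.mulVec (x 0)) with hg
    have hcre : creProd x = (cre z + g) * C := by
      rw [creProd, List.ofFn_succ, List.prod_cons, hg, ← map_add, ← hx]; rfl
    have h1 : C * g = (-1 : ℂ) ^ n • (g * C) :=
      mul_prod_of_anticomm _ _ _ fun i => cre_anticomm _ _
    have h2 := reverse_prod_mul g n (fun i => (cre (y i)).conjTranspose)
      (fun i => star (y i) ⬝ᵥ q.mulVec (x 0)) (fun i => ann_mul_cre _ _)
    change annProd y * g = (-1 : ℂ) ^ (n + 1) • (g * annProd y) + ∑ i : Fin (n + 1), _ •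
      annProd (fun k => y (i.succAbove k)) at h2
    -- Moving $g$ to the left crosses $n+1$ annihilators and $n$ creators. The total sign
    -- $(-1)^{2n+1}=-1$ cancels $gCA$, and only the contractions survive.
    have h3 : C * annProd y * g + g * (C * annProd y) = ∑ i : Fin (n + 1),
        ((-1 : ℂ) ^ (i : ℕ) * (star (y i) ⬝ᵥ q.mulVec (x 0))) •
          (C * annProd (fun k => y (i.succAbove k))) := by
      rw [mul_assoc, h2, mul_add, Finset.mul_sum, mul_smul_comm, ← mul_assoc, h1, smul_mul_assoc,
        smul_smul, ← pow_add, show n + 1 + n = 2 * n + 1 by ring, pow_succ, pow_mul]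
      simp only [mul_smul_comm, mul_assoc]
      simp
    have h4 : (ρ * (creProd x * annProd y)).trace
        = (ρ * (C * annProd y * g + g * (C * annProd y))).trace := by
      rw [hcre]
      exact trace_mul_add_of_intertwine (by rw [hρ, hKz])
    rw [h4, h3, Finset.mul_sum, Matrix.trace_sum, Matrix.det_succ_column_zero]
    refine Finset.sum_congr rfl fun i _ => ?_
    rw [mul_smul_comm, Matrix.trace_smul, ih, smul_eq_mul]
    rfl

/-- Operators commuting with particle-number scaling have vanishing expectation on monomials that
change the particle number. -/
theorem trace_mul_creProd_mul_annProd_of_ne {K : Matrix Λ Λ ℂ} {n m : ℕ} (hnm : n ≠ m)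
    (x : Fin n → Λ → ℂ) (y : Fin m → Λ → ℂ) :
    (secondQuant K * (creProd x * annProd y)).trace = 0 := by
  -- Conjugation by $\Gamma(2\cdot 1)$ fixes $\Gamma(K)$, multiplies each creator by $2$ and each
  -- annihilator by $1/2$. The trace therefore equals $2^{n-m}$ times itself.
  set G := secondQuant ((2 : ℂ) • (1 : Matrix Λ Λ ℂ)) with hG
  set G' := secondQuant ((2 : ℂ)⁻¹ • (1 : Matrix Λ Λ ℂ)) with hG'
  have h1 : G * G' = 1 := by
    rw [hG, hG', ← secondQuant_mul, smul_mul_smul_comm, mul_inv_cancel₀ two_ne_zero, one_smul,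
      one_mul, secondQuant_one]
  have h1' : G' * G = 1 := by
    rw [hG, hG', ← secondQuant_mul, smul_mul_smul_comm, inv_mul_cancel₀ two_ne_zero, one_smul,
      one_mul, secondQuant_one]
  have hK : G * secondQuant K = secondQuant K * G := by
    rw [hG, ← secondQuant_mul, ← secondQuant_mul]; simp
  have hc : ∀ x : Λ → ℂ, G * cre x = (2 : ℂ) • (cre x * G) := by
    intro x
    rw [hG, secondQuant_mul_cre, Matrix.smul_mulVec, Matrix.one_mulVec, map_smul, smul_mul_assoc]
  have ha : ∀ x : Λ → ℂ, G * (cre x).conjTranspose = (2 : ℂ)⁻¹ • ((cre x).conjTranspose * G) := by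
    intro x
    rw [hG, ← secondQuant_mul_ann, Matrix.conjTranspose_smul, Matrix.smul_mulVec,
      Matrix.conjTranspose_one, Matrix.one_mulVec, map_smul, Matrix.conjTranspose_smul,
      mul_smul_comm, smul_smul]
    simp
  have hC : G * creProd x = (2 : ℂ) ^ n • (creProd x * G) := by
    clear hnm
    induction n with
    | zero => simp [creProd]
    | succ n ih =>
      have : creProd x = cre (x 0) * creProd fun i => x i.succ := by
        rw [creProd, List.ofFn_succ, List.prod_cons]; rfl
      rw [this, ← mul_assoc, hc, smul_mul_assoc, mul_assoc, ih, mul_smul_comm, smul_smul, mul_assoc,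
        pow_succ']
  have hA : G * annProd y = ((2 : ℂ)⁻¹) ^ m • (annProd y * G) := by
    clear hnm
    induction m with
    | zero => simp [annProd]
    | succ m ih =>
      have : annProd y = (annProd fun i => y i.succ) * (cre (y 0)).conjTranspose := by
        rw [annProd, List.ofFn_succ, List.reverse_cons, List.prod_append, List.prod_singleton]; rfl
      rw [this, ← mul_assoc, ih, smul_mul_assoc, mul_assoc, ha, mul_smul_comm, smul_smul, mul_assoc,
        pow_succ]
  set N := creProd x * annProd y with hN
  have hGN : G * N = ((2 : ℂ) ^ n * ((2 : ℂ)⁻¹) ^ m) • (N * G) := by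
    rw [hN, ← mul_assoc, hC, smul_mul_assoc, mul_assoc, hA, mul_smul_comm, smul_smul, mul_assoc]
  have key : (secondQuant K * N).trace
      = ((2 : ℂ) ^ n * ((2 : ℂ)⁻¹) ^ m) * (secondQuant K * N).trace := by
    calc (secondQuant K * N).trace = (G' * (G * (secondQuant K * N))).trace := by
          rw [← mul_assoc G', h1', one_mul]
      _ = ((2 : ℂ) ^ n * ((2 : ℂ)⁻¹) ^ m) * (G' * (secondQuant K * N * G)).trace := by
          rw [← mul_assoc G, hK, mul_assoc, hGN, mul_smul_comm, mul_smul_comm, Matrix.trace_smul,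
            smul_eq_mul, mul_assoc (secondQuant K)]
      _ = _ := by
          rw [Matrix.trace_mul_comm, mul_assoc (secondQuant K * N), h1, mul_one]
  have hne : (2 : ℂ) ^ n * ((2 : ℂ)⁻¹) ^ m ≠ 1 := by
    intro h
    rw [inv_pow, mul_inv_eq_one₀ (by positivity)] at h
    exact hnm (Nat.pow_right_injective le_rfl (by exact_mod_cast h))
  by_contra h0
  exact hne (mul_right_cancel₀ h0 (key.symm.trans (one_mul _).symm))

end Wick

/-! ### Normal ordering and the density of a quasi-free state -/

section Span

variable {X : Type*} [LinearOrder X]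

/-- The span of the normal ordered monomials over `l²(Λ)`. -/
noncomputable def normalOrdered (Λ : Finset X) : Submodule ℂ (CAR X) :=
  Submodule.span ℂ {A | ∃ (n m : ℕ) (x : Fin n → Λ → ℂ) (y : Fin m → Λ → ℂ),
    A = (List.ofFn fun i => star (c (emb (x i)))).prod
      * (List.ofFn fun i => c (emb (y i))).reverse.prod}

variable {Λ : Finset X}

theorem star_c_mul_mem_normalOrdered (x : Λ → ℂ) {A : CAR X} (hA : A ∈ normalOrdered Λ) :
    star (c (emb x)) * A ∈ normalOrdered Λ := by
  induction hA using Submodule.span_induction with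
  | mem A h =>
    obtain ⟨n, m, x', y, rfl⟩ := h
    refine Submodule.subset_span ⟨n + 1, m, Fin.cons x x', y, ?_⟩
    rw [List.ofFn_succ, List.prod_cons, mul_assoc]
    simp
  | zero => simp
  | add A B _ _ hA hB => rw [mul_add]; exact add_mem hA hB
  | smul t A _ hA => rw [mul_smul_comm]; exact Submodule.smul_mem _ _ hA

theorem c_mul_mem_normalOrdered (y : Λ → ℂ) {A : CAR X} (hA : A ∈ normalOrdered Λ) :
    c (emb y) * A ∈ normalOrdered Λ := by
  induction hA using Submodule.span_induction with
  | mem A h =>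
    obtain ⟨n, m, x, y', rfl⟩ := h
    induction n with
    | zero =>
      -- The annihilators are multiplied in reverse order, so the new leftmost factor is the last
      -- entry of the family.
      refine Submodule.subset_span ⟨0, m + 1, x, Fin.snoc y' y, ?_⟩
      rw [List.ofFn_succ' (n := m)]
      simp [List.concat_eq_append]
    | succ n ih =>
      rw [List.ofFn_succ, List.prod_cons, mul_assoc, ← mul_assoc,
        eq_sub_of_add_eq (c_mul_star_c (emb y) (emb (x 0))), sub_mul, smul_mul_assoc, one_mul, mul_assoc]
      exact sub_mem (Submodule.smul_mem _ _ (Submodule.subset_span ⟨n, m, _, y', rfl⟩))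
        (star_c_mul_mem_normalOrdered _ (ih _))
  | zero => simp
  | add A B _ _ hA hB => rw [mul_add]; exact add_mem hA hB
  | smul t A _ hA => rw [mul_smul_comm]; exact Submodule.smul_mem _ _ hA

theorem localCAR_le_normalOrdered {A : CAR X} (hA : A ∈ localCAR Λ) : A ∈ normalOrdered Λ := by
  -- The claim is strengthened to invariance of the whole span under left multiplication by $A$, a
  -- property that passes to products without knowing that the span is an algebra.
  have h : ∀ B ∈ normalOrdered Λ, A * B ∈ normalOrdered Λ := by
    change A ∈ Algebra.adjoin ℂ _ at hA
    induction hA using Algebra.adjoin_induction with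
    | mem A h =>
      intro B hB
      rcases h with h | h
      · obtain ⟨x, hx, rfl⟩ := h
        obtain ⟨y, rfl⟩ := exists_emb_eq hx
        exact c_mul_mem_normalOrdered y hB
      · obtain ⟨x, hx, hxA⟩ := h
        obtain ⟨y, rfl⟩ := exists_emb_eq hx
        rw [← star_star A, ← hxA]
        exact star_c_mul_mem_normalOrdered y hB
    | algebraMap r =>
      intro B hB
      rw [Algebra.algebraMap_eq_smul_one, smul_mul_assoc, one_mul]
      exact Submodule.smul_mem _ _ hB
    | add A B _ _ hA hB =>
      intro D hD
      rw [add_mul]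
      exact add_mem (hA D hD) (hB D hD)
    | mul A B _ _ hA hB =>
      intro D hD
      rw [mul_assoc]
      exact hA _ (hB D hD)
  rw [← mul_one A]
  exact h 1 (Submodule.subset_span ⟨0, 0, Fin.elim0, Fin.elim0, by simp⟩)

theorem localize_list_prod (l : List (CAR X)) (hl : ∀ A ∈ l, A ∈ localCAR Λ) :
    localize Λ l.prod = (l.map (localize Λ)).prod := by
  induction l with
  | nil => simpa using localize_one Λ
  | cons A l ih =>
    have hl' : ∀ B ∈ l, B ∈ localCAR Λ := fun B hB => hl B (List.mem_cons_of_mem _ hB)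
    rw [List.prod_cons, localize_mul_localCAR _ (list_prod_mem hl'), ih hl', List.map_cons,
      List.prod_cons]

theorem c_emb_mem_localCAR (x : Λ → ℂ) : c (emb x) ∈ localCAR Λ :=
  StarAlgebra.subset_adjoin ℂ _ ⟨emb x, emb_mem_span x, rfl⟩

theorem localize_monomial {n m : ℕ} (x : Fin n → Λ → ℂ) (y : Fin m → Λ → ℂ) :
    localize Λ ((List.ofFn fun i => star (c (emb (x i)))).prod
      * (List.ofFn fun i => c (emb (y i))).reverse.prod) = creProd x * annProd y := by
  have h1 : ∀ A ∈ (List.ofFn fun i => c (emb (y i))).reverse, A ∈ localCAR Λ := by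
    intro A hA
    rw [List.mem_reverse, List.mem_ofFn] at hA
    obtain ⟨i, rfl⟩ := hA
    exact c_emb_mem_localCAR _
  rw [localize_mul_localCAR _ (list_prod_mem h1), localize_list_prod _ h1, localize_list_prod]
  · rw [List.map_ofFn, List.map_reverse, List.map_ofFn]
    simp only [Function.comp_def, localize_star_c_emb, localize_c_emb]
    rfl
  · intro A hA
    rw [List.mem_ofFn] at hA
    obtain ⟨i, rfl⟩ := hA
    exact star_c_emb_mem_localCAR _

/-- The density of the restriction of a quasi-free state to `CAR(l²(Λ))` is a multiple of
`Γ(q/(1-q))`, where `q` is the compression of the symbol to `l²(Λ)`. -/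
theorem IsQuasiFree.isLocalDensity {ω : CAR X →ₗ[ℂ] ℂ} {Q : EllTwo X →L[ℂ] EllTwo X}
    (hω : IsQuasiFree ω Q) {q K : Matrix Λ Λ ℂ}
    (hq : ∀ x y : Λ → ℂ, ⟪emb y, Q (emb x)⟫_ℂ = star y ⬝ᵥ q.mulVec x)
    (hK : K * (1 - q) = q) {a : ℂ} (ha : a * (secondQuant K).trace = 1) :
    IsLocalDensity ω Λ (a • secondQuant K) := by
  intro A hA
  have h := localCAR_le_normalOrdered hA
  clear hA
  induction h using Submodule.span_induction with
  | mem A h =>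
    obtain ⟨n, m, x, y, rfl⟩ := h
    rw [localize_monomial]
    by_cases hnm : n = m
    · subst hnm
      rw [hω.apply_eq, trace_mul_creProd_mul_annProd (q := q) (K := K) _ _ hK]
      · congr 1
        ext i j
        exact hq _ _
      · intro x
        rw [smul_mul_assoc, secondQuant_mul_cre, mul_smul_comm]
      · rw [Matrix.trace_smul, smul_eq_mul, ha]
    · rw [hω.apply_ne _ _ _ _ hnm, smul_mul_assoc, Matrix.trace_smul,
        trace_mul_creProd_mul_annProd_of_ne hnm, smul_zero]
  | zero => rw [map_zero, ← localizeLin_apply, map_zero]; simp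
  | add A B _ _ hA hB =>
    rw [map_add, hA, hB, ← localizeLin_apply, ← localizeLin_apply, ← localizeLin_apply, map_add,
      mul_add, Matrix.trace_add]
  | smul t A _ hA =>
    rw [map_smul, hA, ← localizeLin_apply, ← localizeLin_apply, map_smul, mul_smul_comm,
      Matrix.trace_smul]

end Span

/-! ### Functional calculus in an eigenbasis and the entropy subgradient -/

section SpectralMatrix

variable {d : Type*} [Fintype d] [DecidableEq d]

/-- The Hermitian matrix with eigenvalues `w` and eigenvectors the columns of `U`. -/
noncomputable def spectralMatrix (U : Matrix.unitaryGroup d ℂ) (w : d → ℝ) : Matrix d d ℂ :=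
  (U : Matrix d d ℂ) * Matrix.diagonal (fun i => (w i : ℂ)) * (U : Matrix d d ℂ).conjTranspose

theorem unitary_conjTranspose_mul (U : Matrix.unitaryGroup d ℂ) :
    (U : Matrix d d ℂ).conjTranspose * (U : Matrix d d ℂ) = 1 :=
  Matrix.mem_unitaryGroup_iff'.1 U.2

theorem unitary_mul_conjTranspose (U : Matrix.unitaryGroup d ℂ) :
    (U : Matrix d d ℂ) * (U : Matrix d d ℂ).conjTranspose = 1 :=
  Matrix.mem_unitaryGroup_iff.1 U.2

theorem spectralMatrix_mul (U : Matrix.unitaryGroup d ℂ) (v w : d → ℝ) :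
    spectralMatrix U v * spectralMatrix U w = spectralMatrix U fun i => v i * w i := by
  unfold spectralMatrix
  rw [Matrix.mul_assoc _ (Matrix.conjTranspose _), ← Matrix.mul_assoc (Matrix.conjTranspose _),
    ← Matrix.mul_assoc (Matrix.conjTranspose _), unitary_conjTranspose_mul, Matrix.one_mul,
    ← Matrix.mul_assoc, Matrix.mul_assoc _ (Matrix.diagonal _) (Matrix.diagonal _),
    Matrix.diagonal_mul_diagonal]
  simp

theorem spectralMatrix_const (U : Matrix.unitaryGroup d ℂ) (a : ℝ) :
    spectralMatrix U (fun _ => a) = (a : ℂ) • 1 := by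
  unfold spectralMatrix
  have : (Matrix.diagonal fun _ : d => (a : ℂ)) = (a : ℂ) • 1 := by
    rw [← Matrix.diagonal_one, ← Matrix.diagonal_smul]; simp [Pi.smul_def]
  rw [this, Matrix.mul_smul, Matrix.mul_one, Matrix.smul_mul, unitary_mul_conjTranspose]

theorem spectralMatrix_one (U : Matrix.unitaryGroup d ℂ) :
    spectralMatrix U (fun _ => 1) = 1 := by
  rw [spectralMatrix_const]; simp

theorem spectralMatrix_sub (U : Matrix.unitaryGroup d ℂ) (v w : d → ℝ) :
    spectralMatrix U (fun i => v i - w i) = spectralMatrix U v - spectralMatrix U w := by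
  unfold spectralMatrix
  rw [← Matrix.sub_mul, ← Matrix.mul_sub, Matrix.diagonal_sub]
  simp

theorem spectralMatrix_smul (U : Matrix.unitaryGroup d ℂ) (a : ℝ) (w : d → ℝ) :
    spectralMatrix U (fun i => a * w i) = (a : ℂ) • spectralMatrix U w := by
  rw [← spectralMatrix_mul U (fun _ => a) w, spectralMatrix_const, Matrix.smul_mul, Matrix.one_mul]

theorem spectralMatrix_conjTranspose (U : Matrix.unitaryGroup d ℂ) (w : d → ℝ) :
    (spectralMatrix U w).conjTranspose = spectralMatrix U w := by
  unfold spectralMatrix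
  rw [Matrix.conjTranspose_mul, Matrix.conjTranspose_mul, Matrix.conjTranspose_conjTranspose,
    Matrix.diagonal_conjTranspose, ← Matrix.mul_assoc]
  congr 3
  ext i
  simp

theorem trace_spectralMatrix (U : Matrix.unitaryGroup d ℂ) (w : d → ℝ) :
    (spectralMatrix U w).trace = ((∑ i, w i : ℝ) : ℂ) := by
  unfold spectralMatrix
  rw [Matrix.trace_mul_comm, ← Matrix.mul_assoc, unitary_conjTranspose_mul, Matrix.one_mul,
    Matrix.trace_diagonal, Complex.ofReal_sum]

theorem exists_eq_spectralMatrix {A : Matrix d d ℂ} (hA : A.IsHermitian) :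
    ∃ U : Matrix.unitaryGroup d ℂ, A = spectralMatrix U hA.eigenvalues := by
  refine ⟨hA.eigenvectorUnitary, ?_⟩
  conv_lhs => rw [hA.spectral_theorem]
  rfl

theorem spectrum_spectralMatrix_subset (U : Matrix.unitaryGroup d ℂ) (w : d → ℝ) :
    spectrum ℝ (spectralMatrix U w) ⊆ Set.range w := by
  intro x hx
  have h1 : (algebraMap ℝ ℂ x) ∈ spectrum ℂ (spectralMatrix U w) :=
    spectrum.algebraMap_mem_iff ℂ |>.2 hx
  have h2 : spectrum ℂ (spectralMatrix U w) = spectrum ℂ (Matrix.diagonal fun i => (w i : ℂ)) :=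
    Unitary.spectrum_star_right_conjugate (U := U)
  rw [h2, spectrum_diagonal] at h1
  obtain ⟨i, hi⟩ := h1
  exact ⟨i, Complex.ofReal_injective hi⟩

theorem spectralMatrix_pow (U : Matrix.unitaryGroup d ℂ) (w : d → ℝ) (k : ℕ) :
    spectralMatrix U w ^ k = spectralMatrix U fun i => w i ^ k := by
  induction k with
  | zero => simp [spectralMatrix_one]
  | succ k ih => rw [pow_succ, ih, spectralMatrix_mul]; simp [pow_succ]

theorem spectralMatrix_add (U : Matrix.unitaryGroup d ℂ) (v w : d → ℝ) :
    spectralMatrix U (fun i => v i + w i) = spectralMatrix U v + spectralMatrix U w := by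
  unfold spectralMatrix
  rw [← Matrix.add_mul, ← Matrix.mul_add, Matrix.diagonal_add]
  simp

theorem aeval_spectralMatrix (U : Matrix.unitaryGroup d ℂ) (w : d → ℝ) (p : Polynomial ℝ) :
    Polynomial.aeval (spectralMatrix U w) p = spectralMatrix U fun i => p.eval (w i) := by
  induction p using Polynomial.induction_on' with
  | add p q hp hq => rw [map_add, hp, hq, ← spectralMatrix_add]; simp
  | monomial n a =>
    rw [Polynomial.aeval_monomial, spectralMatrix_pow]
    simp only [Polynomial.eval_monomial]
    rw [spectralMatrix_smul, Algebra.algebraMap_eq_smul_one, smul_mul_assoc, one_mul]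
    rfl

/-- On the finite spectrum $f$ agrees with its Lagrange interpolation polynomial, for which the
functional calculus is algebraic. No continuity of $f$ is needed. -/
theorem cfc_spectralMatrix (U : Matrix.unitaryGroup d ℂ) (w : d → ℝ) (f : ℝ → ℝ) :
    cfc f (spectralMatrix U w) = spectralMatrix U fun i => f (w i) := by
  set p := Lagrange.interpolate (Finset.univ.image w) id f with hp
  have hpw : ∀ i, p.eval (w i) = f (w i) := fun i =>
    Lagrange.eval_interpolate_at_node f (Set.injOn_id _)
      (Finset.mem_image_of_mem w (Finset.mem_univ i))
  have hsa : IsSelfAdjoint (spectralMatrix U w) := spectralMatrix_conjTranspose U w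
  rw [cfc_congr (g := p.eval), cfc_polynomial p _ hsa, aeval_spectralMatrix]
  · simp only [hpw]
  · intro x hx
    obtain ⟨i, rfl⟩ := spectrum_spectralMatrix_subset U w hx
    exact (hpw i).symm

theorem matPow_spectralMatrix (U : Matrix.unitaryGroup d ℂ) {w : d → ℝ} (hw : ∀ i, 0 < w i)
    (t : ℝ) : matPow (spectralMatrix U w) t = spectralMatrix U fun i => w i ^ t := by
  rw [matPow, cfc_spectralMatrix]
  simp [(hw _).ne']

theorem matLog_spectralMatrix (U : Matrix.unitaryGroup d ℂ) (w : d → ℝ) :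
    matLog (spectralMatrix U w) = spectralMatrix U fun i => Real.log (w i) :=
  cfc_spectralMatrix U w _

/-- The squared overlaps of the two eigenbases turn traces of products of noncommuting matrices into
classical double sums, to which Jensen's inequality applies. -/
theorem trace_spectralMatrix_mul (U V : Matrix.unitaryGroup d ℂ) (v w : d → ℝ) :
    (spectralMatrix U v * spectralMatrix V w).trace = ((∑ i, ∑ j,
      ‖((U : Matrix d d ℂ).conjTranspose * (V : Matrix d d ℂ)) i j‖ ^ 2 * (v i * w j) : ℝ) : ℂ) := by
  set W := (U : Matrix d d ℂ).conjTranspose * (V : Matrix d d ℂ) with hW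
  have hW' : W.conjTranspose = (V : Matrix d d ℂ).conjTranspose * (U : Matrix d d ℂ) := by
    rw [hW, Matrix.conjTranspose_mul, Matrix.conjTranspose_conjTranspose]
  have : (spectralMatrix U v * spectralMatrix V w).trace = (Matrix.diagonal (fun i => (v i : ℂ)) *
      (W * (Matrix.diagonal (fun i => (w i : ℂ)) * W.conjTranspose))).trace := by
    rw [hW', hW]
    unfold spectralMatrix
    simp only [Matrix.mul_assoc]
    rw [Matrix.trace_mul_comm]
    simp only [Matrix.mul_assoc]
  rw [this, Matrix.trace]
  push_cast
  refine Finset.sum_congr rfl fun i _ => ?_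
  rw [Matrix.diag_apply, Matrix.diagonal_mul, Matrix.mul_apply, Finset.mul_sum]
  refine Finset.sum_congr rfl fun j _ => ?_
  rw [Matrix.diagonal_mul, Matrix.conjTranspose_apply, ← Complex.mul_conj']
  simp only [RCLike.star_def]
  ring

theorem sum_norm_sq_unitary_row (U V : Matrix.unitaryGroup d ℂ) (i : d) :
    ∑ j, ‖((U : Matrix d d ℂ).conjTranspose * (V : Matrix d d ℂ)) i j‖ ^ 2 = 1 := by
  set W := (U : Matrix d d ℂ).conjTranspose * (V : Matrix d d ℂ) with hW
  have h : W * W.conjTranspose = 1 := by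
    rw [hW, Matrix.conjTranspose_mul, Matrix.conjTranspose_conjTranspose, Matrix.mul_assoc,
      ← Matrix.mul_assoc (V : Matrix d d ℂ), unitary_mul_conjTranspose, Matrix.one_mul,
      unitary_conjTranspose_mul]
  have h' := congrFun (congrFun h i) i
  rw [Matrix.mul_apply, Matrix.one_apply_eq] at h'
  refine Complex.ofReal_injective ?_
  push_cast
  rw [← h']
  refine Finset.sum_congr rfl fun j _ => ?_
  rw [← Complex.mul_conj', Matrix.conjTranspose_apply]
  rfl

theorem exp_sum_le_sum_exp {ι : Type*} (s : Finset ι) (p y : ι → ℝ) (hp : ∀ i ∈ s, 0 ≤ p i)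
    (h1 : ∑ i ∈ s, p i = 1) :
    Real.exp (∑ i ∈ s, p i * y i) ≤ ∑ i ∈ s, p i * Real.exp (y i) := by
  simpa using convexOn_exp.map_sum_le hp h1 (fun i _ => Set.mem_univ (y i))

/-- The relative entropy is a subgradient at `1` of `t ↦ log Tr D^t E^(1-t)`. -/
theorem mul_relEntropy_le_logTrPow (U V : Matrix.unitaryGroup d ℂ) {v w : d → ℝ}
    (hv : ∀ i, 0 < v i) (hw : ∀ i, 0 < w i) (h1 : ∑ i, v i = 1) (h : ℝ) :
    h * relEntropy (spectralMatrix U v) (spectralMatrix V w)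
      ≤ logTrPow (spectralMatrix U v) (spectralMatrix V w) (1 + h) := by
  -- The numbers $C_{ij}v_i$ form a probability distribution on pairs. The relative entropy is its
  -- mean of $\log v_i-\log w_j$, and $\mathrm{Tr}\,D^{1+h}E^{-h}$ is its mean of $e^{h(\log
  -- v_i-\log w_j)}$, so Jensen's inequality for `exp` gives the bound.
  set C : d → d → ℝ := fun i j =>
    ‖((U : Matrix d d ℂ).conjTranspose * (V : Matrix d d ℂ)) i j‖ ^ 2 with hC
  have hCrow : ∀ i, ∑ j, C i j = 1 := sum_norm_sq_unitary_row U V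
  have hS : relEntropy (spectralMatrix U v) (spectralMatrix V w)
      = ∑ x : d × d, (C x.1 x.2 * v x.1) * (Real.log (v x.1) - Real.log (w x.2)) := by
    rw [relEntropy, matLog_spectralMatrix, matLog_spectralMatrix, Matrix.mul_sub,
      spectralMatrix_mul, Matrix.trace_sub, trace_spectralMatrix, trace_spectralMatrix_mul,
      ← Complex.ofReal_sub, Complex.ofReal_re, Fintype.sum_prod_type, ← Finset.sum_sub_distrib]
    refine Finset.sum_congr rfl fun i _ => ?_
    rw [← one_mul (v i * Real.log (v i)), ← hCrow i, Finset.sum_mul, ← Finset.sum_sub_distrib]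
    refine Finset.sum_congr rfl fun j _ => ?_
    simp only [hC]
    ring
  have hp1 : ∑ x : d × d, C x.1 x.2 * v x.1 = 1 := by
    rw [Fintype.sum_prod_type, ← h1]
    refine Finset.sum_congr rfl fun i _ => ?_
    simp only
    rw [← Finset.sum_mul, hCrow, one_mul]
  have hT : (matPow (spectralMatrix U v) (1 + h) *
      matPow (spectralMatrix V w) (1 - (1 + h))).trace.re
      = ∑ x : d × d, (C x.1 x.2 * v x.1) *
        Real.exp (h * (Real.log (v x.1) - Real.log (w x.2))) := by
    rw [matPow_spectralMatrix U hv, matPow_spectralMatrix V hw, trace_spectralMatrix_mul,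
      Complex.ofReal_re, Fintype.sum_prod_type]
    refine Finset.sum_congr rfl fun i _ => Finset.sum_congr rfl fun j _ => ?_
    have : v i ^ (1 + h) * w j ^ (1 - (1 + h))
        = v i * Real.exp (h * (Real.log (v i) - Real.log (w j))) := by
      rw [Real.rpow_add (hv i), Real.rpow_one, Real.rpow_def_of_pos (hv i),
        Real.rpow_def_of_pos (hw j), mul_assoc, ← Real.exp_add]
      ring_nf
    simp only [hC]
    rw [this]
    ring
  have key := exp_sum_le_sum_exp (Finset.univ : Finset (d × d)) (fun x => C x.1 x.2 * v x.1)
    (fun x => h * (Real.log (v x.1) - Real.log (w x.2)))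
    (fun x _ => mul_nonneg (sq_nonneg _) (hv _).le) hp1
  rw [logTrPow, hT, hS]
  refine le_trans (le_of_eq ?_) ((Real.le_log_iff_exp_le (lt_of_lt_of_le (Real.exp_pos _) key)).2 key)
  rw [Finset.mul_sum]
  exact Finset.sum_congr rfl fun _ _ => by ring

end SpectralMatrix

/-! ### Spectral form of the density and the determinant formula -/

section QuasiFreeDensity

variable {X : Type*} [LinearOrder X] {Λ : Finset X}

theorem secondQuant_mem_unitaryGroup (U : Matrix.unitaryGroup Λ ℂ) :
    secondQuant (U : Matrix Λ Λ ℂ) ∈ Matrix.unitaryGroup (FockIndex Λ) ℂ := by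
  rw [Matrix.mem_unitaryGroup_iff, Matrix.star_eq_conjTranspose, secondQuant_conjTranspose,
    ← secondQuant_mul, unitary_mul_conjTranspose, secondQuant_one]

/-- The second quantization of a unitary matrix. -/
noncomputable def secondQuantUnitary (U : Matrix.unitaryGroup Λ ℂ) :
    Matrix.unitaryGroup (FockIndex Λ) ℂ := ⟨secondQuant U, secondQuant_mem_unitaryGroup U⟩

/-- The product of `κ` over an occupation set. -/
def occProd (κ : Λ → ℝ) (T : FockIndex Λ) : ℝ := ∏ j : Λ, if (j : X) ∈ T.1 then κ j else 1

theorem occProd_pos {κ : Λ → ℝ} (hκ : ∀ i, 0 < κ i) (T : FockIndex Λ) : 0 < occProd κ T :=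
  Finset.prod_pos fun i _ => by split_ifs; exacts [hκ i, one_pos]

theorem occProd_rpow {κ : Λ → ℝ} (hκ : ∀ i, 0 < κ i) (T : FockIndex Λ) (t : ℝ) :
    occProd κ T ^ t = occProd (fun i => κ i ^ t) T := by
  unfold occProd
  rw [← Real.finsetProd_rpow _ _ fun i _ => by split_ifs; exacts [(hκ i).le, zero_le_one]]
  refine Finset.prod_congr rfl fun i _ => ?_
  split_ifs <;> simp

/-- A diagonalization of $A$ induces one of $\Gamma(A)$. With `occProd_rpow` this gives
$\Gamma(A)^t=\Gamma(A^t)$ for positive $A$, and so the powers of a density in `matPow_density`. -/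
theorem secondQuant_spectralMatrix (U : Matrix.unitaryGroup Λ ℂ) (κ : Λ → ℝ) :
    secondQuant (spectralMatrix U κ) = spectralMatrix (secondQuantUnitary U) (occProd κ) := by
  unfold spectralMatrix
  rw [secondQuant_mul, secondQuant_mul, ← secondQuant_conjTranspose, secondQuant_diagonal]
  simp only [secondQuantUnitary]
  congr 3
  ext T
  simp only [occProd]
  push_cast
  refine Finset.prod_congr rfl fun i _ => ?_
  split_ifs <;> simp

theorem trace_secondQuant_spectralMatrix (U : Matrix.unitaryGroup Λ ℂ) (κ : Λ → ℝ) :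
    (secondQuant (spectralMatrix U κ)).trace = ((∏ j, (1 + κ j) : ℝ) : ℂ) := by
  unfold spectralMatrix
  rw [secondQuant_mul, Matrix.trace_mul_comm, ← secondQuant_mul, ← Matrix.mul_assoc,
    unitary_conjTranspose_mul, Matrix.one_mul, trace_secondQuant_diagonal]
  push_cast
  rfl

/-- The eigenvalues of the density of a quasi-free state. -/
noncomputable def densityWeight (lam : Λ → ℝ) (T : FockIndex Λ) : ℝ :=
  (∏ j, (1 - lam j)) * occProd (fun j => lam j / (1 - lam j)) T

theorem densityWeight_pos {lam : Λ → ℝ} (h0 : ∀ j, 0 < lam j) (h1 : ∀ j, lam j < 1)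
    (T : FockIndex Λ) : 0 < densityWeight lam T :=
  mul_pos (Finset.prod_pos fun j _ => sub_pos.2 (h1 j))
    (occProd_pos (fun j => div_pos (h0 j) (sub_pos.2 (h1 j))) T)

theorem prod_one_sub_mul_prod {ι : Type*} [Fintype ι] {lam : ι → ℝ} (h1 : ∀ j, lam j < 1) :
    (∏ j, (1 - lam j)) * ∏ j, (1 + lam j / (1 - lam j)) = 1 := by
  rw [← Finset.prod_mul_distrib]
  refine Finset.prod_eq_one fun j _ => ?_
  have := (sub_pos.2 (h1 j)).ne'
  field_simp
  ring

theorem sum_densityWeight (U : Matrix.unitaryGroup Λ ℂ) {lam : Λ → ℝ} (h1 : ∀ j, lam j < 1) :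
    ∑ T, densityWeight lam T = 1 := by
  have h := trace_secondQuant_spectralMatrix U (fun j => lam j / (1 - lam j))
  rw [secondQuant_spectralMatrix, trace_spectralMatrix] at h
  have h' := Complex.ofReal_injective h
  simp only [densityWeight]
  rw [← Finset.mul_sum, h', prod_one_sub_mul_prod h1]

/-- The density of a quasi-free state whose compressed symbol has eigenvalues `lam` in `(0,1)`. -/
theorem IsQuasiFree.localDensity_eq {ω : CAR X →ₗ[ℂ] ℂ} {Q : EllTwo X →L[ℂ] EllTwo X}
    (hω : IsQuasiFree ω Q) (U : Matrix.unitaryGroup Λ ℂ) {lam : Λ → ℝ}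
    (hq : ∀ x y : Λ → ℂ, ⟪emb y, Q (emb x)⟫_ℂ = star y ⬝ᵥ (spectralMatrix U lam).mulVec x)
    (h1 : ∀ j, lam j < 1) :
    localDensity ω Λ = spectralMatrix (secondQuantUnitary U) (densityWeight lam) := by
  have h2 : ∀ j, 1 - lam j ≠ 0 := fun j => (sub_pos.2 (h1 j)).ne'
  have hD := hω.isLocalDensity (K := spectralMatrix U fun j => lam j / (1 - lam j))
    (a := ((∏ j, (1 - lam j) : ℝ) : ℂ)) hq ?_ ?_
  · rw [hD.localDensity_eq, secondQuant_spectralMatrix, ← spectralMatrix_smul]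
    rfl
  · rw [← spectralMatrix_one U, ← spectralMatrix_sub, spectralMatrix_mul]
    congr 1
    ext j
    field_simp [h2 j]
  · rw [trace_secondQuant_spectralMatrix, ← Complex.ofReal_mul, prod_one_sub_mul_prod h1,
      Complex.ofReal_one]

theorem matPow_density (U : Matrix.unitaryGroup Λ ℂ) {lam : Λ → ℝ} (h0 : ∀ j, 0 < lam j)
    (h1 : ∀ j, lam j < 1) (t : ℝ) :
    matPow (spectralMatrix (secondQuantUnitary U) (densityWeight lam)) t
      = (((∏ j, (1 - lam j)) ^ t : ℝ) : ℂ) •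
        secondQuant (spectralMatrix U fun j => (lam j / (1 - lam j)) ^ t) := by
  rw [matPow_spectralMatrix _ (densityWeight_pos h0 h1), secondQuant_spectralMatrix,
    ← spectralMatrix_smul]
  congr 1
  ext T
  rw [densityWeight, Real.mul_rpow (Finset.prod_nonneg fun j _ => (sub_pos.2 (h1 j)).le)
    (occProd_pos (fun j => div_pos (h0 j) (sub_pos.2 (h1 j))) T).le,
    occProd_rpow (fun j => div_pos (h0 j) (sub_pos.2 (h1 j)))]

/-- Both powers are multiples of second quantized matrices, so the trace of their product is again
of the form $\mathrm{Tr}\,\Gamma$. Splitting $X^2=X\cdot X$ and cycling one factor replaces $X^2Y$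
by the Hermitian matrix $XYX$, whose eigenvalues are the $\delta_j$. -/
theorem logTrPow_density (U V W : Matrix.unitaryGroup Λ ℂ) {lam mu δ : Λ → ℝ}
    (hl0 : ∀ j, 0 < lam j) (hl1 : ∀ j, lam j < 1) (hm0 : ∀ j, 0 < mu j) (hm1 : ∀ j, mu j < 1)
    (t : ℝ) (hδ0 : ∀ j, 0 ≤ δ j)
    (hδ : spectralMatrix U (fun j => (lam j / (1 - lam j)) ^ (t / 2)) *
      spectralMatrix V (fun j => (mu j / (1 - mu j)) ^ (1 - t)) *
      spectralMatrix U (fun j => (lam j / (1 - lam j)) ^ (t / 2)) = spectralMatrix W δ) :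
    logTrPow (spectralMatrix (secondQuantUnitary U) (densityWeight lam))
      (spectralMatrix (secondQuantUnitary V) (densityWeight mu)) t
      = t * ∑ j, Real.log (1 - lam j) + (1 - t) * ∑ j, Real.log (1 - mu j)
        + ∑ j, Real.log (1 + δ j) := by
  have hU : spectralMatrix U (fun j => (lam j / (1 - lam j)) ^ t)
      = spectralMatrix U (fun j => (lam j / (1 - lam j)) ^ (t / 2)) *
        spectralMatrix U (fun j => (lam j / (1 - lam j)) ^ (t / 2)) := by
    rw [spectralMatrix_mul]
    congr 1
    ext j
    rw [← Real.rpow_add (div_pos (hl0 j) (sub_pos.2 (hl1 j))), add_halves]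
  rw [logTrPow, matPow_density U hl0 hl1, matPow_density V hm0 hm1, smul_mul_smul_comm,
    Matrix.trace_smul, hU, secondQuant_mul, Matrix.mul_assoc, Matrix.trace_mul_comm,
    ← secondQuant_mul, ← secondQuant_mul, hδ, trace_secondQuant_spectralMatrix, smul_eq_mul,
    ← Complex.ofReal_mul, ← Complex.ofReal_mul, Complex.ofReal_re]
  have h1 : 0 < ∏ j, (1 - lam j) := Finset.prod_pos fun j _ => sub_pos.2 (hl1 j)
  have h2 : 0 < ∏ j, (1 - mu j) := Finset.prod_pos fun j _ => sub_pos.2 (hm1 j)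
  have h3 : ∀ j, 1 + δ j ≠ 0 := fun j => by linarith [hδ0 j]
  rw [Real.log_mul (mul_pos (Real.rpow_pos_of_pos h1 _) (Real.rpow_pos_of_pos h2 _)).ne'
    (Finset.prod_ne_zero_iff.2 fun j _ => h3 j),
    Real.log_mul (Real.rpow_pos_of_pos h1 _).ne' (Real.rpow_pos_of_pos h2 _).ne',
    Real.log_rpow h1, Real.log_rpow h2, Real.log_prod fun j _ => (sub_pos.2 (hl1 j)).ne',
    Real.log_prod fun j _ => (sub_pos.2 (hm1 j)).ne', Real.log_prod fun j _ => h3 j]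

end QuasiFreeDensity

/-! ### Calculus of approximate left eigenvectors -/

section ApproximateEigenvectors

open scoped Matrix

variable {d : Type*} [Fintype d]

/-- The Euclidean norm of a vector. -/
noncomputable def eucl (v : d → ℂ) : ℝ := ‖(WithLp.toLp 2 v : EuclideanSpace ℂ d)‖

theorem eucl_nonneg (v : d → ℂ) : 0 ≤ eucl v := norm_nonneg _

theorem eucl_sq (v : d → ℂ) : eucl v ^ 2 = ∑ i, ‖v i‖ ^ 2 := by
  rw [eucl, EuclideanSpace.norm_sq_eq]

theorem eucl_add_le (v w : d → ℂ) : eucl (v + w) ≤ eucl v + eucl w := by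
  unfold eucl
  rw [WithLp.toLp_add]
  exact norm_add_le _ _

theorem eucl_smul (a : ℂ) (v : d → ℂ) : eucl (a • v) = ‖a‖ * eucl v := by
  unfold eucl
  rw [WithLp.toLp_smul, norm_smul]

theorem eucl_le_mul {v w : d → ℂ} {C : ℝ} (hC : 0 ≤ C) (h : ∀ i, ‖v i‖ ≤ C * ‖w i‖) :
    eucl v ≤ C * eucl w := by
  refine le_of_sq_le_sq ?_ (mul_nonneg hC (eucl_nonneg w))
  rw [mul_pow, eucl_sq, eucl_sq, Finset.mul_sum]
  refine Finset.sum_le_sum fun i _ => ?_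
  rw [← mul_pow]
  exact pow_le_pow_left₀ (norm_nonneg _) (h i) 2

theorem norm_dotProduct_star_le (v w : d → ℂ) : ‖v ⬝ᵥ star w‖ ≤ eucl v * eucl w := by
  have : v ⬝ᵥ star w = ⟪(WithLp.toLp 2 w : EuclideanSpace ℂ d), WithLp.toLp 2 v⟫_ℂ := by
    rw [EuclideanSpace.inner_eq_star_dotProduct]
  rw [this, mul_comm]
  exact norm_inner_le_norm _ _

/-- A product of matrices with a common approximate eigenvector. -/
theorem eucl_mul_le {A B : Matrix d d ℂ} {a b C : ℝ}
    (hB : ∀ v, eucl (v ᵥ* B) ≤ C * eucl v) (v : d → ℂ) :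
    eucl (v ᵥ* (A * B) - ((a * b : ℝ) : ℂ) • v)
      ≤ C * eucl (v ᵥ* A - (a : ℂ) • v) + |a| * eucl (v ᵥ* B - (b : ℂ) • v) := by
  have : v ᵥ* (A * B) - ((a * b : ℝ) : ℂ) • v
      = (v ᵥ* A - (a : ℂ) • v) ᵥ* B + (a : ℂ) • (v ᵥ* B - (b : ℂ) • v) := by
    rw [Matrix.sub_vecMul, Matrix.vecMul_vecMul, Matrix.smul_vecMul, smul_sub, smul_smul]
    push_cast
    abel
  rw [this]
  refine (eucl_add_le _ _).trans (add_le_add (hB _) ?_)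
  rw [eucl_smul, Complex.norm_real, Real.norm_eq_abs]

variable [DecidableEq d]

theorem eucl_vecMul_of_mul_conjTranspose {U : Matrix d d ℂ} (hU : U * U.conjTranspose = 1)
    (v : d → ℂ) : eucl (v ᵥ* U) = eucl v := by
  have h : ∀ v : d → ℂ, ((eucl v ^ 2 : ℝ) : ℂ) = v ⬝ᵥ star v := by
    intro v
    rw [eucl_sq, dotProduct]
    push_cast
    refine Finset.sum_congr rfl fun i _ => ?_
    rw [← Complex.mul_conj']; rfl
  have h2 : eucl (v ᵥ* U) ^ 2 = eucl v ^ 2 := by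
    refine Complex.ofReal_injective ?_
    rw [h, h, Matrix.star_vecMul, Matrix.dotProduct_mulVec, Matrix.vecMul_vecMul, hU,
      Matrix.vecMul_one]
  exact (sq_eq_sq₀ (eucl_nonneg _) (eucl_nonneg _)).1 h2

/-- In eigenbasis coordinates the defect is multiplication by $w_i-a$, and the unitary change of
basis preserves the norm. Bounds on functional calculus thus reduce to scalar inequalities on the
eigenvalues. -/
theorem eucl_vecMul_spectralMatrix_sub (U : Matrix.unitaryGroup d ℂ) (w : d → ℝ) (a : ℝ)
    (v : d → ℂ) : eucl (v ᵥ* spectralMatrix U w - (a : ℂ) • v)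
      = eucl fun i => ((w i - a : ℝ) : ℂ) * (v ᵥ* (U : Matrix d d ℂ)) i := by
  have h : v ᵥ* spectralMatrix U w - (a : ℂ) • v
      = (fun i => ((w i - a : ℝ) : ℂ) * (v ᵥ* (U : Matrix d d ℂ)) i)
        ᵥ* (U : Matrix d d ℂ).conjTranspose := by
    have h1 : (fun i => ((w i - a : ℝ) : ℂ) * (v ᵥ* (U : Matrix d d ℂ)) i)
        = (v ᵥ* (U : Matrix d d ℂ)) ᵥ* Matrix.diagonal (fun i => (w i : ℂ))
          - (a : ℂ) • (v ᵥ* (U : Matrix d d ℂ)) := by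
      ext i
      rw [Pi.sub_apply, Matrix.vecMul_diagonal, Pi.smul_apply, smul_eq_mul]
      push_cast
      ring
    rw [h1, Matrix.sub_vecMul, Matrix.smul_vecMul, Matrix.vecMul_vecMul, Matrix.vecMul_vecMul,
      Matrix.vecMul_vecMul, unitary_mul_conjTranspose, Matrix.vecMul_one, spectralMatrix,
      Matrix.mul_assoc]
  rw [h, eucl_vecMul_of_mul_conjTranspose]
  rw [Matrix.conjTranspose_conjTranspose, unitary_conjTranspose_mul]

/-- Functional calculus with a Lipschitz function preserves approximate eigenvectors. -/
theorem eucl_functional_calculus_le (U : Matrix.unitaryGroup d ℂ) {w f : d → ℝ} {a b L : ℝ}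
    (hL : 0 ≤ L) (h : ∀ i, |f i - b| ≤ L * |w i - a|) (v : d → ℂ) :
    eucl (v ᵥ* spectralMatrix U f - (b : ℂ) • v)
      ≤ L * eucl (v ᵥ* spectralMatrix U w - (a : ℂ) • v) := by
  rw [eucl_vecMul_spectralMatrix_sub, eucl_vecMul_spectralMatrix_sub]
  refine eucl_le_mul hL fun i => ?_
  rw [norm_mul, norm_mul, ← mul_assoc, Complex.norm_real, Complex.norm_real]
  exact mul_le_mul_of_nonneg_right (h i) (norm_nonneg _)

theorem eucl_vecMul_spectralMatrix_le (U : Matrix.unitaryGroup d ℂ) {w : d → ℝ} {C : ℝ}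
    (hC : 0 ≤ C) (h : ∀ i, |w i| ≤ C) (v : d → ℂ) : eucl (v ᵥ* spectralMatrix U w) ≤ C * eucl v := by
  have h1 := eucl_vecMul_spectralMatrix_sub U w 0 v
  simp only [Complex.ofReal_zero, zero_smul, sub_zero] at h1
  rw [h1, ← eucl_vecMul_of_mul_conjTranspose (unitary_mul_conjTranspose U) v]
  refine eucl_le_mul hC fun i => ?_
  rw [norm_mul, Complex.norm_real]
  exact mul_le_mul_of_nonneg_right (h i) (norm_nonneg _)

end ApproximateEigenvectors

/-! ### Lipschitz bounds uniform in the matrix size -/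

section LipschitzBounds

open scoped Matrix

theorem exists_lipschitz_of_hasDerivAt {f f' : ℝ → ℝ} {a b : ℝ}
    (hf : ∀ x ∈ Set.Icc a b, HasDerivAt f (f' x) x) (hf' : ContinuousOn f' (Set.Icc a b)) :
    ∃ L : ℝ, 0 ≤ L ∧ ∀ x ∈ Set.Icc a b, ∀ y ∈ Set.Icc a b, |f x - f y| ≤ L * |x - y| := by
  obtain ⟨L, hL⟩ := isCompact_Icc.exists_bound_of_continuousOn hf'
  refine ⟨|L|, abs_nonneg L, fun x hx y hy => ?_⟩
  exact (convex_Icc a b).norm_image_sub_le_of_norm_hasDerivWithin_le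
    (fun z hz => (hf z hz).hasDerivWithinAt) (fun z hz => (hL z hz).trans (le_abs_self L)) hy hx

variable {η : ℝ}

theorem one_sub_pos_of_mem (h : 0 < η) {x : ℝ} (hx : x ∈ Set.Icc η (1 - η)) : 0 < 1 - x := by
  linarith [hx.2]

theorem pos_of_mem (h : 0 < η) {x : ℝ} (hx : x ∈ Set.Icc η (1 - η)) : 0 < x :=
  h.trans_le hx.1

theorem continuousOn_odds_rpow (h : 0 < η) (s : ℝ) :
    ContinuousOn (fun x : ℝ => (x / (1 - x)) ^ s) (Set.Icc η (1 - η)) := by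
  refine ContinuousOn.rpow_const (ContinuousOn.div continuousOn_id
    (continuousOn_const.sub continuousOn_id) fun x hx => (one_sub_pos_of_mem h hx).ne') ?_
  exact fun x hx => Or.inl (div_pos (pos_of_mem h hx) (one_sub_pos_of_mem h hx)).ne'

theorem exists_bound_odds_rpow (h : 0 < η) (s : ℝ) :
    ∃ C : ℝ, 0 ≤ C ∧ ∀ x ∈ Set.Icc η (1 - η), |(x / (1 - x)) ^ s| ≤ C := by
  obtain ⟨C, hC⟩ := isCompact_Icc.exists_bound_of_continuousOn (continuousOn_odds_rpow h s)
  exact ⟨|C|, abs_nonneg C, fun x hx => (hC x hx).trans (le_abs_self C)⟩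

theorem exists_lipschitz_odds_rpow (h : 0 < η) (s : ℝ) :
    ∃ L : ℝ, 0 ≤ L ∧ ∀ x ∈ Set.Icc η (1 - η), ∀ y ∈ Set.Icc η (1 - η),
      |(x / (1 - x)) ^ s - (y / (1 - y)) ^ s| ≤ L * |x - y| := by
  refine exists_lipschitz_of_hasDerivAt (f := fun x => (x / (1 - x)) ^ s)
    (f' := fun x => ((1 * (1 - x) - x * -1) / (1 - x) ^ 2) * s * (x / (1 - x)) ^ (s - 1))
    (fun x hx => ?_) ?_
  · have h1 : HasDerivAt (fun x : ℝ => 1 - x) (-1) x := by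
      simpa using (hasDerivAt_id x).const_sub 1
    exact ((hasDerivAt_id x).div h1 (one_sub_pos_of_mem h hx).ne').rpow_const
      (Or.inl (div_pos (pos_of_mem h hx) (one_sub_pos_of_mem h hx)).ne')
  · refine ContinuousOn.mul (ContinuousOn.mul (ContinuousOn.div (by fun_prop) (by fun_prop)
      fun x hx => pow_ne_zero 2 (one_sub_pos_of_mem h hx).ne') continuousOn_const)
      (continuousOn_odds_rpow h (s - 1))

theorem exists_lipschitz_log_one_sub (h : 0 < η) :
    ∃ L : ℝ, 0 ≤ L ∧ ∀ x ∈ Set.Icc η (1 - η), ∀ y ∈ Set.Icc η (1 - η),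
      |Real.log (1 - x) - Real.log (1 - y)| ≤ L * |x - y| := by
  refine exists_lipschitz_of_hasDerivAt (f := fun x => Real.log (1 - x))
    (f' := fun x => (-1) / (1 - x)) (fun x hx => ?_) ?_
  · have h1 : HasDerivAt (fun x : ℝ => 1 - x) (-1) x := by
      simpa using (hasDerivAt_id x).const_sub 1
    exact h1.log (one_sub_pos_of_mem h hx).ne'
  · exact ContinuousOn.div (by fun_prop) (by fun_prop) fun x hx => (one_sub_pos_of_mem h hx).ne'

theorem abs_log_one_add_sub_le {x y : ℝ} (hx : 0 ≤ x) (hy : 0 ≤ y) :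
    |Real.log (1 + x) - Real.log (1 + y)| ≤ |x - y| := by
  have key : ∀ {x y : ℝ}, 0 ≤ x → 0 ≤ y → Real.log (1 + x) - Real.log (1 + y) ≤ |x - y| := by
    intro x y hx hy
    rw [← Real.log_div (by positivity) (by positivity)]
    refine (Real.log_le_sub_one_of_pos (by positivity)).trans ?_
    have : (1 + x) / (1 + y) - 1 = (x - y) / (1 + y) := by field_simp; ring
    rw [this]
    calc (x - y) / (1 + y) ≤ |x - y| / (1 + y) := by gcongr; exact le_abs_self _
      _ ≤ |x - y| := div_le_self (abs_nonneg _) (by linarith)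
  rw [abs_le]
  exact ⟨by linarith [key hy hx, abs_sub_comm x y], key hx hy⟩

/-- The symbol of `Xₕ Y Xₕ`. -/
noncomputable def oddsProd (t a b : ℝ) : ℝ :=
  (a / (1 - a)) ^ (t / 2) * (b / (1 - b)) ^ (1 - t) * (a / (1 - a)) ^ (t / 2)

theorem oddsProd_nonneg (h : 0 < η) (t : ℝ) {a b : ℝ} (ha : a ∈ Set.Icc η (1 - η))
    (hb : b ∈ Set.Icc η (1 - η)) : 0 ≤ oddsProd t a b := by
  have := pos_of_mem h ha
  have := pos_of_mem h hb
  have := one_sub_pos_of_mem h ha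
  have := one_sub_pos_of_mem h hb
  unfold oddsProd
  positivity

/-- The functions applied to the two matrices are bounded and Lipschitz on $[\eta,1-\eta]$, so the
constant depends only on $\eta$ and $t$. Being independent of the dimension, it survives the limit
over boxes; commutativity of the two matrices is nowhere needed. -/
theorem exists_bound_log_one_add_spectralMatrix (h : 0 < η) (t : ℝ) :
    ∃ C : ℝ, 0 ≤ C ∧ ∀ (d : Type) [Fintype d] [DecidableEq d] (U V W : Matrix.unitaryGroup d ℂ)
      (lam mu δ : d → ℝ), (∀ i, lam i ∈ Set.Icc η (1 - η)) → (∀ i, mu i ∈ Set.Icc η (1 - η)) →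
      (∀ i, 0 ≤ δ i) →
      spectralMatrix U (fun j => (lam j / (1 - lam j)) ^ (t / 2)) *
        spectralMatrix V (fun j => (mu j / (1 - mu j)) ^ (1 - t)) *
        spectralMatrix U (fun j => (lam j / (1 - lam j)) ^ (t / 2)) = spectralMatrix W δ →
      ∀ a ∈ Set.Icc η (1 - η), ∀ b ∈ Set.Icc η (1 - η), ∀ v : d → ℂ,
      eucl (v ᵥ* spectralMatrix W (fun j => Real.log (1 + δ j))
        - (Real.log (1 + oddsProd t a b) : ℂ) • v)
        ≤ C * (eucl (v ᵥ* spectralMatrix U lam - (a : ℂ) • v)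
          + eucl (v ᵥ* spectralMatrix V mu - (b : ℂ) • v)) := by
  obtain ⟨C₁, hC₁, hb₁⟩ := exists_bound_odds_rpow h (t / 2)
  obtain ⟨C₂, hC₂, hb₂⟩ := exists_bound_odds_rpow h (1 - t)
  obtain ⟨L₁, hL₁, hl₁⟩ := exists_lipschitz_odds_rpow h (t / 2)
  obtain ⟨L₂, hL₂, hl₂⟩ := exists_lipschitz_odds_rpow h (1 - t)
  -- These are the coefficients of the two defects in the estimate for $XYX$ obtained by applying
  -- `eucl_mul_le` twice; their sum dominates each of them separately.
  refine ⟨C₁ * (C₂ * L₁) + C₁ * (C₁ * L₂) + C₁ * C₂ * L₁, by positivity, ?_⟩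
  intro d _ _ U V W lam mu δ hlam hmu hδ0 hδ a ha b hb v
  set X := spectralMatrix U (fun j => (lam j / (1 - lam j)) ^ (t / 2))
  set Y := spectralMatrix V (fun j => (mu j / (1 - mu j)) ^ (1 - t))
  set x := (a / (1 - a)) ^ (t / 2) with hx
  set y := (b / (1 - b)) ^ (1 - t) with hy
  set p := eucl (v ᵥ* spectralMatrix U lam - (a : ℂ) • v)
  set q := eucl (v ᵥ* spectralMatrix V mu - (b : ℂ) • v)
  have hp : 0 ≤ p := eucl_nonneg _
  have hq : 0 ≤ q := eucl_nonneg _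
  have hX : eucl (v ᵥ* X - (x : ℂ) • v) ≤ L₁ * p :=
    eucl_functional_calculus_le U hL₁ (fun i => hl₁ _ (hlam i) _ ha) v
  have hY : eucl (v ᵥ* Y - (y : ℂ) • v) ≤ L₂ * q :=
    eucl_functional_calculus_le V hL₂ (fun i => hl₂ _ (hmu i) _ hb) v
  have hXb : ∀ v, eucl (v ᵥ* X) ≤ C₁ * eucl v :=
    eucl_vecMul_spectralMatrix_le U hC₁ fun i => hb₁ _ (hlam i)
  have hYb : ∀ v, eucl (v ᵥ* Y) ≤ C₂ * eucl v :=
    eucl_vecMul_spectralMatrix_le V hC₂ fun i => hb₂ _ (hmu i)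
  have hxb : |x| ≤ C₁ := hb₁ a ha
  have hyb : |y| ≤ C₂ := hb₂ b hb
  have h1 : eucl (v ᵥ* (X * Y) - ((x * y : ℝ) : ℂ) • v) ≤ C₂ * (L₁ * p) + C₁ * (L₂ * q) :=
    (eucl_mul_le hYb v).trans (add_le_add (mul_le_mul_of_nonneg_left hX hC₂)
      (mul_le_mul hxb hY (eucl_nonneg _) hC₁))
  have h2 : eucl (v ᵥ* (X * Y * X) - ((x * y * x : ℝ) : ℂ) • v)
      ≤ C₁ * (C₂ * (L₁ * p) + C₁ * (L₂ * q)) + C₁ * C₂ * (L₁ * p) := by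
    refine (eucl_mul_le hXb v).trans (add_le_add (mul_le_mul_of_nonneg_left h1 hC₁) ?_)
    refine mul_le_mul ?_ hX (eucl_nonneg _) (by positivity)
    rw [abs_mul]
    exact mul_le_mul hxb hyb (abs_nonneg _) hC₁
  have hodd : oddsProd t a b = x * y * x := rfl
  rw [hδ, ← hodd] at h2
  have hz := oddsProd_nonneg h t ha hb
  clear_value X Y x y p q
  -- The function $\log(1+x)$ is $1$-Lipschitz on $[0,\infty)$, so nonnegativity of the $\delta_j$
  -- is enough and no upper bound on them is required.
  have h3 := eucl_functional_calculus_le W (w := δ) (f := fun j => Real.log (1 + δ j))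
    (a := oddsProd t a b) (b := Real.log (1 + oddsProd t a b)) zero_le_one
    (fun i => (abs_log_one_add_sub_le (hδ0 i) hz).trans (one_mul _).ge) v
  rw [one_mul] at h3
  refine (h3.trans h2).trans ?_
  have e1 : 0 ≤ C₁ * (C₂ * L₁) * q := by positivity
  have e2 : 0 ≤ C₁ * (C₁ * L₂) * p := by positivity
  have e3 : 0 ≤ C₁ * C₂ * L₁ * q := by positivity
  linarith

end LipschitzBounds

/-! ### Compressions of Fourier multipliers -/

section Compression

open scoped Matrix

variable {ν : ℕ}

theorem continuous_character (k : Lattice ν) : Continuous (character k) := by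
  unfold character; fun_prop

theorem norm_character (k : Lattice ν) (x : Fin ν → ℝ) : ‖character k x‖ = 1 := by
  have : Complex.I * ∑ i, (ofLex k i : ℂ) * (x i : ℂ)
      = ((∑ i, (ofLex k i : ℝ) * x i : ℝ) : ℂ) * Complex.I := by push_cast; ring
  rw [character, this, Complex.norm_exp_ofReal_mul_I]

theorem conj_character_mul (k l : Lattice ν) (x : Fin ν → ℝ) :
    (starRingEnd ℂ) (character k x) * character l x = character (l - k) x := by
  rw [character, character, character, ← Complex.exp_conj, ← Complex.exp_add]
  congr 1
  simp only [map_mul, Complex.conj_I, map_sum, map_intCast, Complex.conj_ofReal,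
    Finset.mul_sum, ← Finset.sum_add_distrib]
  refine Finset.sum_congr rfl fun i _ => ?_
  rw [ofLex_sub, Pi.sub_apply]
  push_cast
  ring

theorem integral_conj_character_mul (k l : Lattice ν) :
    ∫ x, (starRingEnd ℂ) (character k x) * character l x ∂cubeMeasure ν = if k = l then 1 else 0 := by
  have h := orthonormal_iff_ite.1 (orthonormal_character ν) k l
  rw [← h, L2.inner_def]
  refine integral_congr_ae ?_
  filter_upwards [(memLp_character k).coeFn_toLp, (memLp_character l).coeFn_toLp] with x hk hl
  rw [hk, hl, RCLike.inner_apply, mul_comm]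

/-- The matrix of the compression of `Q` to `l²(Λ)`. -/
noncomputable def compression {X : Type*} [LinearOrder X] (Q : EllTwo X →L[ℂ] EllTwo X)
    (Λ : Finset X) : Matrix Λ Λ ℂ :=
  Matrix.of fun l k => Q (delta (k : X)) (l : X)

theorem inner_emb_compression {X : Type*} [LinearOrder X] (Q : EllTwo X →L[ℂ] EllTwo X)
    {Λ : Finset X} (x y : Λ → ℂ) :
    ⟪emb y, Q (emb x)⟫_ℂ = star y ⬝ᵥ (compression Q Λ).mulVec x := by
  rw [inner_emb, dotProduct]
  refine Finset.sum_congr rfl fun l _ => ?_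
  congr 1
  rw [emb, map_sum, lp.coeFn_sum, Finset.sum_apply, Matrix.mulVec, dotProduct]
  refine Finset.sum_congr rfl fun k _ => ?_
  rw [map_smul, lp.coeFn_smul, Pi.smul_apply, smul_eq_mul, mul_comm]
  rfl

/-- The basis vector `delta` carries a decidability instance, and the one of the lexicographic
product and the one of the linear order are not syntactically equal; the statement is therefore made
for an arbitrary instance. -/
theorem fourier_delta_ae [D : DecidableEq (Lattice ν)] (k : Lattice ν) :
    fourier ν (delta k) =ᵐ[cubeMeasure ν] character k := by
  obtain rfl : D = fun a b => instDecidableEqLex (Fin ν → ℤ) a b := Subsingleton.elim _ _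
  rw [fourier_delta]
  exact (memLp_character k).coeFn_toLp

theorem fourier_emb_ae {Λ : Finset (Lattice ν)} (y : Λ → ℂ) :
    fourier ν (emb y) =ᵐ[cubeMeasure ν] fun x => ∑ k, y k * character (k : Lattice ν) x := by
  let : DecidableEq (Lattice ν) := fun a b => LinearOrder.toDecidableEq a b
  rw [emb, map_sum]
  refine (Lp.coeFn_finsetSum _ _).trans ?_
  have h : ∀ᵐ x ∂cubeMeasure ν, ∀ k : Λ, fourier ν (y k • delta (k : Lattice ν)) x
      = y k * character (k : Lattice ν) x := by
    rw [ae_all_iff]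
    intro k
    rw [map_smul]
    filter_upwards [Lp.coeFn_smul (y k) (fourier ν (delta (k : Lattice ν))),
      fourier_delta_ae (k : Lattice ν)] with x h1 h2
    rw [h1, Pi.smul_apply, h2, smul_eq_mul]
  filter_upwards [h] with x hx
  rw [Finset.sum_apply]
  exact Finset.sum_congr rfl fun k _ => hx k

theorem norm_sq_fourier (f : EllTwo (Lattice ν)) :
    ∫ x, ‖fourier ν f x‖ ^ 2 ∂cubeMeasure ν = ‖f‖ ^ 2 := by
  have h : ⟪fourier ν f, fourier ν f⟫_ℂ = ((‖f‖ ^ 2 : ℝ) : ℂ) := by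
    rw [LinearIsometry.inner_map_map, inner_self_eq_norm_sq_to_K]
    push_cast; rfl
  rw [L2.inner_def] at h
  refine Complex.ofReal_injective ?_
  rw [← h, ← integral_complex_ofReal]
  refine integral_congr_ae (ae_of_all _ fun x => ?_)
  simp only [inner_self_eq_norm_sq_to_K]
  push_cast; rfl

theorem integrable_norm_sq_fourier (f : EllTwo (Lattice ν)) :
    Integrable (fun x => ‖fourier ν f x‖ ^ 2) (cubeMeasure ν) :=
  (Lp.memLp (fourier ν f)).integrable_norm_pow two_ne_zero

variable {Q : EllTwo (Lattice ν) →L[ℂ] EllTwo (Lattice ν)} {q : (Fin ν → ℝ) → ℝ}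

theorem IsFourierMultiplier.inner_eq (hQ : IsFourierMultiplier Q q) (f g : EllTwo (Lattice ν)) :
    ⟪f, Q g⟫_ℂ = ∫ x, (q x : ℂ) * ⟪fourier ν f x, fourier ν g x⟫_ℂ ∂cubeMeasure ν := by
  rw [← LinearIsometry.inner_map_map (fourier ν), L2.inner_def]
  refine integral_congr_ae ?_
  filter_upwards [hQ g] with x hx
  rw [hx]
  simp only [RCLike.inner_apply]
  ring

theorem IsFourierMultiplier.isHermitian (hQ : IsFourierMultiplier Q q) (Λ : Finset (Lattice ν)) :
    (compression Q Λ).IsHermitian := by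
  let : DecidableEq (Lattice ν) := fun a b => LinearOrder.toDecidableEq a b
  ext l k
  rw [Matrix.conjTranspose_apply, compression, Matrix.of_apply, Matrix.of_apply,
    ← inner_delta, ← inner_delta, hQ.inner_eq, hQ.inner_eq, ← starRingEnd_apply, ← integral_conj]
  refine integral_congr_ae (ae_of_all _ fun x => ?_)
  simp only [map_mul, Complex.conj_ofReal, inner_conj_symm]

/-- By Plancherel the quadratic form is the mean of $q$ against the probability density $|Ff|^2$. -/
theorem IsFourierMultiplier.re_inner_mem_Icc (hQ : IsFourierMultiplier Q q) {a b : ℝ}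
    (hqm : AEStronglyMeasurable q (cubeMeasure ν))
    (hq : ∀ᵐ x ∂cubeMeasure ν, q x ∈ Set.Icc a b) {f : EllTwo (Lattice ν)} (hf : ‖f‖ = 1) :
    (⟪f, Q f⟫_ℂ).re ∈ Set.Icc a b := by
  have h1 : ⟪f, Q f⟫_ℂ = ((∫ x, q x * ‖fourier ν f x‖ ^ 2 ∂cubeMeasure ν : ℝ) : ℂ) := by
    rw [hQ.inner_eq, ← integral_complex_ofReal]
    refine integral_congr_ae (ae_of_all _ fun x => ?_)
    simp only [inner_self_eq_norm_sq_to_K]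
    push_cast; rfl
  have hI := integrable_norm_sq_fourier f
  have hqI : Integrable (fun x => q x * ‖fourier ν f x‖ ^ 2) (cubeMeasure ν) := by
    refine hI.bdd_mul (c := max |a| |b|) hqm ?_
    filter_upwards [hq] with x hx
    exact abs_le_max_abs_abs hx.1 hx.2
  have h2 : ∫ x, ‖fourier ν f x‖ ^ 2 ∂cubeMeasure ν = 1 := by rw [norm_sq_fourier, hf, one_pow]
  rw [h1, Complex.ofReal_re]
  constructor
  · calc a = ∫ x, a * ‖fourier ν f x‖ ^ 2 ∂cubeMeasure ν := by rw [integral_const_mul, h2, mul_one]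
      _ ≤ _ := integral_mono_ae (hI.const_mul a) hqI (by
        filter_upwards [hq] with x hx
        exact mul_le_mul_of_nonneg_right hx.1 (sq_nonneg _))
  · calc _ ≤ ∫ x, b * ‖fourier ν f x‖ ^ 2 ∂cubeMeasure ν := integral_mono_ae hqI (hI.const_mul b) (by
        filter_upwards [hq] with x hx
        exact mul_le_mul_of_nonneg_right hx.2 (sq_nonneg _))
      _ = b := by rw [integral_const_mul, h2, mul_one]

theorem norm_emb {X : Type*} [LinearOrder X] {Λ : Finset X} (x : Λ → ℂ) : ‖emb x‖ = eucl x := by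
  have h : ⟪emb x, emb x⟫_ℂ = ((eucl x ^ 2 : ℝ) : ℂ) := by
    rw [inner_emb, eucl_sq]
    push_cast
    refine Finset.sum_congr rfl fun k _ => ?_
    rw [emb_apply, ← Complex.conj_mul']
    rfl
  rw [inner_self_eq_norm_sq_to_K] at h
  have h' : ‖emb x‖ ^ 2 = eucl x ^ 2 := by
    refine Complex.ofReal_injective (Eq.trans ?_ h)
    push_cast; rfl
  exact (sq_eq_sq₀ (norm_nonneg _) (eucl_nonneg _)).1 h'

theorem spectralMatrix_mulVec_col {d : Type*} [Fintype d] [DecidableEq d]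
    (U : Matrix.unitaryGroup d ℂ) (w : d → ℝ) (i : d) :
    (spectralMatrix U w).mulVec ((U : Matrix d d ℂ).col i)
      = (w i : ℂ) • (U : Matrix d d ℂ).col i := by
  rw [← Matrix.mulVec_single_one, Matrix.mulVec_mulVec, spectralMatrix, Matrix.mul_assoc,
    unitary_conjTranspose_mul, Matrix.mul_one, ← Matrix.mulVec_mulVec, Matrix.diagonal_mulVec_single,
    ← Matrix.mulVec_smul, ← Pi.single_smul, smul_eq_mul]

theorem eucl_unitary_col {d : Type*} [Fintype d] [DecidableEq d]
    (U : Matrix.unitaryGroup d ℂ) (i : d) : eucl ((U : Matrix d d ℂ).col i) = 1 := by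
  have h := congrFun (congrFun (unitary_conjTranspose_mul U) i) i
  rw [Matrix.mul_apply, Matrix.one_apply_eq] at h
  have h' : eucl ((U : Matrix d d ℂ).col i) ^ 2 = 1 := by
    refine Complex.ofReal_injective ?_
    rw [eucl_sq, Complex.ofReal_one, ← h]
    push_cast
    refine Finset.sum_congr rfl fun k _ => ?_
    rw [← Complex.conj_mul']
    rfl
  exact (pow_eq_one_iff_of_nonneg (eucl_nonneg _) two_ne_zero).1 h'

/-- The eigenvalues of the compression lie in every interval which contains the values of the
symbol. -/
theorem IsFourierMultiplier.exists_compression_eq (hQ : IsFourierMultiplier Q q) {a b : ℝ}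
    (hqm : AEStronglyMeasurable q (cubeMeasure ν))
    (hq : ∀ᵐ x ∂cubeMeasure ν, q x ∈ Set.Icc a b) (Λ : Finset (Lattice ν)) :
    ∃ (U : Matrix.unitaryGroup Λ ℂ) (lam : Λ → ℝ), compression Q Λ = spectralMatrix U lam ∧
      ∀ i, lam i ∈ Set.Icc a b := by
  obtain ⟨U, hU⟩ := exists_eq_spectralMatrix (hQ.isHermitian Λ)
  refine ⟨U, _, hU, fun i => ?_⟩
  have h := hQ.re_inner_mem_Icc hqm hq (f := emb ((U : Matrix Λ Λ ℂ).col i))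
    (by rw [norm_emb, eucl_unitary_col])
  have h2 : star ((U : Matrix Λ Λ ℂ).col i) ⬝ᵥ (U : Matrix Λ Λ ℂ).col i = 1 := by
    have h := congrFun (congrFun (unitary_conjTranspose_mul U) i) i
    rw [Matrix.mul_apply, Matrix.one_apply_eq] at h
    exact h
  rw [inner_emb_compression, hU, spectralMatrix_mulVec_col, dotProduct_smul, h2, smul_eq_mul,
    mul_one, Complex.ofReal_re] at h
  exact h

/-- Shift invariance: the matrix entry of a multiplier is a Fourier coefficient of $q$ and depends
only on the difference of its indices. -/
theorem IsFourierMultiplier.apply_delta_add [DecidableEq (Lattice ν)]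
    (hQ : IsFourierMultiplier Q q) (k m : Lattice ν) :
    Q (delta k) (k + m) = Q (delta 0) m := by
  have h : ∀ k l : Lattice ν, Q (delta k) l
      = ∫ x, (q x : ℂ) * character (k - l) x ∂cubeMeasure ν := by
    intro k l
    rw [← inner_delta, hQ.inner_eq]
    refine integral_congr_ae ?_
    filter_upwards [fourier_delta_ae k, fourier_delta_ae l] with x hk hl
    rw [hk, hl, RCLike.inner_apply, mul_comm (character k x), conj_character_mul]
  rw [h, h]
  rw [sub_add_cancel_left, zero_sub]

end Compression

/-! ### Boundary effects of translations on boxes -/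

section BoxCounting

variable {ν : ℕ}

theorem mem_box {n : ℕ} {k : Lattice ν} : k ∈ box ν n ↔ ∀ i, 0 ≤ ofLex k i ∧ ofLex k i < n := by
  rw [box, Finset.mem_map]
  constructor
  · rintro ⟨f, hf, rfl⟩
    simpa [Fintype.mem_piFinset] using hf
  · intro h
    exact ⟨ofLex k, by simpa [Fintype.mem_piFinset] using h, rfl⟩

theorem card_box (n : ℕ) : (box ν n).card = n ^ ν := by
  simp [box]

/-- The intersection of a box with its translate is a product of integer intervals. -/
theorem card_filter_add_mem_box (n : ℕ) (m : Lattice ν) :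
    ((box ν n).filter fun k => k + m ∈ box ν n).card
      = ∏ i, (min (n : ℤ) (n - ofLex m i) - max 0 (-ofLex m i)).toNat := by
  have : (box ν n).filter (fun k => k + m ∈ box ν n)
      = (Fintype.piFinset fun i : Fin ν => Finset.Ico (max 0 (-ofLex m i))
        (min (n : ℤ) (n - ofLex m i))).map toLex.toEmbedding := by
    ext k
    rw [Finset.mem_filter, mem_box, mem_box, Finset.mem_map]
    constructor
    · rintro ⟨h1, h2⟩
      refine ⟨ofLex k, ?_, rfl⟩
      rw [Fintype.mem_piFinset]
      intro i
      have h1 := h1 i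
      have h2 := h2 i
      rw [ofLex_add, Pi.add_apply] at h2
      rw [Finset.mem_Ico]
      omega
    · rintro ⟨f, hf, rfl⟩
      rw [Fintype.mem_piFinset] at hf
      refine ⟨fun i => ?_, fun i => ?_⟩
      · have := Finset.mem_Ico.1 (hf i)
        change 0 ≤ f i ∧ f i < n
        omega
      · have := Finset.mem_Ico.1 (hf i)
        change 0 ≤ f i + ofLex m i ∧ f i + ofLex m i < n
        omega
  rw [this, Finset.card_map, Fintype.card_piFinset]
  simp

/-- The proportion of the points of a large box which a fixed translation moves out of it tends
to zero. -/
theorem tendsto_boundary_ratio (m : Lattice ν) :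
    Tendsto (fun n : ℕ => (∑ k ∈ box ν n, if k + m ∈ box ν n then (0 : ℝ) else 1) / (n : ℝ) ^ ν)
      atTop (𝓝 0) := by
  have h1 : Tendsto (fun n : ℕ => 1 - ∏ i : Fin ν, (1 - |(ofLex m i : ℝ)| / n)) atTop (𝓝 0) := by
    have : Tendsto (fun n : ℕ => ∏ i : Fin ν, (1 - |(ofLex m i : ℝ)| / n)) atTop
        (𝓝 (∏ i : Fin ν, (1 - 0))) :=
      tendsto_finsetProd _ fun i _ => tendsto_const_nhds.sub
        (tendsto_const_nhds.div_atTop tendsto_natCast_atTop_atTop)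
    simpa using this.const_sub 1
  refine h1.congr' ?_
  -- For such $n$ every side length $n-|m_i|$ is nonnegative, so `toNat` truncates nothing.
  have hev : ∀ᶠ n : ℕ in atTop, ∀ i, |ofLex m i| ≤ (n : ℤ) := by
    rw [eventually_all]
    intro i
    filter_upwards [eventually_ge_atTop (ofLex m i).natAbs] with n hn
    rw [Int.abs_eq_natAbs]
    omega
  filter_upwards [hev, eventually_gt_atTop 0] with n hn hn0
  have hsum : (∑ k ∈ box ν n, if k + m ∈ box ν n then (0 : ℝ) else 1)
      = (n : ℝ) ^ ν - ((box ν n).filter fun k => k + m ∈ box ν n).card := by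
    have : ∀ k ∈ box ν n, (if k + m ∈ box ν n then (0 : ℝ) else 1)
        = 1 - if k + m ∈ box ν n then (1 : ℝ) else 0 := fun k _ => by split_ifs <;> simp
    rw [Finset.sum_congr rfl this, Finset.sum_sub_distrib, Finset.sum_boole]
    simp [card_box]
  have hcard : (((box ν n).filter fun k => k + m ∈ box ν n).card : ℝ)
      = ∏ i : Fin ν, ((n : ℝ) - |(ofLex m i : ℝ)|) := by
    rw [card_filter_add_mem_box, Nat.cast_prod]
    refine Finset.prod_congr rfl fun i _ => ?_
    have h := hn i
    have h' : ((min (n : ℤ) (n - ofLex m i) - max 0 (-ofLex m i)).toNat : ℤ)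
        = n - |ofLex m i| := by
      rcases abs_cases (ofLex m i) with ⟨h1, _⟩ | ⟨h1, _⟩ <;> omega
    have h'' := congrArg (Int.cast : ℤ → ℝ) h'
    push_cast at h''
    exact_mod_cast h''
  have hn' : (n : ℝ) ≠ 0 := by positivity
  rw [hsum, hcard, sub_div, div_self (pow_ne_zero _ hn')]
  congr 1
  rw [show (n : ℝ) ^ ν = ∏ _i : Fin ν, (n : ℝ) by simp, ← Finset.prod_div_distrib]
  refine Finset.prod_congr rfl fun i _ => ?_
  rw [sub_div, div_self hn']

end BoxCounting

/-! ### The averaged defect of the character vectors, and traces -/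

section Defect

open scoped Matrix

variable {ν : ℕ} {Q : EllTwo (Lattice ν) →L[ℂ] EllTwo (Lattice ν)} {q : (Fin ν → ℝ) → ℝ}

/-- The values of the characters indexed by `Λ`. -/
noncomputable def charVec (Λ : Finset (Lattice ν)) (x : Fin ν → ℝ) : Λ → ℂ :=
  fun k => character (k : Lattice ν) x

theorem eucl_charVec_sq (Λ : Finset (Lattice ν)) (x : Fin ν → ℝ) :
    eucl (charVec Λ x) ^ 2 = Λ.card := by
  rw [eucl_sq]
  simp [charVec, norm_character]

/-- How far the vector of characters is from an eigenvector of `A` with eigenvalue `a x`. -/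
noncomputable def defect {Λ : Finset (Lattice ν)} (A : Matrix Λ Λ ℂ) (a : (Fin ν → ℝ) → ℝ)
    (x : Fin ν → ℝ) : ℝ :=
  eucl (charVec Λ x ᵥ* A - (a x : ℂ) • charVec Λ x)

theorem norm_sq_eq_tsum {X : Type*} (f : EllTwo X) : ‖f‖ ^ 2 = ∑' l, ‖f l‖ ^ 2 := by
  simpa using lp.norm_rpow_eq_tsum (p := 2) (by norm_num) f

theorem summable_norm_sq {X : Type*} (f : EllTwo X) : Summable fun l => ‖f l‖ ^ 2 := by
  simpa using (lp.memℓp f).summable (by norm_num)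

theorem emb_apply_of_notMem {X : Type*} [LinearOrder X] {Λ : Finset X} (x : Λ → ℂ) {i : X}
    (hi : i ∉ Λ) : emb x i = 0 := by
  rw [emb, lp.coeFn_sum, Finset.sum_apply]
  refine Finset.sum_eq_zero fun l _ => ?_
  have hl : i ≠ l := fun h => hi (h ▸ l.2)
  rw [lp.coeFn_smul, Pi.smul_apply, delta, lp.single_apply_ne _ _ _ hl, smul_zero]

theorem compression_apply [D : DecidableEq (Lattice ν)] {Λ : Finset (Lattice ν)} (l k : Λ) :
    compression Q Λ l k = Q (delta (k : Lattice ν)) (l : Lattice ν) := by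
  obtain rfl : D = fun a b => LinearOrder.toDecidableEq a b := Subsingleton.elim _ _
  rfl

/-- The component of `Q 1_k` outside of `Λ`. -/
noncomputable def outerPart (Q : EllTwo (Lattice ν) →L[ℂ] EllTwo (Lattice ν))
    (Λ : Finset (Lattice ν)) (k : Λ) : EllTwo (Lattice ν) :=
  emb ((compression Q Λ).col k) - Q (delta (k : Lattice ν))

/-- Inside $\Lambda$ the two terms cancel; outside, shift invariance refers every column of $Q$ back
to $Q1_0$ through the substitution $l=k+m$. -/
theorem norm_sq_outerPart (hQ : IsFourierMultiplier Q q) (Λ : Finset (Lattice ν)) (k : Λ) :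
    ‖outerPart Q Λ k‖ ^ 2
      = ∑' m, if (k : Lattice ν) + m ∈ Λ then 0 else ‖Q (delta 0) m‖ ^ 2 := by
  rw [norm_sq_eq_tsum, ← (Equiv.addLeft (k : Lattice ν)).tsum_eq]
  refine tsum_congr fun m => ?_
  rw [Equiv.coe_addLeft, outerPart, lp.coeFn_sub, Pi.sub_apply]
  split_ifs with h
  · have := emb_apply ((compression Q Λ).col k) ⟨_, h⟩
    rw [this, Matrix.col_apply, compression_apply]
    simp
  · rw [emb_apply_of_notMem _ h, zero_sub, norm_neg, hQ.apply_delta_add]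

/-- The $k$-th coordinate of $v_xA-q(x)v_x$ is the value at $x$ of the Fourier transform of
$PQ1_k-Q1_k$. The defect is therefore pure truncation error, and Plancherel integrates its square.
-/
theorem defect_sq_ae (hQ : IsFourierMultiplier Q q) (Λ : Finset (Lattice ν)) :
    (fun x => defect (compression Q Λ) q x ^ 2) =ᵐ[cubeMeasure ν]
      fun x => ∑ k, ‖fourier ν (outerPart Q Λ k) x‖ ^ 2 := by
  have h : ∀ᵐ x ∂cubeMeasure ν, ∀ k : Λ, fourier ν (outerPart Q Λ k) x
      = (charVec Λ x ᵥ* compression Q Λ - (q x : ℂ) • charVec Λ x) k := by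
    rw [ae_all_iff]
    intro k
    rw [outerPart, map_sub]
    filter_upwards [Lp.coeFn_sub (fourier ν (emb ((compression Q Λ).col k)))
      (fourier ν (Q (delta (k : Lattice ν)))), fourier_emb_ae ((compression Q Λ).col k),
      hQ (delta (k : Lattice ν)), fourier_delta_ae (k : Lattice ν)] with x h1 h2 h3 h4
    rw [h1, Pi.sub_apply, h2, Pi.sub_apply, Pi.smul_apply, smul_eq_mul]
    congr 1
    · simp only [Matrix.vecMul, dotProduct, charVec, Matrix.col_apply]
      exact Finset.sum_congr rfl fun l _ => mul_comm _ _
    · rw [h3, h4]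
      rfl
  filter_upwards [h] with x hx
  rw [defect, eucl_sq]
  exact Finset.sum_congr rfl fun k _ => by rw [hx]

theorem integral_defect_sq (hQ : IsFourierMultiplier Q q) (n : ℕ) :
    ∫ x, defect (compression Q (box ν n)) q x ^ 2 ∂cubeMeasure ν
      = ∑' m, (∑ k ∈ box ν n, if k + m ∈ box ν n then (0 : ℝ) else 1) * ‖Q (delta 0) m‖ ^ 2 := by
  rw [integral_congr_ae (defect_sq_ae hQ _), integral_finsetSum _
    fun k _ => integrable_norm_sq_fourier _]
  simp only [norm_sq_fourier, norm_sq_outerPart hQ]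
  have hs := summable_norm_sq (Q (delta 0))
  rw [← Summable.tsum_finsetSum fun k _ => ?_]
  · refine tsum_congr fun m => ?_
    rw [Finset.sum_mul, Finset.sum_coe_sort (box ν n)
      (fun k => if k + m ∈ box ν n then (0 : ℝ) else ‖Q (delta 0) m‖ ^ 2)]
    refine Finset.sum_congr rfl fun k _ => ?_
    split_ifs <;> simp
  · refine hs.of_nonneg_of_le (fun m => ?_) fun m => ?_
    · split_ifs <;> positivity
    · split_ifs
      · positivity
      · exact le_rfl

/-- Dominated convergence over $m$: the weight of $\|(Q1_0)(m)\|^2$ is the proportion of points that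
translation by $m$ moves out of the box, which is at most $1$ and tends to $0$. Square summability
of $Q1_0$ suffices, so no regularity of the symbol is required. -/
theorem tendsto_integral_defect_sq (hQ : IsFourierMultiplier Q q) :
    Tendsto (fun n : ℕ => (∫ x, defect (compression Q (box ν n)) q x ^ 2 ∂cubeMeasure ν)
      / (n : ℝ) ^ ν) atTop (𝓝 0) := by
  have hs := summable_norm_sq (Q (delta 0))
  have h := tendsto_tsum_of_dominated_convergence (𝓕 := atTop)
    (f := fun (n : ℕ) m => (∑ k ∈ box ν n, if k + m ∈ box ν n then (0 : ℝ) else 1) / (n : ℝ) ^ ν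
      * ‖Q (delta 0) m‖ ^ 2) (g := fun _ => 0) hs (fun m => ?_) (Eventually.of_forall fun n m => ?_)
  · rw [tsum_zero] at h
    refine h.congr fun n => ?_
    rw [integral_defect_sq hQ, ← tsum_div_const]
    exact tsum_congr fun m => by ring
  · simpa using (tendsto_boundary_ratio m).mul_const (‖Q (delta 0) m‖ ^ 2)
  · have h0 : (0 : ℝ) ≤ ∑ k ∈ box ν n, if k + m ∈ box ν n then (0 : ℝ) else 1 :=
      Finset.sum_nonneg fun k _ => by split_ifs <;> simp
    have h1 : (∑ k ∈ box ν n, if k + m ∈ box ν n then (0 : ℝ) else 1) ≤ (n : ℝ) ^ ν := by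
      calc _ ≤ ∑ k ∈ box ν n, (1 : ℝ) := Finset.sum_le_sum fun k _ => by split_ifs <;> simp
        _ = _ := by simp [card_box]
    rw [Real.norm_of_nonneg (by positivity)]
    exact mul_le_of_le_one_left (by positivity) (div_le_one_of_le₀ h1 (by positivity))

theorem aestronglyMeasurable_defect {Λ : Finset (Lattice ν)} (A : Matrix Λ Λ ℂ)
    {a : (Fin ν → ℝ) → ℝ} (ha : AEStronglyMeasurable a (cubeMeasure ν)) :
    AEStronglyMeasurable (defect A a) (cubeMeasure ν) := by
  have h : defect A a = fun x => Real.sqrt (∑ k, ‖(charVec Λ x ᵥ* A) k - a x * charVec Λ x k‖ ^ 2) := by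
    ext x
    rw [defect, ← Real.sqrt_sq (eucl_nonneg _), eucl_sq]
    rfl
  rw [h]
  refine Real.continuous_sqrt.comp_aestronglyMeasurable ?_
  refine Finset.aestronglyMeasurable_fun_sum _ fun k _ => ?_
  refine ((AEStronglyMeasurable.sub ?_ ?_).norm).pow 2
  · refine Continuous.aestronglyMeasurable ?_
    simp only [Matrix.vecMul, dotProduct, charVec]
    exact continuous_finsetSum _ fun l _ => (continuous_character _).mul continuous_const
  · exact (Complex.continuous_ofReal.comp_aestronglyMeasurable ha).mul
      (continuous_character _).aestronglyMeasurable

theorem memLp_defect (hQ : IsFourierMultiplier Q q) (hqm : AEStronglyMeasurable q (cubeMeasure ν))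
    (Λ : Finset (Lattice ν)) : MemLp (defect (compression Q Λ) q) 2 (cubeMeasure ν) := by
  rw [memLp_two_iff_integrable_sq (aestronglyMeasurable_defect _ hqm)]
  refine Integrable.congr ?_ (defect_sq_ae hQ Λ).symm
  exact integrable_finsetSum _ fun k _ => integrable_norm_sq_fourier _

theorem sq_integral_le {Ω : Type*} [MeasurableSpace Ω] {μ : Measure Ω} [IsProbabilityMeasure μ]
    {f : Ω → ℝ} (hf : MemLp f 2 μ) : (∫ x, f x ∂μ) ^ 2 ≤ ∫ x, f x ^ 2 ∂μ := by
  have h := ProbabilityTheory.variance_eq_sub hf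
  have h' := ProbabilityTheory.variance_nonneg f μ
  rw [h] at h'
  simpa using h'

/-- The square root of the box size is the norm of $v_x$, so this is the mean relative defect, the
form in which `abs_trace_sub_integral_le` uses it. -/
theorem tendsto_integral_defect (hQ : IsFourierMultiplier Q q)
    (hqm : AEStronglyMeasurable q (cubeMeasure ν)) :
    Tendsto (fun n : ℕ => (∫ x, defect (compression Q (box ν n)) q x ∂cubeMeasure ν)
      / Real.sqrt ((n : ℝ) ^ ν)) atTop (𝓝 0) := by
  have h := (Real.continuous_sqrt.tendsto 0).comp (tendsto_integral_defect_sq hQ)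
  rw [Real.sqrt_zero] at h
  refine squeeze_zero (fun n => ?_) (fun n => ?_) h
  · exact div_nonneg (integral_nonneg fun x => eucl_nonneg _) (Real.sqrt_nonneg _)
  · rw [Function.comp_apply, Real.sqrt_div' _ (by positivity)]
    gcongr
    exact Real.le_sqrt_of_sq_le (sq_integral_le (memLp_defect hQ hqm _))

/-- Approximate eigenvectors compute traces. -/
theorem abs_trace_sub_integral_le {Λ : Finset (Lattice ν)} (hΛ : Λ.Nonempty) (H : Matrix Λ Λ ℂ)
    {h g : (Fin ν → ℝ) → ℝ} (hh : Integrable h (cubeMeasure ν)) (hg : Integrable g (cubeMeasure ν))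
    (hle : ∀ᵐ x ∂cubeMeasure ν, defect H h x ≤ g x) :
    ‖H.trace / Λ.card - ((∫ x, h x ∂cubeMeasure ν : ℝ) : ℂ)‖
      ≤ (∫ x, g x ∂cubeMeasure ν) / Real.sqrt Λ.card := by
  have hN : (0 : ℝ) < Λ.card := by exact_mod_cast hΛ.card_pos
  have hN' : (Λ.card : ℂ) ≠ 0 := by exact_mod_cast hN.ne'
  have hcont : ∀ k l : Λ, Integrable (fun x => character (k : Lattice ν) x * H k l *
      (starRingEnd ℂ) (character (l : Lattice ν) x)) (cubeMeasure ν) := by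
    intro k l
    refine Integrable.of_bound (C := ‖H k l‖) ?_ (ae_of_all _ fun x => ?_)
    · exact (((continuous_character _).mul continuous_const).mul
        (Complex.continuous_conj.comp (continuous_character _))).aestronglyMeasurable
    · simp [norm_character]
  have hform : ∀ x, (charVec Λ x ᵥ* H) ⬝ᵥ star (charVec Λ x)
      = ∑ l : Λ, ∑ k : Λ, character (k : Lattice ν) x * H k l *
        (starRingEnd ℂ) (character (l : Lattice ν) x) := by
    intro x
    simp only [dotProduct, Matrix.vecMul, Finset.sum_mul]
    rfl
  -- Orthonormality of the characters keeps only the diagonal entries of $H$ in the average.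
  have htr : H.trace = ∫ x, (charVec Λ x ᵥ* H) ⬝ᵥ star (charVec Λ x) ∂cubeMeasure ν := by
    simp only [hform]
    rw [integral_finsetSum _ fun l _ => integrable_finsetSum _ fun k _ => hcont k l]
    refine Finset.sum_congr rfl fun l _ => ?_
    rw [integral_finsetSum _ fun k _ => hcont k l]
    have : ∀ k : Λ, ∫ x, character (k : Lattice ν) x * H k l *
        (starRingEnd ℂ) (character (l : Lattice ν) x) ∂cubeMeasure ν
        = if l = k then H k l else 0 := by
      intro k
      have h1 := integral_conj_character_mul (l : Lattice ν) (k : Lattice ν)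
      have h2 : ∀ x, character (k : Lattice ν) x * H k l *
        (starRingEnd ℂ) (character (l : Lattice ν) x)
        = H k l * ((starRingEnd ℂ) (character (l : Lattice ν) x) *
          character (k : Lattice ν) x) := fun x => by ring
      simp only [h2]
      rw [integral_const_mul, h1]
      by_cases hkl : l = k
      · subst hkl; simp
      · have : (l : Lattice ν) ≠ k := fun h => hkl (Subtype.ext h)
        simp [hkl, this]
    simp [this]
  have hcv : ∀ x, charVec Λ x ⬝ᵥ star (charVec Λ x) = Λ.card := by
    intro x
    have : ∀ k : Λ, charVec Λ x k * star (charVec Λ x) k = 1 := by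
      intro k
      rw [Pi.star_apply, ← starRingEnd_apply, Complex.mul_conj', charVec, norm_character]
      simp
    rw [dotProduct, Finset.sum_congr rfl fun k _ => this k]
    simp
  have hF : Integrable (fun x => (charVec Λ x ᵥ* H) ⬝ᵥ star (charVec Λ x)) (cubeMeasure ν) := by
    simp only [hform]
    exact integrable_finsetSum _ fun l _ => integrable_finsetSum _ fun k _ => hcont k l
  have hh' : Integrable (fun x => (h x : ℂ)) (cubeMeasure ν) := hh.ofReal (𝕜 := ℂ)
  have hdiff : H.trace / Λ.card - ((∫ x, h x ∂cubeMeasure ν : ℝ) : ℂ)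
      = ∫ x, (charVec Λ x ᵥ* H - (h x : ℂ) • charVec Λ x) ⬝ᵥ star (charVec Λ x) / Λ.card
        ∂cubeMeasure ν := by
    rw [htr, ← integral_div, ← integral_complex_ofReal, ← integral_sub (hF.div_const _) hh']
    refine integral_congr_ae (ae_of_all _ fun x => ?_)
    simp only
    rw [sub_dotProduct, smul_dotProduct, hcv, sub_div, smul_eq_mul, mul_div_cancel_right₀ _ hN']
  rw [hdiff, ← integral_div]
  refine norm_integral_le_of_norm_le (hg.div_const _) ?_
  filter_upwards [hle] with x hx
  rw [norm_div, Complex.norm_natCast]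
  have h1 := norm_dotProduct_star_le (charVec Λ x ᵥ* H - (h x : ℂ) • charVec Λ x) (charVec Λ x)
  have h2 : eucl (charVec Λ x) = Real.sqrt Λ.card := by
    rw [← eucl_charVec_sq Λ x, Real.sqrt_sq (eucl_nonneg _)]
  rw [h2] at h1
  -- Cauchy–Schwarz contributes $\|v_x\|=\sqrt{|\Lambda|}$, and division by $|\Lambda|$ leaves
  -- $1/\sqrt{|\Lambda|}$.
  rw [div_le_div_iff₀ hN (Real.sqrt_pos.2 hN)]
  calc _ ≤ (defect H h x * Real.sqrt Λ.card) * Real.sqrt Λ.card :=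
        mul_le_mul_of_nonneg_right h1 (Real.sqrt_nonneg _)
    _ = defect H h x * Λ.card := by rw [mul_assoc, Real.mul_self_sqrt hN.le]
    _ ≤ _ := mul_le_mul_of_nonneg_right hx hN.le

end Defect

/-! ### The limit function, its derivative, and convergence of subgradients -/

section LimitFunction

/-- The logarithm of `a^t b^(1-t) + (1-a)^t (1-b)^(1-t)`. -/
noncomputable def logChernoff (a b t : ℝ) : ℝ :=
  Real.log (a ^ t * b ^ (1 - t) + (1 - a) ^ t * (1 - b) ^ (1 - t))

/-- The derivative of `logChernoff` in its last variable. -/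
noncomputable def logChernoffDeriv (a b t : ℝ) : ℝ :=
  (a ^ t * b ^ (1 - t) * Real.log (a / b)
    + (1 - a) ^ t * (1 - b) ^ (1 - t) * Real.log ((1 - a) / (1 - b)))
    / (a ^ t * b ^ (1 - t) + (1 - a) ^ t * (1 - b) ^ (1 - t))

variable {η a b : ℝ}

theorem hasDerivAt_rpow_mul_rpow (ha : 0 < a) (hb : 0 < b) (t : ℝ) :
    HasDerivAt (fun t => a ^ t * b ^ (1 - t)) (a ^ t * b ^ (1 - t) * Real.log (a / b)) t := by
  have h1 : HasDerivAt (fun t : ℝ => a ^ t) (a ^ t * Real.log a) t :=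
    (Real.hasStrictDerivAt_const_rpow ha t).hasDerivAt
  have h2 : HasDerivAt (fun t : ℝ => b ^ (1 - t)) (b ^ (1 - t) * Real.log b * -1) t :=
    (Real.hasStrictDerivAt_const_rpow hb (1 - t)).hasDerivAt.comp t
      (by simpa using (hasDerivAt_id t).const_sub 1)
  refine (h1.mul h2).congr_deriv ?_
  rw [Real.log_div ha.ne' hb.ne']
  ring

theorem hasDerivAt_logChernoff (ha : a ∈ Set.Ioo (0 : ℝ) 1) (hb : b ∈ Set.Ioo (0 : ℝ) 1) (t : ℝ) :
    HasDerivAt (logChernoff a b) (logChernoffDeriv a b t) t := by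
  have ha' : 0 < 1 - a := sub_pos.2 ha.2
  have hb' : 0 < 1 - b := sub_pos.2 hb.2
  have hpos : 0 < a ^ t * b ^ (1 - t) + (1 - a) ^ t * (1 - b) ^ (1 - t) := by
    have := ha.1; have := hb.1; positivity
  exact ((hasDerivAt_rpow_mul_rpow ha.1 hb.1 t).add
    (hasDerivAt_rpow_mul_rpow ha' hb' t)).log hpos.ne'

theorem abs_log_div_le (hη : 0 < η) (ha : a ∈ Set.Icc η (1 - η)) (hb : b ∈ Set.Icc η (1 - η)) :
    |Real.log (a / b)| ≤ -2 * Real.log η := by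
  have key : ∀ {x : ℝ}, x ∈ Set.Icc η (1 - η) → Real.log η ≤ Real.log x ∧ Real.log x ≤ 0 :=
    fun {x} hx => ⟨Real.log_le_log hη hx.1,
      Real.log_nonpos (hη.le.trans hx.1) (by linarith [hx.2])⟩
  rw [Real.log_div (pos_of_mem hη ha).ne' (pos_of_mem hη hb).ne', abs_le]
  constructor <;> linarith [(key ha).1, (key ha).2, (key hb).1, (key hb).2]

theorem one_sub_mem_Icc (ha : a ∈ Set.Icc η (1 - η)) : 1 - a ∈ Set.Icc η (1 - η) :=
  ⟨by linarith [ha.2], by linarith [ha.1]⟩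

theorem mem_Ioo_of_mem_Icc (hη : 0 < η) (ha : a ∈ Set.Icc η (1 - η)) : a ∈ Set.Ioo (0 : ℝ) 1 :=
  ⟨pos_of_mem hη ha, sub_pos.1 (one_sub_pos_of_mem hη ha)⟩

/-- The derivative is a weighted mean of the two log ratios, each bounded by $-2\log\eta$. The bound
does not involve $t$, so it dominates globally when differentiating under the integral. -/
theorem abs_logChernoffDeriv_le (hη : 0 < η) (ha : a ∈ Set.Icc η (1 - η))
    (hb : b ∈ Set.Icc η (1 - η)) (t : ℝ) : |logChernoffDeriv a b t| ≤ -2 * Real.log η := by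
  have h1 := abs_log_div_le hη ha hb
  have h2 := abs_log_div_le hη (one_sub_mem_Icc ha) (one_sub_mem_Icc hb)
  have ha0 := pos_of_mem hη ha
  have hb0 := pos_of_mem hη hb
  have ha' := one_sub_pos_of_mem hη ha
  have hb' := one_sub_pos_of_mem hη hb
  have hp : 0 < a ^ t * b ^ (1 - t) := by positivity
  have hp' : 0 < (1 - a) ^ t * (1 - b) ^ (1 - t) := by positivity
  rw [logChernoffDeriv, abs_div, abs_of_pos (add_pos hp hp'), div_le_iff₀ (add_pos hp hp')]
  refine (abs_add_le _ _).trans ?_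
  rw [abs_mul (a ^ t * b ^ (1 - t)), abs_mul ((1 - a) ^ t * (1 - b) ^ (1 - t)), abs_of_pos hp, abs_of_pos hp', mul_add]
  refine add_le_add ?_ ?_
  · rw [mul_comm]; exact mul_le_mul_of_nonneg_right h1 hp.le
  · rw [mul_comm]; exact mul_le_mul_of_nonneg_right h2 hp'.le

theorem logChernoff_one (a b : ℝ) : logChernoff a b 1 = 0 := by simp [logChernoff]

theorem logChernoffDeriv_one (a b : ℝ) : logChernoffDeriv a b 1
    = a * Real.log (a / b) + (1 - a) * Real.log ((1 - a) / (1 - b)) := by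
  simp [logChernoffDeriv]

theorem abs_logChernoff_le (hη : 0 < η) (ha : a ∈ Set.Icc η (1 - η))
    (hb : b ∈ Set.Icc η (1 - η)) (t : ℝ) : |logChernoff a b t| ≤ -2 * Real.log η * |t - 1| := by
  have h := convex_univ.norm_image_sub_le_of_norm_hasDerivWithin_le (x := (1 : ℝ)) (y := t)
    (fun s _ => (hasDerivAt_logChernoff (mem_Ioo_of_mem_Icc hη ha)
      (mem_Ioo_of_mem_Icc hη hb) s).hasDerivWithinAt)
    (fun s _ => abs_logChernoffDeriv_le hη ha hb s) (Set.mem_univ _) (Set.mem_univ _)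
  rwa [logChernoff_one, sub_zero] at h

/-- The scalar counterpart of `logTrPow_density`: it splits the limit integrand into the three terms
whose matrix versions have limits of Szegő type. -/
theorem logChernoff_eq (hη : 0 < η) (ha : a ∈ Set.Icc η (1 - η)) (hb : b ∈ Set.Icc η (1 - η))
    (t : ℝ) : logChernoff a b t
      = t * Real.log (1 - a) + (1 - t) * Real.log (1 - b) + Real.log (1 + oddsProd t a b) := by
  have ha0 := pos_of_mem hη ha
  have hb0 := pos_of_mem hη hb
  have ha' := one_sub_pos_of_mem hη ha
  have hb' := one_sub_pos_of_mem hη hb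
  have h1 := oddsProd_nonneg hη t ha hb
  have h2 : oddsProd t a b = a ^ t * b ^ (1 - t) / ((1 - a) ^ t * (1 - b) ^ (1 - t)) := by
    have : oddsProd t a b
        = ((a / (1 - a)) ^ (t / 2) * (a / (1 - a)) ^ (t / 2)) * (b / (1 - b)) ^ (1 - t) := by
      unfold oddsProd; ring
    rw [this, ← Real.rpow_add (by positivity), add_halves, Real.div_rpow ha0.le ha'.le,
      Real.div_rpow hb0.le hb'.le, div_mul_div_comm]
  have h3 : 0 < (1 - a) ^ t * (1 - b) ^ (1 - t) := by positivity
  have h4 : a ^ t * b ^ (1 - t) + (1 - a) ^ t * (1 - b) ^ (1 - t)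
      = (1 - a) ^ t * (1 - b) ^ (1 - t) * (1 + oddsProd t a b) := by
    rw [h2]; field_simp; ring
  rw [logChernoff, h4, Real.log_mul h3.ne' (by linarith), Real.log_mul (by positivity)
    (by positivity), Real.log_rpow ha', Real.log_rpow hb']

variable {ν : ℕ} {q r : (Fin ν → ℝ) → ℝ}

theorem aestronglyMeasurable_logChernoff (hqm : AEStronglyMeasurable q (cubeMeasure ν))
    (hrm : AEStronglyMeasurable r (cubeMeasure ν)) (t : ℝ) :
    AEStronglyMeasurable (fun x => logChernoff (q x) (r x) t) (cubeMeasure ν) := by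
  have h1 := hqm.aemeasurable
  have h2 := hrm.aemeasurable
  refine AEMeasurable.aestronglyMeasurable ?_
  exact Real.measurable_log.comp_aemeasurable
    (((h1.pow_const t).mul (h2.pow_const (1 - t))).add
      (((h1.const_sub 1).pow_const t).mul ((h2.const_sub 1).pow_const (1 - t))))

theorem aestronglyMeasurable_logChernoffDeriv (hqm : AEStronglyMeasurable q (cubeMeasure ν))
    (hrm : AEStronglyMeasurable r (cubeMeasure ν)) (t : ℝ) :
    AEStronglyMeasurable (fun x => logChernoffDeriv (q x) (r x) t) (cubeMeasure ν) := by
  have h1 := hqm.aemeasurable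
  have h2 := hrm.aemeasurable
  have h3 := ((h1.pow_const t).mul (h2.pow_const (1 - t)))
  have h4 := (((h1.const_sub 1).pow_const t).mul ((h2.const_sub 1).pow_const (1 - t)))
  refine AEMeasurable.aestronglyMeasurable ?_
  exact ((h3.mul (Real.measurable_log.comp_aemeasurable (h1.div h2))).add
    (h4.mul (Real.measurable_log.comp_aemeasurable ((h1.const_sub 1).div (h2.const_sub 1))))).div
    (h3.add h4)

theorem integrable_logChernoff (hη : 0 < η) (hqm : AEStronglyMeasurable q (cubeMeasure ν))
    (hrm : AEStronglyMeasurable r (cubeMeasure ν))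
    (hq : ∀ᵐ x ∂cubeMeasure ν, q x ∈ Set.Icc η (1 - η))
    (hr : ∀ᵐ x ∂cubeMeasure ν, r x ∈ Set.Icc η (1 - η)) (t : ℝ) :
    Integrable (fun x => logChernoff (q x) (r x) t) (cubeMeasure ν) := by
  refine Integrable.of_bound (C := -2 * Real.log η * |t - 1|)
    (aestronglyMeasurable_logChernoff hqm hrm t) ?_
  filter_upwards [hq, hr] with x h1 h2
  exact abs_logChernoff_le hη h1 h2 t

theorem hasDerivAt_integral_logChernoff (hη : 0 < η)
    (hqm : AEStronglyMeasurable q (cubeMeasure ν))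
    (hrm : AEStronglyMeasurable r (cubeMeasure ν))
    (hq : ∀ᵐ x ∂cubeMeasure ν, q x ∈ Set.Icc η (1 - η))
    (hr : ∀ᵐ x ∂cubeMeasure ν, r x ∈ Set.Icc η (1 - η)) (t : ℝ) :
    HasDerivAt (fun t => ∫ x, logChernoff (q x) (r x) t ∂cubeMeasure ν)
      (∫ x, logChernoffDeriv (q x) (r x) t ∂cubeMeasure ν) t := by
  refine (hasDerivAt_integral_of_dominated_loc_of_deriv_le (s := Set.univ)
    (F := fun t x => logChernoff (q x) (r x) t) (F' := fun t x => logChernoffDeriv (q x) (r x) t)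
    (bound := fun _ => -2 * Real.log η) univ_mem
    (Eventually.of_forall fun t => aestronglyMeasurable_logChernoff hqm hrm t)
    (integrable_logChernoff hη hqm hrm hq hr t) (aestronglyMeasurable_logChernoffDeriv hqm hrm t)
    ?_ (integrable_const _) ?_).2
  · filter_upwards [hq, hr] with x h1 h2 s _
    exact abs_logChernoffDeriv_le hη h1 h2 s
  · filter_upwards [hq, hr] with x h1 h2 s _
    exact hasDerivAt_logChernoff (mem_Ioo_of_mem_Icc hη h1) (mem_Ioo_of_mem_Icc hη h2) s

theorem integral_cubeMeasure (f : (Fin ν → ℝ) → ℝ) :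
    ∫ x, f x ∂cubeMeasure ν = 1 / (2 * Real.pi) ^ ν * ∫ x in cube ν, f x := by
  rw [cubeMeasure, integral_smul_measure, ENNReal.toReal_ofReal (by positivity), smul_eq_mul,
    one_div]

/-- If `L n` has subgradient `s n` at `1` and `L n 1 = 0`, and `L n` converges pointwise to a function
which is differentiable at `1`, then the subgradients converge to its derivative. -/
theorem tendsto_of_subgradient {s : ℕ → ℝ} {L : ℕ → ℝ → ℝ} {ψ : ℝ → ℝ} {S : ℝ}
    (hle : ∀ n h, h * s n ≤ L n (1 + h)) (hL : ∀ t, Tendsto (fun n => L n t) atTop (𝓝 (ψ t)))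
    (hψ : HasDerivAt ψ S 1) (h1 : ψ 1 = 0) : Tendsto s atTop (𝓝 S) := by
  have hs := hasDerivAt_iff_tendsto_slope_zero.1 hψ
  rw [tendsto_order] at hs ⊢
  constructor
  · intro b hb
    -- Dividing the subgradient inequality by a negative $h$ bounds $s_n$ from below by a difference
    -- quotient; positive $h$ gives the upper bound. Each time $h$ is fixed before $n$ tends to
    -- infinity, so pointwise convergence is enough.
    have h2 := (hs.1 b hb).filter_mono (nhdsWithin_mono (0 : ℝ) (fun x hx => ne_of_lt hx) :
      𝓝[<] (0 : ℝ) ≤ 𝓝[≠] 0)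
    obtain ⟨h, hh, hh0⟩ := (h2.and self_mem_nhdsWithin).exists
    have hh0 : h < 0 := hh0
    rw [h1, sub_zero, smul_eq_mul, inv_mul_eq_div, lt_div_iff_of_neg hh0] at hh
    filter_upwards [(tendsto_order.1 (hL (1 + h))).2 _ hh] with n hn
    have := (hle n h).trans_lt hn
    rw [mul_comm] at this
    exact lt_of_mul_lt_mul_of_nonpos_right this hh0.le
  · intro b hb
    have h2 := (hs.2 b hb).filter_mono (nhdsWithin_mono (0 : ℝ) (fun x hx => ne_of_gt hx) :
      𝓝[>] (0 : ℝ) ≤ 𝓝[≠] 0)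
    obtain ⟨h, hh, hh0⟩ := (h2.and self_mem_nhdsWithin).exists
    have hh0 : 0 < h := hh0
    rw [h1, sub_zero, smul_eq_mul, inv_mul_eq_div, div_lt_iff₀ hh0] at hh
    filter_upwards [(tendsto_order.1 (hL (1 + h))).2 _ hh] with n hn
    have := (hle n h).trans_lt hn
    rw [mul_comm] at this
    exact lt_of_mul_lt_mul_of_nonneg_right this hh0.le

end LimitFunction

/-! ### Local densities expressed through the compressed symbols -/

section LocalDensity

variable {X : Type*} [LinearOrder X] {ω φ : CAR X →ₗ[ℂ] ℂ} {Q R : EllTwo X →L[ℂ] EllTwo X}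
  {Λ : Finset X} {lam mu δ : Λ → ℝ}

theorem IsQuasiFree.logTrPow_localDensity [D : DecidableEq X] (hω : IsQuasiFree ω Q)
    (hφ : IsQuasiFree φ R) (U V W : Matrix.unitaryGroup Λ ℂ)
    (hU : compression Q Λ = spectralMatrix U lam) (hV : compression R Λ = spectralMatrix V mu)
    (hl : ∀ j, lam j ∈ Set.Ioo (0 : ℝ) 1) (hm : ∀ j, mu j ∈ Set.Ioo (0 : ℝ) 1) (t : ℝ)
    (hδ0 : ∀ j, 0 ≤ δ j)
    (hδ : spectralMatrix U (fun j => (lam j / (1 - lam j)) ^ (t / 2)) *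
      spectralMatrix V (fun j => (mu j / (1 - mu j)) ^ (1 - t)) *
      spectralMatrix U (fun j => (lam j / (1 - lam j)) ^ (t / 2)) = spectralMatrix W δ) :
    logTrPow (localDensity ω Λ) (localDensity φ Λ) t
      = t * ∑ j, Real.log (1 - lam j) + (1 - t) * ∑ j, Real.log (1 - mu j)
        + ∑ j, Real.log (1 + δ j) := by
  obtain rfl : D = fun a b => LinearOrder.toDecidableEq a b := Subsingleton.elim _ _
  rw [hω.localDensity_eq U (fun x y => by rw [inner_emb_compression, hU]) fun j => (hl j).2,
    hφ.localDensity_eq V (fun x y => by rw [inner_emb_compression, hV]) fun j => (hm j).2]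
  exact logTrPow_density U V W (fun j => (hl j).1) (fun j => (hl j).2) (fun j => (hm j).1)
    (fun j => (hm j).2) t hδ0 hδ

theorem IsQuasiFree.mul_relEntropy_localDensity_le [D : DecidableEq X] (hω : IsQuasiFree ω Q)
    (hφ : IsQuasiFree φ R) (U V : Matrix.unitaryGroup Λ ℂ)
    (hU : compression Q Λ = spectralMatrix U lam) (hV : compression R Λ = spectralMatrix V mu)
    (hl : ∀ j, lam j ∈ Set.Ioo (0 : ℝ) 1) (hm : ∀ j, mu j ∈ Set.Ioo (0 : ℝ) 1) (h : ℝ) :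
    h * relEntropy (localDensity ω Λ) (localDensity φ Λ)
      ≤ logTrPow (localDensity ω Λ) (localDensity φ Λ) (1 + h) := by
  obtain rfl : D = fun a b => LinearOrder.toDecidableEq a b := Subsingleton.elim _ _
  rw [hω.localDensity_eq U (fun x y => by rw [inner_emb_compression, hU]) fun j => (hl j).2,
    hφ.localDensity_eq V (fun x y => by rw [inner_emb_compression, hV]) fun j => (hm j).2]
  exact mul_relEntropy_le_logTrPow _ _
    (densityWeight_pos (fun j => (hl j).1) fun j => (hl j).2)
    (densityWeight_pos (fun j => (hm j).1) fun j => (hm j).2)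
    (sum_densityWeight U fun j => (hl j).2) h

end LocalDensity

/-! ### Passage to the limit over boxes -/

section Asymptotics

variable {ν : ℕ} {η : ℝ} {q r : (Fin ν → ℝ) → ℝ}
  {Q R : EllTwo (Lattice ν) →L[ℂ] EllTwo (Lattice ν)}

theorem box_nonempty {n : ℕ} (hn : 0 < n) : (box ν n).Nonempty := by
  rw [← Finset.card_pos, card_box]; positivity

/-- Normalized traces of matrices of which the characters are approximate eigenvectors converge. -/
theorem tendsto_sum_div (hQ : IsFourierMultiplier Q q) (hR : IsFourierMultiplier R r)
    (hqm : AEStronglyMeasurable q (cubeMeasure ν)) (hrm : AEStronglyMeasurable r (cubeMeasure ν))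
    {h : (Fin ν → ℝ) → ℝ} (hh : Integrable h (cubeMeasure ν)) {C : ℝ}
    (U : ∀ n, Matrix.unitaryGroup (box ν n) ℂ) (w : ∀ n, box ν n → ℝ)
    (hle : ∀ n, ∀ᵐ x ∂cubeMeasure ν, defect (spectralMatrix (U n) (w n)) h x
      ≤ C * (defect (compression Q (box ν n)) q x + defect (compression R (box ν n)) r x)) :
    Tendsto (fun n : ℕ => (∑ k, w n k) / (n : ℝ) ^ ν) atTop (𝓝 (∫ x, h x ∂cubeMeasure ν)) := by
  rw [tendsto_iff_norm_sub_tendsto_zero]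
  have h0 := ((tendsto_integral_defect hQ hqm).add (tendsto_integral_defect hR hrm)).const_mul C
  rw [add_zero, mul_zero] at h0
  refine squeeze_zero' (Eventually.of_forall fun n => norm_nonneg _) ?_ h0
  filter_upwards [eventually_gt_atTop 0] with n hn
  have hI1 := (memLp_defect hQ hqm (box ν n)).integrable one_le_two
  have hI2 := (memLp_defect hR hrm (box ν n)).integrable one_le_two
  have key := abs_trace_sub_integral_le (box_nonempty hn) _ hh ((hI1.add hI2).const_mul C) (hle n)
  rw [trace_spectralMatrix, card_box, integral_const_mul] at key
  have e : (((∑ k, w n k : ℝ) : ℂ) / ((n ^ ν : ℕ) : ℂ) - ((∫ x, h x ∂cubeMeasure ν : ℝ) : ℂ))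
      = (((∑ k, w n k) / (n : ℝ) ^ ν - ∫ x, h x ∂cubeMeasure ν : ℝ) : ℂ) := by push_cast; rfl
  rw [e, Complex.norm_real, Nat.cast_pow] at key
  refine key.trans (le_of_eq ?_)
  simp only [Pi.add_apply]
  rw [integral_add hI1 hI2]
  ring

/-- Positivity comes from $XYX=(\sqrt Y X)^*(\sqrt Y X)$. -/
theorem exists_conj_eq_spectralMatrix {d : Type*} [Fintype d] [DecidableEq d]
    (U V : Matrix.unitaryGroup d ℂ) (x y : d → ℝ) (hy : ∀ i, 0 ≤ y i) :
    ∃ (W : Matrix.unitaryGroup d ℂ) (δ : d → ℝ), (∀ i, 0 ≤ δ i) ∧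
      spectralMatrix U x * spectralMatrix V y * spectralMatrix U x = spectralMatrix W δ := by
  have h1 : spectralMatrix U x * spectralMatrix V y * spectralMatrix U x
      = (spectralMatrix V (fun i => Real.sqrt (y i)) * spectralMatrix U x).conjTranspose *
        (spectralMatrix V (fun i => Real.sqrt (y i)) * spectralMatrix U x) := by
    have : spectralMatrix V y = spectralMatrix V (fun i => Real.sqrt (y i)) *
        spectralMatrix V (fun i => Real.sqrt (y i)) := by
      rw [spectralMatrix_mul]
      congr 1
      ext i
      exact (Real.mul_self_sqrt (hy i)).symm
    rw [Matrix.conjTranspose_mul, spectralMatrix_conjTranspose, spectralMatrix_conjTranspose, this]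
    simp only [Matrix.mul_assoc]
  have hpsd : (spectralMatrix U x * spectralMatrix V y * spectralMatrix U x).PosSemidef := by
    rw [h1]; exact Matrix.posSemidef_conjTranspose_mul_self _
  obtain ⟨W, hW⟩ := exists_eq_spectralMatrix hpsd.isHermitian
  exact ⟨W, _, hpsd.eigenvalues_nonneg, hW⟩

theorem integrable_log_one_sub (hη : 0 < η) (hqm : AEStronglyMeasurable q (cubeMeasure ν))
    (hq : ∀ᵐ x ∂cubeMeasure ν, q x ∈ Set.Icc η (1 - η)) :
    Integrable (fun x => Real.log (1 - q x)) (cubeMeasure ν) := by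
  refine Integrable.of_bound (C := - Real.log η) (AEMeasurable.aestronglyMeasurable
    (Real.measurable_log.comp_aemeasurable (hqm.aemeasurable.const_sub 1))) ?_
  filter_upwards [hq] with x hx
  have hx' := one_sub_mem_Icc hx
  rw [Real.norm_eq_abs, abs_le]
  have h1 := Real.log_le_log hη hx'.1
  have h2 := Real.log_nonpos (hη.le.trans hx'.1) (by linarith [hx'.2])
  constructor <;> linarith

/-- Szegő type limit for the sum of `log (1 - λ)` over the eigenvalues of the compressions. -/
theorem tendsto_sum_log_one_sub (hη : 0 < η) (hQ : IsFourierMultiplier Q q)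
    (hqm : AEStronglyMeasurable q (cubeMeasure ν))
    (hq : ∀ᵐ x ∂cubeMeasure ν, q x ∈ Set.Icc η (1 - η))
    (U : ∀ n, Matrix.unitaryGroup (box ν n) ℂ) (lam : ∀ n, box ν n → ℝ)
    (hU : ∀ n, compression Q (box ν n) = spectralMatrix (U n) (lam n))
    (hlam : ∀ n i, lam n i ∈ Set.Icc η (1 - η)) :
    Tendsto (fun n : ℕ => (∑ k, Real.log (1 - lam n k)) / (n : ℝ) ^ ν) atTop
      (𝓝 (∫ x, Real.log (1 - q x) ∂cubeMeasure ν)) := by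
  obtain ⟨L, hL, hl⟩ := exists_lipschitz_log_one_sub hη
  -- Only one symbol is involved here, so it fills both slots of the two-symbol statement and the
  -- second defect is a harmless extra term.
  refine tendsto_sum_div hQ hQ hqm hqm (C := L) (integrable_log_one_sub hη hqm hq) U
    (fun n k => Real.log (1 - lam n k)) fun n => ?_
  filter_upwards [hq] with x hx
  have h1 : defect (spectralMatrix (U n) fun k => Real.log (1 - lam n k))
      (fun x => Real.log (1 - q x)) x ≤ L * defect (compression Q (box ν n)) q x := by
    rw [hU]
    exact eucl_functional_calculus_le (U n) hL (fun i => hl _ (hlam n i) _ hx) _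
  have h2 : 0 ≤ L * defect (compression Q (box ν n)) q x := mul_nonneg hL (eucl_nonneg _)
  rw [mul_add]
  linarith

variable {ω φ : CAR (Lattice ν) →ₗ[ℂ] ℂ}

theorem tendsto_logTrPow (hη : 0 < η) (hω : IsQuasiFree ω Q) (hφ : IsQuasiFree φ R)
    (hQ : IsFourierMultiplier Q q) (hR : IsFourierMultiplier R r)
    (hqm : AEStronglyMeasurable q (cubeMeasure ν)) (hrm : AEStronglyMeasurable r (cubeMeasure ν))
    (hq : ∀ᵐ x ∂cubeMeasure ν, q x ∈ Set.Icc η (1 - η))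
    (hr : ∀ᵐ x ∂cubeMeasure ν, r x ∈ Set.Icc η (1 - η)) (t : ℝ) :
    Tendsto (fun n : ℕ => 1 / (n : ℝ) ^ ν *
        logTrPow (localDensity ω (box ν n)) (localDensity φ (box ν n)) t) atTop
      (𝓝 (∫ x, logChernoff (q x) (r x) t ∂cubeMeasure ν)) := by
  choose U lam hU hlam using fun n => hQ.exists_compression_eq hqm hq (box ν n)
  choose V mu hV hmu using fun n => hR.exists_compression_eq hrm hr (box ν n)
  have hl := fun n i => mem_Ioo_of_mem_Icc hη (hlam n i)
  have hm := fun n i => mem_Ioo_of_mem_Icc hη (hmu n i)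
  choose W δ hδ0 hδ using fun n => exists_conj_eq_spectralMatrix (U n) (V n)
    (fun j => (lam n j / (1 - lam n j)) ^ (t / 2)) (fun j => (mu n j / (1 - mu n j)) ^ (1 - t))
    fun j => Real.rpow_nonneg (div_nonneg (hm n j).1.le (sub_pos.2 (hm n j).2).le) _
  obtain ⟨C, -, hCb⟩ := exists_bound_log_one_add_spectralMatrix hη t
  have hI1 := (integrable_log_one_sub hη hqm hq).const_mul t
  have hI2 := (integrable_log_one_sub hη hrm hr).const_mul (1 - t)
  have hG := integrable_logChernoff hη hqm hrm hq hr t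
  have hae : (fun x => logChernoff (q x) (r x) t) =ᵐ[cubeMeasure ν] fun x =>
      t * Real.log (1 - q x) + (1 - t) * Real.log (1 - r x)
        + Real.log (1 + oddsProd t (q x) (r x)) := by
    filter_upwards [hq, hr] with x h1 h2
    exact logChernoff_eq hη h1 h2 t
  -- Integrability of this term is inherited from the three other terms of the pointwise identity.
  have hI3 : Integrable (fun x => Real.log (1 + oddsProd t (q x) (r x))) (cubeMeasure ν) := by
    refine ((hG.sub hI1).sub hI2).congr ?_
    filter_upwards [hae] with x hx
    simp only [Pi.sub_apply, hx]
    ring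
  have h3 : Tendsto (fun n : ℕ => (∑ k, Real.log (1 + δ n k)) / (n : ℝ) ^ ν) atTop
      (𝓝 (∫ x, Real.log (1 + oddsProd t (q x) (r x)) ∂cubeMeasure ν)) := by
    refine tendsto_sum_div hQ hR hqm hrm (C := C) hI3 W (fun n k => Real.log (1 + δ n k))
      fun n => ?_
    filter_upwards [hq, hr] with x h1 h2
    rw [hU, hV]
    exact hCb _ (U n) (V n) (W n) (lam n) (mu n) (δ n) (hlam n) (hmu n) (hδ0 n) (hδ n) _ h1 _ h2 _
  have hI12 : Integrable (fun x => t * Real.log (1 - q x) + (1 - t) * Real.log (1 - r x))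
      (cubeMeasure ν) := hI1.add hI2
  rw [integral_congr_ae hae, integral_add hI12 hI3, integral_add hI1 hI2,
    integral_const_mul, integral_const_mul]
  have h1 := tendsto_sum_log_one_sub hη hQ hqm hq U lam hU hlam
  have h2 := tendsto_sum_log_one_sub hη hR hrm hr V mu hV hmu
  refine (((h1.const_mul t).add (h2.const_mul (1 - t))).add h3).congr fun n => ?_
  rw [hω.logTrPow_localDensity hφ (U n) (V n) (W n) (hU n) (hV n) (hl n) (hm n) t (hδ0 n) (hδ n)]
  ring

theorem mul_relEntropy_le (hη : 0 < η) (hω : IsQuasiFree ω Q) (hφ : IsQuasiFree φ R)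
    (hQ : IsFourierMultiplier Q q) (hR : IsFourierMultiplier R r)
    (hqm : AEStronglyMeasurable q (cubeMeasure ν)) (hrm : AEStronglyMeasurable r (cubeMeasure ν))
    (hq : ∀ᵐ x ∂cubeMeasure ν, q x ∈ Set.Icc η (1 - η))
    (hr : ∀ᵐ x ∂cubeMeasure ν, r x ∈ Set.Icc η (1 - η)) (Λ : Finset (Lattice ν)) (h : ℝ) :
    h * relEntropy (localDensity ω Λ) (localDensity φ Λ)
      ≤ logTrPow (localDensity ω Λ) (localDensity φ Λ) (1 + h) := by
  obtain ⟨U, lam, hU, hlam⟩ := hQ.exists_compression_eq hqm hq Λ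
  obtain ⟨V, mu, hV, hmu⟩ := hR.exists_compression_eq hrm hr Λ
  exact hω.mul_relEntropy_localDensity_le hφ U V hU hV (fun i => mem_Ioo_of_mem_Icc hη (hlam i))
    (fun i => mem_Ioo_of_mem_Icc hη (hmu i)) h

theorem ae_cubeMeasure_of_forall_mem {p : (Fin ν → ℝ) → Prop} (h : ∀ x ∈ cube ν, p x) :
    ∀ᵐ x ∂cubeMeasure ν, p x :=
  Measure.smul_absolutelyContinuous.ae_le (ae_restrict_of_forall_mem
    (MeasurableSet.univ_pi fun _ => measurableSet_Ico) h)

theorem aestronglyMeasurable_cubeMeasure (hq : AEMeasurable q (volume.restrict (cube ν))) :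
    AEStronglyMeasurable q (cubeMeasure ν) :=
  hq.aestronglyMeasurable.mono_ac Measure.smul_absolutelyContinuous

end Asymptotics

end QuasiFree

/-! ### The main theorem -/

open QuasiFree in
theorem proposition4p1 (ν : ℕ) (η : ℝ) (hη : η ∈ Set.Ioo (0 : ℝ) (1 / 2))
    (q r : (Fin ν → ℝ) → ℝ)
    (hq_meas : AEMeasurable q (volume.restrict (cube ν)))
    (hr_meas : AEMeasurable r (volume.restrict (cube ν)))
    (hq : ∀ x ∈ cube ν, q x ∈ Set.Icc η (1 - η))
    (hr : ∀ x ∈ cube ν, r x ∈ Set.Icc η (1 - η))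
    (Q R : EllTwo (Lattice ν) →L[ℂ] EllTwo (Lattice ν))
    (hQ : IsFourierMultiplier Q q) (hR : IsFourierMultiplier R r)
    (ω φ : CAR (Lattice ν) →ₗ[ℂ] ℂ)
    (hω : IsQuasiFree ω Q) (hφ : IsQuasiFree φ R) :
    ∃ (S : ℝ) (ψ : ℝ → ℝ),
      Tendsto (fun n : ℕ => 1 / (n : ℝ) ^ ν *
        relEntropy (localDensity ω (box ν n)) (localDensity φ (box ν n))) atTop (𝓝 S) ∧
      (∀ t : ℝ, Tendsto (fun n : ℕ => 1 / (n : ℝ) ^ ν *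
        logTrPow (localDensity ω (box ν n)) (localDensity φ (box ν n)) t) atTop (𝓝 (ψ t))) ∧
      S = 1 / (2 * Real.pi) ^ ν * ∫ x in cube ν,
        (q x * Real.log (q x / r x) + (1 - q x) * Real.log ((1 - q x) / (1 - r x))) ∧
      (∀ t : ℝ, ψ t = 1 / (2 * Real.pi) ^ ν * ∫ x in cube ν,
        Real.log (q x ^ t * r x ^ (1 - t) + (1 - q x) ^ t * (1 - r x) ^ (1 - t))) ∧
      Differentiable ℝ ψ ∧ HasDerivAt ψ S 1 := by
  have hqm := aestronglyMeasurable_cubeMeasure hq_meas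
  have hrm := aestronglyMeasurable_cubeMeasure hr_meas
  have hq' := ae_cubeMeasure_of_forall_mem hq
  have hr' := ae_cubeMeasure_of_forall_mem hr
  have hderiv := hasDerivAt_integral_logChernoff hη.1 hqm hrm hq' hr'
  have hlim := tendsto_logTrPow hη.1 hω hφ hQ hR hqm hrm hq' hr'
  refine ⟨_, _, ?_, hlim, ?_, fun t => integral_cubeMeasure _,
    fun t => (hderiv t).differentiableAt, hderiv 1⟩
  · refine tendsto_of_subgradient (L := fun n t => 1 / (n : ℝ) ^ ν *
        logTrPow (localDensity ω (box ν n)) (localDensity φ (box ν n)) t) (fun n h => ?_) hlim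
      (hderiv 1) (by simp only [logChernoff_one, integral_zero])
    -- The factor $1/n^\nu$ is nonnegative for every $n$, including $n=0$ with its default value of
    -- division by zero, so the subgradient inequality survives normalization.
    rw [mul_left_comm]
    exact mul_le_mul_of_nonneg_left (mul_relEntropy_le hη.1 hω hφ hQ hR hqm hrm hq' hr' _ h)
      (by positivity)
  · simp only [logChernoffDeriv_one]
    exact integral_cubeMeasure _
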